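/- Conventions. A deterministic polynomial-time (PT) algorithm is a polynomial-time uniform family $(C_n)_n$ of classical Boolean circuits, one for each input length $n$; a quantum polynomial-time algorithm (QPT) is a polynomial-time uniform family of quantum circuits over a fixed finite universal gate set of admissible operations, the $n$-th of which takes $n$-(qu)bit inputs. Polynomial-time uniform means that a Turing machine, on input $1^n$, prints a description of the $n$-th circuit in time polynomial in $n$. A function on bitstrings is PT-computable if some PT algorithm computes it. Probabilities are over the measurement of the output register of the QPT and over the indicated uniformly random strings, and $\operatorname{negl}(n)$ stands for some function $\varepsilon$ with $n^k\varepsilon(n)\to 0$ for every $k$. Let $f:\{0,1\}^*\to\{0,1\}^*$ be a quantum-secure one-way permutation (qOWP), that is: $f$ is PT-computable, $f$ restricts to a bijection of $\{0,1\}^n$ onto itself for every $n$, and for every QPT $\mathcal A$ $$\Pr_{x\in_R\{0,1\}^n}\bigl[\mathcal A(f(x),1^n)\in f^{-1}(f(x))\bigr]\le \operatorname{negl}(n).$$ Let $b:\{0,1\}^*\to\{0,1\}$ be a hard-core predicate of $f$, that is: $b$ is PT-computable and for every QPT $\mathcal A$ $$\Pr_{x\in_R\{0,1\}^n}\bigl[\mathcal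 A(f(x),1^n)=b(x)\bigr]\le \tfrac12+\operatorname{negl}(n).$$ Let $t=t(n)$ be a polynomial in $n$ (with rational coefficients) whose values at all integers $n\ge 1$ are non-negative integers. Then $$G:\{0,1\}^n\to\{0,1\}^{t(n)},\qquad G(s)=b(f^{t-1}(s))\,b(f^{t-2}(s))\cdots b(f(s))\,b(s),\qquad t=t(|s|),$$ is a quantum-secure pseudorandom generator, that is: $G$ is PT-computable and for every QPT $\mathcal D$ $$\Bigl|\Pr_{s\in_R\{0,1\}^n}[\mathcal D(G(s))=1]-\Pr_{y\in_R\{0,1\}^{t(n)}}[\mathcal D(y)=1]\Bigr|\le \operatorname{negl}(n).$$ -/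

import Mathlib

open scoped Matrix

namespace QuantumPRG

/-! ## Polynomial-time uniform families of descriptions -/

/-- The finite alphabet in which circuits with gate names `γ` are described: a wire number `i` is
written in unary as `tick ^ i sep`. -/
inductive Token (γ : Type) : Type
  | tick : Token γ
  | sep : Token γ
  | out : Token γ
  | gate (g : γ) : Token γ

/-- The unary description of a wire number. -/
def encodeWire {γ : Type} (i : ℕ) : List (Token γ) :=
  List.replicate i Token.tick ++ [Token.sep]

/-- The family `C` is polynomial-time uniform with respect to the description `enc`: there is a
Turing machine that on input `1ⁿ` prints the description of `C n` in time polynomial in `n`. -/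
def PolyTimeUniform {κ γ : Type} (enc : κ → List (Token γ)) (C : ℕ → κ) : Prop :=
  Nonempty (Turing.TM2ComputableInPolyTime Computability.unaryEncodeNat enc C)

/-! ## Classical Boolean circuits -/

/-- Names of the classical gates. -/
inductive BoolGateName : Type
  | zero : BoolGateName
  | nand : BoolGateName

/-- A classical gate together with the wires that it reads. -/
inductive BoolGate : Type
  | zero : BoolGate
  | nand (i j : ℕ) : BoolGate

/-- A Boolean circuit as a straight-line program. On `n` input bits the wires `0, …, n - 1` carry
the input, and the `k`-th gate (counted from `0`) writes to the new wire `n + k`. The output is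
read from the wires in `outs`. -/
structure BoolCircuit : Type where
  gates : List BoolGate
  outs : List ℕ

/-- The bit produced by a gate from the list of the values of the wires so far. -/
def BoolGate.eval (v : List Bool) : BoolGate → Bool
  | .zero => false
  | .nand i j => !(v.getD i false && v.getD j false)

/-- The gate reads only from the wires `0, …, m - 1`. -/
def BoolGate.ReadsBelow (m : ℕ) : BoolGate → Prop
  | .zero => True
  | .nand i j => i < m ∧ j < m

/-- The values of all wires after the circuit was run on the input `x`. -/
def BoolCircuit.wires (c : BoolCircuit) (x : List Bool) : List Bool :=
  c.gates.foldl (fun v g => v ++ [g.eval v]) x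

/-- The output of the circuit on the input `x`. -/
def BoolCircuit.eval (c : BoolCircuit) (x : List Bool) : List Bool :=
  c.outs.map fun i => (c.wires x).getD i false

/-- The circuit is a legal circuit on `n` input bits: every gate reads from earlier wires, and
every output wire exists. -/
def BoolCircuit.WellFormed (n : ℕ) (c : BoolCircuit) : Prop :=
  (∀ (k : ℕ) (hk : k < c.gates.length), (c.gates[k]).ReadsBelow (n + k)) ∧
    ∀ i ∈ c.outs, i < n + c.gates.length

/-- The description of a classical gate. -/
def BoolGate.encode : BoolGate → List (Token BoolGateName)
  | .zero => [Token.gate .zero]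
  | .nand i j => Token.gate .nand :: (encodeWire i ++ encodeWire j)

/-- The description of a Boolean circuit. -/
def BoolCircuit.encode (c : BoolCircuit) : List (Token BoolGateName) :=
  c.gates.flatMap BoolGate.encode ++ c.outs.flatMap fun i => Token.out :: encodeWire i

/-- `f` is computed by a deterministic polynomial-time algorithm, i.e. by a polynomial-time uniform
family of Boolean circuits with one circuit for each input length. -/
def PTComputable (f : List Bool → List Bool) : Prop :=
  ∃ C : ℕ → BoolCircuit, PolyTimeUniform BoolCircuit.encode C ∧
    (∀ n, (C n).WellFormed n) ∧ ∀ x : List Bool, (C x.length).eval x = f x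

/-! ## Quantum circuits -/

/-- Names of the quantum gates. `reset` discards a qubit and replaces it by a fresh `|0⟩`. -/
inductive QGateName : Type
  | X : QGateName
  | H : QGateName
  | T : QGateName
  | cnot : QGateName
  | toffoli : QGateName
  | reset : QGateName

/-- The number of qubits on which a gate acts. -/
@[reducible] def QGateName.arity : QGateName → ℕ
  | .X => 1
  | .H => 1
  | .T => 1
  | .cnot => 2
  | .toffoli => 3
  | .reset => 1

/-- Operators on `k` qubits in the computational basis `|z⟩`, `z : Fin k → Bool`. -/
abbrev QOp (k : ℕ) : Type := Matrix (Fin k → Bool) (Fin k → Bool) ℂ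

/-- The Kraus operators of a gate. -/
noncomputable def QGateName.kraus : (g : QGateName) → List (QOp g.arity)
  | .X => [Matrix.of fun a b : Fin 1 → Bool => if a 0 = !b 0 then 1 else 0]
  | .H => [Matrix.of fun a b : Fin 1 → Bool =>
      (if a 0 && b 0 then -1 else 1) / ((Real.sqrt 2 : ℝ) : ℂ)]
  | .T => [Matrix.of fun a b : Fin 1 → Bool =>
      if a 0 = b 0 then (if a 0 then Complex.exp (Complex.I * (Real.pi / 4 : ℝ)) else 1) else 0]
  | .cnot => [Matrix.of fun a b : Fin 2 → Bool =>
      if a 0 = b 0 ∧ a 1 = xor (b 1) (b 0) then 1 else 0]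
  | .toffoli => [Matrix.of fun a b : Fin 3 → Bool =>
      if a 0 = b 0 ∧ a 1 = b 1 ∧ a 2 = xor (b 2) (b 0 && b 1) then 1 else 0]
  | .reset => [Matrix.of fun a b : Fin 1 → Bool => if a 0 = false ∧ b 0 = false then 1 else 0,
      Matrix.of fun a b : Fin 1 → Bool => if a 0 = false ∧ b 0 = true then 1 else 0]

/-- The operator on `w` qubits that acts as `K` on the (ordered, distinct) wires `v` and as the
identity on all the others. -/
noncomputable def liftOp {k w : ℕ} (v : Fin k ↪ Fin w) (K : QOp k) : QOp w :=
  Matrix.of fun z z' =>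
    open Classical in
    if ∀ i : Fin w, i ∉ Set.range v → z i = z' i then
      K (fun j => z (v j)) (fun j => z' (v j)) else 0

/-- A gate placed on distinct wires of a register of `w` qubits. -/
structure QGate (w : ℕ) : Type where
  name : QGateName
  wires : Fin name.arity ↪ Fin w

/-- The admissible (completely positive, trace-preserving) map performed by a gate. -/
noncomputable def QGate.apply {w : ℕ} (g : QGate w) (ρ : QOp w) : QOp w :=
  (g.name.kraus.map fun K => liftOp g.wires K * ρ * (liftOp g.wires K)ᴴ).sum

/-- A quantum circuit on a register of `width` qubits. On an `n`-bit input the first `n` qubits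
carry the input and all the others start in `|0⟩`. At the end the qubits in `outs` are measured in
the computational basis and all the others are discarded. -/
structure QCircuit : Type where
  width : ℕ
  gates : List (QGate width)
  outs : List (Fin width)
  outs_nodup : outs.Nodup

/-- The computational basis state `|x, 0, …, 0⟩⟨x, 0, …, 0|` on `w` qubits. -/
noncomputable def inputState (w : ℕ) (x : List Bool) : QOp w :=
  Matrix.of fun z z' =>
    if z = (fun i : Fin w => x.getD i false) ∧ z' = (fun i : Fin w => x.getD i false) then 1 else 0

/-- The state of the whole register after all gates were applied. -/
noncomputable def QCircuit.finalState (c : QCircuit) (x : List Bool) : QOp c.width :=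
  c.gates.foldl (fun ρ g => g.apply ρ) (inputState c.width x)

/-- The probability that the measured output of the circuit on the input `x` lies in `E`. -/
noncomputable def QCircuit.prob (c : QCircuit) (x : List Bool) (E : Set (List Bool)) : ℝ :=
  open Classical in
  ∑ z : Fin c.width → Bool, if c.outs.map z ∈ E then (c.finalState x z z).re else 0

/-- The description of a gate on a register. -/
def QGate.encode {w : ℕ} (g : QGate w) : List (Token QGateName) :=
  Token.gate g.name :: (List.ofFn fun j => encodeWire (g.wires j : ℕ)).flatten

/-- The description of a quantum circuit. -/
def QCircuit.encode (c : QCircuit) : List (Token QGateName) :=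
  encodeWire c.width ++ c.gates.flatMap QGate.encode ++
    c.outs.flatMap fun i => Token.out :: encodeWire (i : ℕ)

/-- A quantum polynomial-time algorithm: a polynomial-time uniform family of quantum circuits, the
`n`-th of which accepts `n`-bit inputs. -/
structure QPT : Type where
  circuit : ℕ → QCircuit
  le_width : ∀ n, n ≤ (circuit n).width
  uniform : PolyTimeUniform QCircuit.encode circuit

/-- The probability that the output of the algorithm on the bitstring `x` lies in `E`. -/
noncomputable def QPT.prob (A : QPT) (x : List Bool) (E : Set (List Bool)) : ℝ :=
  (A.circuit x.length).prob x E

/-! ## Cryptographic notions -/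

/-- The expectation of `F x` for a uniformly random bitstring `x` of length `n`. -/
noncomputable def uniformMean (n : ℕ) (F : List Bool → ℝ) : ℝ :=
  (∑ x : Fin n → Bool, F (List.ofFn x)) / 2 ^ n

/-- `ε` decays faster than the inverse of every polynomial. -/
def Negligible (ε : ℕ → ℝ) : Prop :=
  Asymptotics.SuperpolynomialDecay Filter.atTop (fun n : ℕ => (n : ℝ)) ε

/-- The bitstring `1ⁿ 0 y`, which encodes the input pair `(y, 1ⁿ)`. -/
def withParam (y : List Bool) (n : ℕ) : List Bool :=
  List.replicate n true ++ false :: y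

/-- Quantum-secure one-way function. -/
def IsQOWF (f : List Bool → List Bool) : Prop :=
  PTComputable f ∧ ∀ A : QPT, ∃ ε : ℕ → ℝ, Negligible ε ∧ ∀ n : ℕ,
    uniformMean n (fun x => A.prob (withParam (f x) n) {x' | f x' = f x}) ≤ ε n

/-- Quantum-secure one-way permutation: a quantum-secure one-way function that permutes the
bitstrings of every length. -/
def IsQOWP (f : List Bool → List Bool) : Prop :=
  IsQOWF f ∧ ∀ n : ℕ, Set.BijOn f {x | x.length = n} {x | x.length = n}

/-- `b` is a hard-core predicate of `f`. -/
def IsHardCore (b : List Bool → Bool) (f : List Bool → List Bool) : Prop :=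
  PTComputable (fun x => [b x]) ∧ ∀ A : QPT, ∃ ε : ℕ → ℝ, Negligible ε ∧ ∀ n : ℕ,
    uniformMean n (fun x => A.prob (withParam (f x) n) {[b x]}) ≤ 1 / 2 + ε n

/-- `G` is a quantum-secure pseudorandom generator that maps `n` bits to `m n` bits. -/
def IsQPRG (m : ℕ → ℕ) (G : List Bool → List Bool) : Prop :=
  PTComputable G ∧ (∀ s : List Bool, (G s).length = m s.length) ∧
    ∀ D : QPT, ∃ ε : ℕ → ℝ, Negligible ε ∧ ∀ n : ℕ,
      |uniformMean n (fun s => D.prob (G s) {[true]}) -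
        uniformMean (m n) (fun y => D.prob y {[true]})| ≤ ε n

/-- The generator `s ↦ b(f^(t-1)(s)) b(f^(t-2)(s)) ⋯ b(f(s)) b(s)`, where `t = t(|s|)`. -/
def iteratedGenerator (f : List Bool → List Bool) (b : List Bool → Bool) (t : ℕ → ℕ)
    (s : List Bool) : List Bool :=
  ((List.range (t s.length)).reverse).map fun i => b (f^[i] s)

end QuantumPRG

/-! The security proof is the Blum–Micali–Yao hybrid argument. The `k`-th hybrid of a seed `s`
consists of the bits `b(f^(k-1)(s)) ⋯ b(s)` followed by `t - k` random bits; hybrid `0` is uniform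
and hybrid `t` is the output of the generator. Since the generator lists its bits in reverse order,
the first `u` bits of the `(u+1)`-th hybrid of `x` can be computed forwards from `y = f(x)`, and
precisely the next bit, `b(x)`, is missing. A predictor inserts a random guess for it, fills up with
random bits, runs the distinguisher and returns the guess or its negation according to the verdict.
For fixed `u` it is right with probability `1/2` plus the difference of the acceptance probabilities
on hybrid `u+1` of `x` and hybrid `u` of `f(x)` (`hybrid_term`). As `f` permutes the strings of each
length, `f(x)` may be replaced by `x` in the mean, and the sum over `u` telescopes to the advantage
of the distinguisher (`uniformMean_hybrid`).

Fair coins yield a uniform `u` only below a power of two. So `u` is drawn below the least power of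
two `T ≥ t`, and for `u ≥ t` the predictor succeeds with probability exactly `1/2`. Its advantage is
that of the distinguisher divided by `T ≤ 2t + 1`, a polynomial loss. One predictor is used for each
sign of the advantage (`security_iteratedGenerator`).

Most of the proof shows that the circuits of the generator and of the predictor are polynomial-time
uniform for actual Turing machines. Programs on stack machines are composed by flow charts
(`flow_node`), and `Comp` is the class of word-valued functions of unary tuples that they compute.
It contains the words printed by given machines (`comp_of_machine`), is closed under concatenation,
bounded loops and inspection of letters, and every function of one variable in it is printed by a
machine (`polyTimeUniform_of_comp`). All numbers are unary, so arithmetic and searches can be done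
by counting. The given circuits are read back from their descriptions (`boolCircuit_data`,
`qCircuit_data`), and the new descriptions are assembled from them.

The output distribution of the predictor (`predCircuit_prob`) follows by evaluating its gates on the
operators `|z⟩⟨z'|`. Classical gates permute basis states, a Hadamard gate followed by a discarded
copy is a fair coin (`run_coin`), and the gates of the distinguisher commute with adding idle wires
(`QGate.embed_apply`). -/

open scoped Matrix

namespace QuantumPRG

/-! ## Counting steps -/

/-- `b` is reached from `a` by exactly `t` applications of the partial function `f`. -/
inductive Steps {α : Type*} (f : α → Option α) : ℕ → α → α → Prop
  | refl (a : α) : Steps f 0 a a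
  | head {a b c : α} {t : ℕ} (h : f a = some b) (hs : Steps f t b c) : Steps f (t + 1) a c

theorem Steps.trans {α : Type*} {f : α → Option α} {s t : ℕ} {a b c : α}
    (h₁ : Steps f s a b) (h₂ : Steps f t b c) : Steps f (s + t) a c := by
  induction h₁ with
  | refl => simpa using h₂
  | head h _ ih => rw [Nat.add_right_comm]; exact Steps.head h (ih h₂)

theorem iterate_bind_none {α : Type*} (f : α → Option α) (t : ℕ) :
    (flip bind f)^[t] none = none := by
  induction t with
  | zero => rfl
  | succ t ih => rw [Function.iterate_succ_apply]; exact ih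

/-- Iteration of `flip bind f` is the form in which a run is stored in `TM2ComputableInPolyTime`;
`Steps` is the form in which runs concatenate. -/
theorem steps_iff_iterate {α : Type*} {f : α → Option α} {t : ℕ} {a b : α} :
    Steps f t a b ↔ (flip bind f)^[t] (some a) = some b := by
  induction t generalizing a with
  | zero =>
    constructor
    · rintro ⟨⟩; rfl
    · intro h; cases h; exact Steps.refl _
  | succ t ih =>
    rw [Function.iterate_succ_apply]
    have hb : flip bind f (some a) = f a := rfl
    rw [hb]
    constructor
    · rintro (_ | ⟨h, hs⟩)
      rw [h]; exact ih.1 hs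
    · intro h
      cases hfa : f a with
      | none => rw [hfa, iterate_bind_none] at h; cases h
      | some c => rw [hfa] at h; exact Steps.head hfa (ih.2 h)

/-! ## Embedding one stack machine into another -/

/-- The data by which a stack machine runs inside a larger one: its stacks, letters and labels are
renamed, and its internal state is one component of the larger internal state. -/
structure MachineEmb {K K' : Type} (Γ : K → Type) (Γ' : K' → Type) (Λ Λ' σ σ' : Type) where
  stack : K → K'
  stack_inj : Function.Injective stack
  enc : ∀ k, Γ k → Γ' (stack k)
  dec : ∀ k, Γ' (stack k) → Option (Γ k)
  dec_enc : ∀ k x, dec k (enc k x) = some x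
  get : σ' → σ
  set : σ → σ' → σ'
  get_set : ∀ a s, get (set a s) = a
  set_get : ∀ s, set (get s) s = s
  set_set : ∀ a b s, set a (set b s) = set a s
  label : Λ → Λ'

namespace MachineEmb

open Turing TM2

variable {K K' : Type} {Γ : K → Type} {Γ' : K' → Type} {Λ Λ' σ σ' : Type}
  (E : MachineEmb Γ Γ' Λ Λ' σ σ')

/-- The statement of the larger machine that performs `q` and continues with `ex` instead of
halting. -/
def stmt (ex : Stmt Γ' Λ' σ') : Stmt Γ Λ σ → Stmt Γ' Λ' σ'
  | .push k f q => .push (E.stack k) (fun s => E.enc k (f (E.get s))) (stmt ex q)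
  | .peek k f q =>
    .peek (E.stack k) (fun s o => E.set (f (E.get s) (o.bind (E.dec k))) s) (stmt ex q)
  | .pop k f q =>
    .pop (E.stack k) (fun s o => E.set (f (E.get s) (o.bind (E.dec k))) s) (stmt ex q)
  | .load a q => .load (fun s => E.set (a (E.get s)) s) (stmt ex q)
  | .branch f q₁ q₂ => .branch (fun s => f (E.get s)) (stmt ex q₁) (stmt ex q₂)
  | .goto f => .goto fun s => E.label (f (E.get s))
  | .halt => ex

theorem head?_bind_dec (k : K) (l : List (Γ k)) :
    ((l.map (E.enc k)).head?.bind (E.dec k)) = l.head? := by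
  cases l <;> simp [E.dec_enc]

variable [DecidableEq K']

theorem update_off {S' : ∀ k, List (Γ' k)} (k : K) (l : List (Γ' (E.stack k))) {j : K'}
    (hj : j ∉ Set.range E.stack) : Function.update S' (E.stack k) l j = S' j :=
  Function.update_of_ne (fun h => hj ⟨k, h.symm⟩) _ _

variable [DecidableEq K]

/-- What the larger machine does after it performed a statement that ended in configuration `c`. -/
def after (ex : Stmt Γ' Λ' σ') (s : σ') (T : ∀ k, List (Γ' k)) (c : Cfg Γ Λ σ) : Cfg Γ' Λ' σ' :=
  match c.l with
  | some l => ⟨some (E.label l), E.set c.var s, T⟩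
  | none => stepAux ex (E.set c.var s) T

theorem update_stack {S : ∀ k, List (Γ k)} {S' : ∀ k, List (Γ' k)}
    (hS : ∀ k, S' (E.stack k) = (S k).map (E.enc k)) (k : K) (l : List (Γ k)) (j : K) :
    Function.update S' (E.stack k) (l.map (E.enc k)) (E.stack j) =
      (Function.update S k l j).map (E.enc j) := by
  by_cases h : j = k
  · subst h; simp
  · rw [Function.update_of_ne (fun h' => h (E.stack_inj h')), Function.update_of_ne h, hS]

/-- Induction on the statement, with the invariant that embedded stacks hold the codes of the
original ones and all others are untouched. The resulting stacks `T` are only asserted to exist: the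
two clauses determine them, and no merged dependent function has to be written down. -/
theorem stepAux_stmt (ex : Stmt Γ' Λ' σ') (q : Stmt Γ Λ σ) :
    ∀ (s : σ') (S : ∀ k, List (Γ k)) (S' : ∀ k, List (Γ' k)),
      (∀ k, S' (E.stack k) = (S k).map (E.enc k)) →
      ∃ T, (∀ k, T (E.stack k) = ((stepAux q (E.get s) S).stk k).map (E.enc k)) ∧
        (∀ k, k ∉ Set.range E.stack → T k = S' k) ∧
        stepAux (E.stmt ex q) s S' = E.after ex s T (stepAux q (E.get s) S) := by
  induction q with
  | push k f q ih =>
    intro s S S' hS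
    have h := ih s (Function.update S k (f (E.get s) :: S k))
      (Function.update S' (E.stack k) (E.enc k (f (E.get s)) :: S' (E.stack k))) (by
        intro j
        rw [hS k, ← List.map_cons]
        exact E.update_stack hS k _ j)
    obtain ⟨T, h₁, h₂, h₃⟩ := h
    exact ⟨T, h₁, fun j hj => (h₂ j hj).trans (E.update_off k _ hj), h₃⟩
  | peek k f q ih =>
    intro s S S' hS
    have h := ih (E.set (f (E.get s) (S k).head?) s) S S' hS
    rw [E.get_set] at h
    obtain ⟨T, h₁, h₂, h₃⟩ := h
    refine ⟨T, h₁, h₂, ?_⟩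
    simp only [stmt, stepAux]
    rw [hS k, E.head?_bind_dec, h₃]
    simp only [after, E.set_set]
  | pop k f q ih =>
    intro s S S' hS
    have h := ih (E.set (f (E.get s) (S k).head?) s) (Function.update S k (S k).tail)
      (Function.update S' (E.stack k) (S' (E.stack k)).tail) (by
        intro j
        rw [hS k, ← List.map_tail]
        exact E.update_stack hS k _ j)
    rw [E.get_set] at h
    obtain ⟨T, h₁, h₂, h₃⟩ := h
    refine ⟨T, h₁, fun j hj => (h₂ j hj).trans (E.update_off k _ hj), ?_⟩
    simp only [stmt, stepAux]
    rw [hS k] at h₃ ⊢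
    rw [E.head?_bind_dec, h₃]
    simp only [after, E.set_set]
  | load a q ih =>
    intro s S S' hS
    have h := ih (E.set (a (E.get s)) s) S S' hS
    rw [E.get_set] at h
    obtain ⟨T, h₁, h₂, h₃⟩ := h
    refine ⟨T, h₁, h₂, ?_⟩
    simp only [stmt, stepAux]
    rw [h₃]
    simp only [after, E.set_set]
  | branch f q₁ q₂ ih₁ ih₂ =>
    intro s S S' hS
    simp only [stmt, stepAux]
    cases f (E.get s)
    · exact ih₂ s S S' hS
    · exact ih₁ s S S' hS
  | goto f =>
    intro s S S' hS
    exact ⟨S', hS, fun _ _ => rfl, by simp [stmt, after, E.set_get]⟩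
  | halt =>
    intro s S S' hS
    exact ⟨S', hS, fun _ _ => rfl, by simp [stmt, after, E.set_get]⟩

/-- A run of the embedded machine up to its halting is a run of the larger one. -/
theorem steps_of_steps {M : Λ → Stmt Γ Λ σ} {M' : Λ' → Stmt Γ' Λ' σ'} {ex : Stmt Γ' Λ' σ'}
    (hM : ∀ l, M' (E.label l) = E.stmt ex (M l)) {t : ℕ} {v : σ} {U : ∀ k, List (Γ k)} :
    ∀ {l : Λ} {s : σ'} {S : ∀ k, List (Γ k)} {S' : ∀ k, List (Γ' k)},
      (∀ k, S' (E.stack k) = (S k).map (E.enc k)) →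
      Steps (TM2.step M) t ⟨some l, E.get s, S⟩ ⟨none, v, U⟩ →
      ∃ T, (∀ k, T (E.stack k) = (U k).map (E.enc k)) ∧
        (∀ k, k ∉ Set.range E.stack → T k = S' k) ∧
        Steps (TM2.step M') t ⟨some (E.label l), s, S'⟩ (stepAux ex (E.set v s) T) := by
  induction t with
  | zero => intro l s S S' _ h; cases h
  | succ t ih =>
    intro l s S S' hS h
    obtain (_ | ⟨h₁, hs⟩) := h
    rename_i b
    simp only [TM2.step, Option.some.injEq] at h₁
    obtain ⟨T, hT₁, hT₂, hT₃⟩ := E.stepAux_stmt ex (M l) s S S' hS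
    rw [h₁] at hT₁ hT₃
    have hstep : TM2.step M' ⟨some (E.label l), s, S'⟩ = some (E.after ex s T b) := by
      simp only [TM2.step, hM, hT₃]
    -- If this step halts the small machine, then `ex` has been performed within the same step, so
    -- both runs have the same length.
    obtain ⟨bl, bv, bS⟩ := b
    cases bl with
    | none =>
      cases hs with
      | refl => exact ⟨T, hT₁, hT₂, Steps.head hstep (Steps.refl _)⟩
      | head h _ => simp [TM2.step] at h
    | some l' =>
      obtain ⟨T', h₁', h₂', h₃'⟩ := ih (l := l') (s := E.set bv s) (S := bS) (S' := T) hT₁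
        (by rw [E.get_set]; exact hs)
      refine ⟨T', h₁', fun k hk => (h₂' k hk).trans (hT₂ k hk), Steps.head hstep ?_⟩
      rw [E.set_set] at h₃'
      exact h₃'

end MachineEmb

open Turing

/-! ## Program fragments over a common alphabet -/

/-- A stack machine over the stacks `R`, all with the alphabet `A`. -/
structure Frag (R A : Type) where
  Λ : Type
  σ : Type
  [finΛ : Finite Λ]
  [finσ : Finite σ]
  main : Λ
  init : σ
  m : Λ → TM2.Stmt (fun _ : R => A) Λ σ

attribute [instance] Frag.finΛ Frag.finσ

namespace Frag

variable {R A : Type} [DecidableEq R]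

/-- Started with the stacks `S`, the fragment halts within `T` steps, with the stacks `U` and the
internal state reset. -/
def Runs (P : Frag R A) (T : ℕ) (S U : R → List A) : Prop :=
  ∃ t ≤ T, Steps (TM2.step P.m) t ⟨some P.main, P.init, S⟩ ⟨none, P.init, U⟩

theorem Runs.mono {P : Frag R A} {T T' : ℕ} {S U : R → List A} (h : P.Runs T S U) (hT : T ≤ T') :
    P.Runs T' S U := by
  obtain ⟨t, ht, hs⟩ := h
  exact ⟨t, ht.trans hT, hs⟩

/-- The fragment that performs a single statement. -/
def prim (q : TM2.Stmt (fun _ : R => A) Unit Unit) : Frag R A where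
  Λ := Unit
  σ := Unit
  main := ()
  init := ()
  m _ := q

theorem prim_runs {q : TM2.Stmt (fun _ : R => A) Unit Unit} {S U : R → List A}
    (h : TM2.stepAux q () S = ⟨none, (), U⟩) : (prim q).Runs 1 S U :=
  ⟨1, le_rfl, Steps.head (by simp [prim, TM2.step, h]) (Steps.refl _)⟩

def skip : Frag R A := prim .halt

theorem skip_runs (S : R → List A) : (skip : Frag R A).Runs 1 S S := prim_runs rfl

/-- Push a word, the first letter first. -/
def pushWord (r : R) : List A → TM2.Stmt (fun _ : R => A) Unit Unit
  | [] => .halt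
  | a :: w => .push r (fun _ => a) (pushWord r w)

theorem pushWord_runs (r : R) (w : List A) (S : R → List A) :
    (prim (pushWord r w)).Runs 1 S (Function.update S r (w.reverse ++ S r)) := by
  apply prim_runs
  induction w generalizing S with
  | nil => simp [pushWord]
  | cons a w ih => simp only [pushWord, TM2.stepAux]; rw [ih]; simp

/-- Push single letters to several stacks. -/
def pushEach : List (R × A) → TM2.Stmt (fun _ : R => A) Unit Unit
  | [] => .halt
  | p :: w => .push p.1 (fun _ => p.2) (pushEach w)

def popOne (r : R) : Frag R A := prim (.pop r (fun _ _ => ()) .halt)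

theorem popOne_runs (r : R) (S : R → List A) :
    (popOne r : Frag R A).Runs 1 S (Function.update S r (S r).tail) := prim_runs rfl

/-! ### Renaming the stacks -/

/-- The fragment run by a machine whose stacks are among the stacks `R` and whose letters are
encoded by letters of `A`. -/
def ofMachine {K Λ σ : Type} {Γ : K → Type} [Finite Λ] [Finite σ] (M : Λ → TM2.Stmt Γ Λ σ)
    (main : Λ) (init : σ) (E : MachineEmb Γ (fun _ : R => A) Λ Λ σ σ) : Frag R A where
  Λ := Λ
  σ := σ
  main := main
  init := init
  m l := E.stmt .halt (M l)

/-- Only stacks and letters are renamed here, while labels and internal states are those of the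
machine. The final stacks are forced: codes on the range of the renaming, unchanged elsewhere. -/
theorem ofMachine_runs {K Λ σ : Type} [DecidableEq K] {Γ : K → Type} [Finite Λ] [Finite σ]
    {M : Λ → TM2.Stmt Γ Λ σ} {main : Λ} {init : σ} {E : MachineEmb Γ (fun _ : R => A) Λ Λ σ σ}
    (hl : ∀ l, E.label l = l) (hg : ∀ s, E.get s = s) (hset : ∀ a s, E.set a s = a)
    {T t : ℕ} {S U : ∀ k, List (Γ k)}
    (h : Steps (TM2.step M) t ⟨some main, init, S⟩ ⟨none, init, U⟩) (ht : t ≤ T)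
    {S' U' : R → List A} (hS : ∀ k, S' (E.stack k) = (S k).map (E.enc k))
    (hU : ∀ k, U' (E.stack k) = (U k).map (E.enc k))
    (hoff : ∀ r, r ∉ Set.range E.stack → U' r = S' r) :
    (ofMachine M main init E).Runs T S' U' := by
  obtain ⟨V, h₁, h₂, h₃⟩ := E.steps_of_steps (M' := (ofMachine M main init E).m)
    (ex := .halt) (fun l => by rw [hl]; rfl) (s := init) hS (by rw [hg]; exact h)
  have hV : V = U' := by
    funext r
    by_cases hr : r ∈ Set.range E.stack
    · obtain ⟨k, rfl⟩ := hr; rw [h₁, hU]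
    · rw [h₂ r hr, hoff r hr]
  rw [hl, hset, hV] at h₃
  exact ⟨t, ht, h₃⟩

/-- The renaming of stacks as an embedding of machines. -/
def renameEmb {R' : Type} (e : R' ↪ R) (Λ σ : Type) :
    MachineEmb (fun _ : R' => A) (fun _ : R => A) Λ Λ σ σ where
  stack := e
  stack_inj := e.injective
  enc _ := id
  dec _ := some
  dec_enc _ _ := rfl
  get := id
  set a _ := a
  get_set _ _ := rfl
  set_get _ := rfl
  set_set _ _ _ := rfl
  label := id

def rename {R' : Type} (P : Frag R' A) (e : R' ↪ R) : Frag R A :=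
  ofMachine P.m P.main P.init (renameEmb e P.Λ P.σ)

theorem rename_runs {R' : Type} [DecidableEq R'] {P : Frag R' A} {e : R' ↪ R} {T : ℕ}
    {S' U' : R' → List A} {S U : R → List A} (h : P.Runs T S' U') (hS : ∀ k, S (e k) = S' k)
    (hU : ∀ k, U (e k) = U' k) (hoff : ∀ r, r ∉ Set.range e → U r = S r) :
    (P.rename e).Runs T S U := by
  obtain ⟨t, ht, hs⟩ := h
  exact ofMachine_runs (fun _ => rfl) (fun _ => rfl) (fun _ _ => rfl) hs ht
    (fun k => by simpa [renameEmb] using hS k) (fun k => by simpa [renameEmb] using hU k) hoff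

/-! ### Flow charts -/

section Flow

variable {N C : Type} [DecidableEq N] (P : N → Frag R A)

/-- Each node owns one component of a product of internal states, and a further component of type
`C` is reserved for control. Running a node changes only its own component. -/
def nodeEmb (C : Type) (n : N) :
    MachineEmb (fun _ : R => A) (fun _ : R => A) (P n).Λ (Σ n, (P n).Λ) (P n).σ
      (C × ∀ n, (P n).σ) where
  stack := id
  stack_inj := Function.injective_id
  enc _ := id
  dec _ := some
  dec_enc _ _ := rfl
  get s := s.2 n
  set a s := (s.1, Function.update s.2 n a)
  get_set _ _ := by simp
  set_get _ := by simp
  set_set _ _ _ := by simp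
  label l := ⟨n, l⟩

/-- Exit statements see only the control component; a jump to a node is a jump to the entry label of
its fragment. -/
def exitEmb (C : Type) :
    MachineEmb (fun _ : R => A) (fun _ : R => A) N (Σ n, (P n).Λ) C (C × ∀ n, (P n).σ) where
  stack := id
  stack_inj := Function.injective_id
  enc _ := id
  dec _ := some
  dec_enc _ _ := rfl
  get := Prod.fst
  set a s := (a, s.2)
  get_set _ _ := rfl
  set_get _ := rfl
  set_set _ _ _ := rfl
  label n := ⟨n, (P n).main⟩

/-- Run the fragment of the current node and then the exit statement of the node, which chooses the
next node. -/
def flow [Finite N] [Finite C] (c₀ : C) (start : N)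
    (ex : N → TM2.Stmt (fun _ : R => A) N C) : Frag R A where
  Λ := Σ n, (P n).Λ
  σ := C × ∀ n, (P n).σ
  main := ⟨start, (P start).main⟩
  init := (c₀, fun n => (P n).init)
  m l := (nodeEmb P C l.1).stmt ((exitEmb P C).stmt .halt (ex l.1)) ((P l.1).m l.2)

/-- The configuration of a flow chart that is about to run the node of the given configuration. -/
def liftCfg (c : TM2.Cfg (fun _ : R => A) N C) :
    TM2.Cfg (fun _ : R => A) (Σ n, (P n).Λ) (C × ∀ n, (P n).σ) :=
  ⟨c.l.map fun n => ⟨n, (P n).main⟩, (c.var, fun n => (P n).init), c.stk⟩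

/-- Since `Runs` requires the internal state to be reset at the end, the configuration after a node
is again a `liftCfg`, and runs of successive nodes can be chained. The exit statement replaces the
`halt` of the fragment and so costs no step of its own. -/
theorem flow_node [Finite N] [Finite C] {c₀ : C} {start : N}
    {ex : N → TM2.Stmt (fun _ : R => A) N C} {n : N} {T : ℕ} {S U : R → List A}
    (h : (P n).Runs T S U) (c : C) :
    ∃ t ≤ T, Steps (TM2.step (flow P c₀ start ex).m) t (liftCfg P ⟨some n, c, S⟩)
      (liftCfg P (TM2.stepAux (ex n) c U)) := by
  obtain ⟨t, ht, hs⟩ := h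
  obtain ⟨V, h₁, -, h₃⟩ := (nodeEmb P C n).steps_of_steps
    (M' := (flow P c₀ start ex).m) (ex := (exitEmb P C).stmt .halt (ex n)) (fun l => rfl)
    (s := (c, fun n => (P n).init)) (S' := S) (fun k => by simp [nodeEmb]) hs
  have hV : V = U := by funext k; simpa [nodeEmb] using h₁ k
  subst hV
  obtain ⟨W, g₁, -, g₃⟩ := (exitEmb P C).stepAux_stmt .halt (ex n) (c, fun n => (P n).init) V V
    (fun k => by simp [exitEmb])
  have hW : W = (TM2.stepAux (ex n) c V).stk := by funext k; simpa [exitEmb] using g₁ k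
  subst hW
  refine ⟨t, ht, ?_⟩
  have hset : (nodeEmb P C n).set (P n).init (c, fun n => (P n).init) =
      (c, fun n => (P n).init) := by
    simp [nodeEmb]
  rw [hset, g₃] at h₃
  have hg : (exitEmb P C).get (c, fun n => (P n).init) = c := rfl
  rw [hg] at h₃
  convert h₃ using 1
  obtain ⟨l, c', U'⟩ := TM2.stepAux (ex n) c V
  cases l <;> rfl

end Flow

/-! ### Sequencing, branching and loops -/

def seq (P Q : Frag R A) : Frag R A :=
  flow (N := Bool) (C := Unit) (fun b => cond b Q P) () false
    (fun b => cond b .halt (.goto fun _ => true))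

theorem seq_runs {P Q : Frag R A} {T₁ T₂ : ℕ} {S U V : R → List A} (h₁ : P.Runs T₁ S U)
    (h₂ : Q.Runs T₂ U V) : (P.seq Q).Runs (T₁ + T₂) S V := by
  obtain ⟨t₁, ht₁, hs₁⟩ := flow_node (N := Bool) (C := Unit) (fun b => cond b Q P) (c₀ := ())
    (start := false) (ex := fun b => cond b .halt (.goto fun _ => true)) (n := false) h₁ ()
  obtain ⟨t₂, ht₂, hs₂⟩ := flow_node (N := Bool) (C := Unit) (fun b => cond b Q P) (c₀ := ())
    (start := false) (ex := fun b => cond b .halt (.goto fun _ => true)) (n := true) h₂ ()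
  exact ⟨t₁ + t₂, add_le_add ht₁ ht₂, hs₁.trans hs₂⟩

section Branch

variable {C : Type} [Finite C] [DecidableEq C]

/-- Pop a letter of the stack `r` and run the fragment chosen by the class of the letter. -/
def branch (r : R) (cls : A → C) (P : Option C → Frag R A) : Frag R A :=
  flow (N := Option (Option C)) (C := Option C) (fun n => n.elim skip P) none none
    (fun n => n.elim (.pop r (fun _ o => o.map cls) (.goto fun s => some s))
      (fun _ => .load (fun _ => none) .halt))

theorem branch_runs {r : R} {cls : A → C} {P : Option C → Frag R A} {T : ℕ} {S U : R → List A}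
    (h : (P ((S r).head?.map cls)).Runs T (Function.update S r (S r).tail) U) :
    (branch r cls P).Runs (1 + T) S U := by
  obtain ⟨t₁, ht₁, hs₁⟩ := flow_node (N := Option (Option C)) (C := Option C)
    (fun n => n.elim skip P) (c₀ := none) (start := none)
    (ex := fun n => n.elim (.pop r (fun _ o => o.map cls) (.goto fun s => some s))
      (fun _ => .load (fun _ => none) .halt)) (n := none) (skip_runs S) none
  obtain ⟨t₂, ht₂, hs₂⟩ := flow_node (N := Option (Option C)) (C := Option C)
    (fun n => n.elim skip P) (c₀ := none) (start := none)
    (ex := fun n => n.elim (.pop r (fun _ o => o.map cls) (.goto fun s => some s))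
      (fun _ => .load (fun _ => none) .halt)) (n := some ((S r).head?.map cls)) h
      ((S r).head?.map cls)
  exact ⟨t₁ + t₂, add_le_add ht₁ ht₂, hs₁.trans hs₂⟩

/-- The exit statements of the nodes of a loop. -/
def loopExit (r : R) (cls : A → C) : Option C → TM2.Stmt (fun _ : R => A) (Option C) (Option C)
  | none => .pop r (fun _ o => o.map cls) (.branch (fun s => s.isSome) (.goto fun s => s) .halt)
  | some _ => .load (fun _ => none) (.goto fun _ => none)

/-- Empty the stack `r`, running for each letter the fragment chosen by its class. -/
def loop (r : R) (cls : A → C) (P : C → Frag R A) : Frag R A :=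
  flow (N := Option C) (C := Option C) (fun n => n.elim skip P) none none (loopExit r cls)

theorem loop_nil {r : R} {cls : A → C} {P : C → Frag R A} {S : R → List A} (hS : S r = []) :
    (loop r cls P).Runs 1 S S := by
  obtain ⟨t₁, ht₁, hs₁⟩ := flow_node (N := Option C) (C := Option C)
    (fun n => n.elim skip P) (c₀ := none) (start := none)
    (ex := loopExit r cls) (n := none) (skip_runs S) none
  refine ⟨t₁, ht₁, ?_⟩
  simp only [loopExit, TM2.stepAux, hS, List.head?_nil, Option.map_none, Option.isSome_none,
    List.tail_nil, cond_false] at hs₁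
  rw [← hS, Function.update_eq_self] at hs₁
  exact hs₁

theorem loop_cons {r : R} {cls : A → C} {P : C → Frag R A} {S U V : R → List A} {a : A}
    {l : List A} {T T' : ℕ} (hS : S r = a :: l) (hP : (P (cls a)).Runs T (Function.update S r l) U)
    (hU : (loop r cls P).Runs T' U V) : (loop r cls P).Runs (1 + T + T') S V := by
  obtain ⟨t₁, ht₁, hs₁⟩ := flow_node (N := Option C) (C := Option C)
    (fun n => n.elim skip P) (c₀ := none) (start := none)
    (ex := loopExit r cls) (n := none) (skip_runs S) none
  obtain ⟨t₂, ht₂, hs₂⟩ := flow_node (N := Option C) (C := Option C)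
    (fun n => n.elim skip P) (c₀ := none) (start := none)
    (ex := loopExit r cls) (n := some (cls a)) hP (some (cls a))
  simp only [loopExit, TM2.stepAux, hS, List.head?_cons, Option.map_some, Option.isSome_some,
    List.tail_cons, cond_true] at hs₁ hs₂
  obtain ⟨t₃, ht₃, hs₃⟩ := hU
  exact ⟨t₁ + t₂ + t₃, by omega, (hs₁.trans hs₂).trans hs₃⟩

end Branch

end Frag

/-! ## Polynomial-time computable word-valued functions of unary numbers -/

/-- The letters of the words that are computed. -/
abbrev Letter : Type := Token (BoolGateName ⊕ QGateName)

instance : Finite BoolGateName :=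
  Finite.of_surjective (fun b : Bool => cond b BoolGateName.zero BoolGateName.nand) (by
    rintro (_ | _)
    exacts [⟨true, rfl⟩, ⟨false, rfl⟩])

instance : Finite QGateName := by
  refine Finite.of_surjective (fun i : Fin 6 => match i with
    | 0 => QGateName.X | 1 => .H | 2 => .T | 3 => .cnot | 4 => .toffoli | 5 => .reset) ?_
  rintro (_ | _)
  exacts [⟨0, rfl⟩, ⟨1, rfl⟩, ⟨2, rfl⟩, ⟨3, rfl⟩, ⟨4, rfl⟩, ⟨5, rfl⟩]

instance {γ : Type} [Finite γ] : Finite (Token γ) := by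
  refine Finite.of_surjective (fun i : Option (Option (Option γ)) => match i with
    | none => Token.tick | some none => .sep | some (some none) => .out
    | some (some (some g)) => .gate g) ?_
  rintro (_ | _ | _ | g)
  exacts [⟨none, rfl⟩, ⟨some none, rfl⟩, ⟨some (some none), rfl⟩, ⟨some (some (some g)), rfl⟩]

noncomputable instance : DecidableEq Letter := Classical.decEq _

/-- A type of tuples of natural numbers. -/
class Ctx (X : Type) where
  I : Type
  [fin : Fintype I]
  [dec : DecidableEq I]
  val : X → I → ℕ

attribute [reducible, instance] Ctx.fin Ctx.dec

instance : Ctx ℕ where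
  I := Unit
  val n _ := n

instance {X : Type} [Ctx X] : Ctx (X × ℕ) where
  I := Option (Ctx.I X)
  val p i := i.elim p.2 (Ctx.val p.1)

/-- The sum of the entries of a tuple. -/
def ctxSize {X : Type} [Ctx X] (x : X) : ℕ := ∑ i, Ctx.val x i

theorem ctxSize_nat (n : ℕ) : ctxSize n = n := by
  simp [ctxSize, Ctx.val, Ctx.I]

theorem ctxSize_pair {X : Type} [Ctx X] (x : X) (j : ℕ) : ctxSize (x, j) = j + ctxSize x := by
  have h := Fintype.sum_option (fun i : Option (Ctx.I X) => Ctx.val (x, j) i)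
  exact h

/-- A unary number on a stack. -/
def unary (B : Type) (n : ℕ) : List (Letter ⊕ B) := List.replicate n (Sum.inl Token.tick)

/-- Letters that are not proper count as `tick`. -/
def letterClass {B : Type} : Letter ⊕ B → Letter := Sum.elim id fun _ => Token.tick

/-- The stacks that hold the tuple `x`, the word `l` in the output stack, and nothing else. -/
def ctxStk {X : Type} [Ctx X] {W B : Type} (x : X) (l : List Letter) :
    Ctx.I X ⊕ Option W → List (Letter ⊕ B) :=
  Sum.elim (fun i => unary B (Ctx.val x i)) fun w => w.elim (l.map Sum.inl) fun _ => []

/-- `F` is computed in polynomial time by a fragment that appends its value to the output stack and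
restores all other stacks. The stacks may hold letters of `B` in between. -/
def Comp (B : Type) {X : Type} [Ctx X] (F : X → List Letter) : Prop :=
  ∃ (W : Type) (_ : Finite W) (_ : DecidableEq W) (P : Frag (Ctx.I X ⊕ Option W) (Letter ⊕ B))
    (p : Polynomial ℕ), ∀ x, (F x).length ≤ p.eval (ctxSize x) ∧
      ∀ l, P.Runs (p.eval (ctxSize x)) (ctxStk x l) (ctxStk x ((F x).reverse ++ l))

theorem eval_mono (p : Polynomial ℕ) {a b : ℕ} (h : a ≤ b) : p.eval a ≤ p.eval b := by
  simp only [Polynomial.eval_eq_sum, Polynomial.sum_def]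
  gcongr

/-- An embedding of the stacks of a fragment that computes a function. -/
def alloc {I W R : Type} (v : I → R) (o : R) (w : W → R) (hv : Function.Injective v)
    (hw : Function.Injective w) (hvo : ∀ i, v i ≠ o) (hwo : ∀ j, w j ≠ o)
    (hvw : ∀ i j, v i ≠ w j) : I ⊕ Option W ↪ R where
  toFun := Sum.elim v fun k => k.elim o w
  inj' := by
    rintro (i | _ | i) (j | _ | j) h
    · exact congrArg _ (hv h)
    · exact absurd h (hvo i)
    · exact absurd h (hvw i j)
    · exact absurd h.symm (hvo j)
    · rfl
    · exact absurd h.symm (hwo j)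
    · exact absurd h.symm (hvw j i)
    · exact absurd h (hwo i)
    · exact congrArg _ (congrArg _ (hw h))

/-- The rule for calling a subroutine: only the stacks assigned to it must hold the arguments or be
empty, and apart from the output nothing changes, whatever the other stacks hold. -/
theorem rename_computes {X : Type} [Ctx X] {W B R : Type} [DecidableEq W] [DecidableEq R]
    {P : Frag (Ctx.I X ⊕ Option W) (Letter ⊕ B)} {T : ℕ} {x : X} {w : List Letter}
    (h : ∀ l, P.Runs T (ctxStk x l) (ctxStk x (w ++ l)))
    (e : Ctx.I X ⊕ Option W ↪ R) {S : R → List (Letter ⊕ B)} {l : List Letter}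
    (hv : ∀ i, S (e (Sum.inl i)) = unary B (Ctx.val x i))
    (ho : S (e (Sum.inr none)) = l.map Sum.inl) (hw : ∀ i, S (e (Sum.inr (some i))) = []) :
    (P.rename e).Runs T S (Function.update S (e (Sum.inr none)) ((w ++ l).map Sum.inl)) := by
  refine Frag.rename_runs (h l) ?_ ?_ ?_
  · rintro (i | _ | i)
    exacts [hv i, ho, hw i]
  · rintro (i | _ | i)
    · rw [Function.update_of_ne (fun h => by simpa using e.injective h)]; exact hv i
    · rw [Function.update_self]; rfl
    · rw [Function.update_of_ne (fun h => by simpa using e.injective h)]; exact hw i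
  · intro r hr
    exact Function.update_of_ne (fun h => hr ⟨_, h.symm⟩) _ _

/-! ### Moving letters between stacks -/

namespace Frag

variable {R A C : Type} [DecidableEq R] [Finite C] [DecidableEq C]

theorem pushEach_runs (ts : List R) (hts : ts.Nodup) (a : A) (S : R → List A) :
    (prim (pushEach (ts.map fun t => (t, a)))).Runs 1 S
      (fun k => if k ∈ ts then a :: S k else S k) := by
  apply prim_runs
  induction ts generalizing S with
  | nil => simp [pushEach]
  | cons t ts ih =>
    simp only [List.map_cons, pushEach, TM2.stepAux]
    rw [ih (List.nodup_cons.1 hts).2]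
    congr 1
    funext k
    by_cases hk : k = t
    · subst hk; simp [(List.nodup_cons.1 hts).1]
    · simp [hk]

/-- Empty the stack `r` onto each of the stacks `ts`. -/
def drain (r : R) (cls : A → C) (g : C → A) (ts : List R) : Frag R A :=
  loop r cls fun c => prim (pushEach (ts.map fun t => (t, g c)))

/-- This is the basic movement of data: with no target it clears a stack, with one it moves and
reverses the contents, with two it duplicates them. -/
theorem drain_runs {r : R} {cls : A → C} {g : C → A} {ts : List R} (hts : ts.Nodup)
    (hr : r ∉ ts) {S U : R → List A} (hUr : U r = [])
    (hU : ∀ k ≠ r, U k = if k ∈ ts then ((S r).map fun a => g (cls a)).reverse ++ S k else S k) :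
    (drain r cls g ts).Runs (2 * (S r).length + 1) S U := by
  generalize hl : S r = l
  rw [hl] at hU
  induction l generalizing S with
  | nil =>
    have : U = S := by
      funext k
      by_cases hk : k = r
      · rw [hk, hUr, hl]
      · rw [hU k hk]; simp
    rw [this]
    exact loop_nil hl
  | cons a l ih =>
    have h := ih (S := fun k => if k ∈ ts then g (cls a) :: Function.update S r l k
      else Function.update S r l k) (by
        intro k hk
        rw [hU k hk]
        by_cases hkt : k ∈ ts <;> simp [hkt, Function.update_of_ne hk]) (by simp [hr])
    refine (loop_cons hl (pushEach_runs ts hts (g (cls a)) _) h).mono ?_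
    simp only [List.length_cons]; omega

end Frag

theorem map_unary {B : Type} (n : ℕ) :
    ((unary B n).map fun a : Letter ⊕ B => (Sum.inl (letterClass a) : Letter ⊕ B)) =
      unary B n := by
  simp [unary, letterClass]

theorem Frag.Runs.of_eq {R A : Type} [DecidableEq R] {P : Frag R A} {T T' : ℕ}
    {S S' U U' : R → List A} (h : P.Runs T S U) (hS : S = S') (hU : U = U') (hT : T ≤ T') :
    P.Runs T' S' U' := by
  subst hS hU; exact h.mono hT

/-! ### Scratch stacks -/

section Scratch

variable {B X W : Type} [Ctx X] {k : ℕ}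

/-- As `ctxStk`, with `k` further stacks in use. -/
def scratch (W B : Type) (x : X) (l : List Letter) (s : Fin k → List Letter) :
    Ctx.I X ⊕ Option (Fin k ⊕ W) → List (Letter ⊕ B) :=
  Sum.elim (fun i => unary B (Ctx.val x i)) fun w =>
    w.elim (l.map Sum.inl) (Sum.elim (fun i => (s i).map Sum.inl) fun _ => [])

theorem scratch_nil (x : X) (l : List Letter) :
    scratch W B x l (fun _ : Fin k => []) = ctxStk x l := by
  funext r
  rcases r with i | _ | i | w <;> rfl

variable [DecidableEq W]

theorem update_scratch_out (x : X) (l w : List Letter) (s : Fin k → List Letter) :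
    Function.update (scratch W B x l s) (Sum.inr none) (w.map Sum.inl) = scratch W B x w s := by
  funext r
  rcases r with i | _ | i | j
  · rw [Function.update_of_ne (by simp)]; rfl
  · rw [Function.update_self]; rfl
  · rw [Function.update_of_ne (by simp)]; rfl
  · rw [Function.update_of_ne (by simp)]; rfl

theorem update_scratch (x : X) (l w : List Letter) (s : Fin k → List Letter) (m : Fin k) :
    Function.update (scratch W B x l s) (Sum.inr (some (Sum.inl m))) (w.map Sum.inl) =
      scratch W B x l (Function.update s m w) := by
  funext r
  rcases r with i | _ | i | j
  · rw [Function.update_of_ne (by simp)]; rfl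
  · rw [Function.update_of_ne (by simp)]; rfl
  · by_cases h : i = m
    · subst h; rw [Function.update_self]; simp [scratch]
    · rw [Function.update_of_ne (by simpa using h)]
      simp [scratch, Function.update_of_ne h]
  · rw [Function.update_of_ne (by simp)]; rfl

theorem drain_scratch (x : X) (l : List Letter) (s : Fin k → List Letter) {i j : Fin k}
    (hij : i ≠ j) :
    (Frag.drain (Sum.inr (some (Sum.inl i))) letterClass Sum.inl
      [Sum.inr (some (Sum.inl j))]).Runs (2 * (s i).length + 1) (scratch W B x l s)
      (scratch W B x l (Function.update (Function.update s i []) j ((s i).reverse ++ s j))) := by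
  have hlen : (scratch W B x l s (Sum.inr (some (Sum.inl i)))).length = (s i).length := by
    simp [scratch]
  rw [← hlen]
  refine Frag.drain_runs (by simp) (by simpa using hij) ?_ ?_
  · simp [scratch, Function.update_of_ne hij]
  · rintro r hr
    rcases r with a | _ | a | a
    · simp [scratch]
    · simp [scratch]
    · by_cases haj : a = j
      · subst haj; simp [scratch, letterClass]
      · have hai : a ≠ i := fun h => hr (by rw [h])
        simp [scratch, haj, hai]
    · simp [scratch]

theorem clear_scratch (x : X) (l : List Letter) (s : Fin k → List Letter) (i : Fin k) :
    (Frag.drain (Sum.inr (some (Sum.inl i))) letterClass Sum.inl []).Runs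
      (2 * (s i).length + 1) (scratch W B x l s)
      (scratch W B x l (Function.update s i [])) := by
  have hlen : (scratch W B x l s (Sum.inr (some (Sum.inl i)))).length = (s i).length := by
    simp [scratch]
  rw [← hlen]
  refine Frag.drain_runs (by simp) (by simp) ?_ ?_
  · simp [scratch]
  · rintro r hr
    rcases r with a | _ | a | a
    · simp [scratch]
    · simp [scratch]
    · have hai : a ≠ i := fun h => hr (by rw [h])
      simp [scratch, hai]
    · simp [scratch]

/-- A fragment that computes a function of `x`, placed beside `k` scratch stacks. -/
def toOut {W' : Type} [DecidableEq W'] (k : ℕ) (P : Frag (Ctx.I X ⊕ Option W') (Letter ⊕ B))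
    (ι : W' ↪ W) : Frag (Ctx.I X ⊕ Option (Fin k ⊕ W)) (Letter ⊕ B) :=
  P.rename (alloc Sum.inl (Sum.inr none) (fun i => Sum.inr (some (Sum.inr (ι i))))
    Sum.inl_injective (fun i j h => ι.injective (by simpa using h)) (fun _ => Sum.inl_ne_inr)
    (fun j h => by simp at h) (fun _ _ => Sum.inl_ne_inr))

/-- A fragment that computes a function of `x`, with output to a scratch stack. -/
def toScratch {W' : Type} [DecidableEq W'] (P : Frag (Ctx.I X ⊕ Option W') (Letter ⊕ B))
    (ι : W' ↪ W) (m : Fin k) : Frag (Ctx.I X ⊕ Option (Fin k ⊕ W)) (Letter ⊕ B) :=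
  P.rename (alloc Sum.inl (Sum.inr (some (Sum.inl m))) (fun i => Sum.inr (some (Sum.inr (ι i))))
    Sum.inl_injective (fun i j h => ι.injective (by simpa using h)) (fun _ => Sum.inl_ne_inr)
    (fun j h => by simp at h) (fun _ _ => Sum.inl_ne_inr))

theorem toOut_runs {W' : Type} [DecidableEq W']
    {P : Frag (Ctx.I X ⊕ Option W') (Letter ⊕ B)} {T : ℕ} {x : X} {w : List Letter}
    (h : ∀ l, P.Runs T (ctxStk x l) (ctxStk x (w ++ l))) (ι : W' ↪ W)
    (l : List Letter) (s : Fin k → List Letter) :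
    (toOut k P ι).Runs T (scratch W B x l s) (scratch W B x (w ++ l) s) :=
  (rename_computes h _ (l := l) (fun _ => rfl) rfl (fun _ => rfl)).of_eq rfl
    (update_scratch_out x l _ s) le_rfl

theorem toScratch_runs {W' : Type} [DecidableEq W']
    {P : Frag (Ctx.I X ⊕ Option W') (Letter ⊕ B)} {T : ℕ} {x : X} {w : List Letter}
    (h : ∀ l, P.Runs T (ctxStk x l) (ctxStk x (w ++ l))) (ι : W' ↪ W)
    (l : List Letter) (s : Fin k → List Letter) (m : Fin k) :
    (toScratch P ι m).Runs T (scratch W B x l s)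
      (scratch W B x l (Function.update s m (w ++ s m))) :=
  (rename_computes h _ (l := s m) (fun _ => rfl) rfl (fun _ => rfl)).of_eq rfl
    (update_scratch x l _ s m) le_rfl

end Scratch

namespace Comp

variable {B X : Type} [Ctx X]

theorem const (w : List Letter) : Comp B fun _ : X => w := by
  refine ⟨Empty, inferInstance, inferInstance,
    Frag.prim (Frag.pushWord (Sum.inr none) (w.map Sum.inl)), Polynomial.C (w.length + 1),
    fun x => ⟨by simp, fun l => ?_⟩⟩
  refine (Frag.pushWord_runs (Sum.inr none) (w.map Sum.inl) (ctxStk x l)).of_eq rfl ?_ (by simp)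
  funext r
  rcases r with i | _ | i
  · rw [Function.update_of_ne (by simp)]; rfl
  · rw [Function.update_self]; simp [ctxStk]
  · exact i.elim

/-- The entry `i` of the tuple, in unary. -/
theorem entry (i : Ctx.I X) : Comp B fun x : X => List.replicate (Ctx.val x i) Token.tick := by
  -- Reading a unary number consumes it. The ticks therefore go to a scratch stack first, and from
  -- there to the output and back to the entry simultaneously.
  refine ⟨Fin 1 ⊕ Empty, inferInstance, inferInstance,
    (Frag.drain (Sum.inl i) letterClass Sum.inl [Sum.inr (some (Sum.inl 0))]).seq
      (Frag.drain (Sum.inr (some (Sum.inl 0))) letterClass Sum.inl [Sum.inl i, Sum.inr none]),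
    4 * Polynomial.X + 2, fun x => ?_⟩
  have hle : Ctx.val x i ≤ ctxSize x := Finset.single_le_sum (fun _ _ => Nat.zero_le _)
    (Finset.mem_univ i)
  refine ⟨by simp; omega, fun l => ?_⟩
  obtain ⟨S₁, hS₁⟩ : ∃ S : Ctx.I X ⊕ Option (Fin 1 ⊕ Empty) → List (Letter ⊕ B),
    S = Function.update (Function.update (ctxStk x l) (Sum.inl i) [])
      (Sum.inr (some (Sum.inl 0))) (unary B (Ctx.val x i)) := ⟨_, rfl⟩
  have h0 : (ctxStk x l (Sum.inl i : Ctx.I X ⊕ Option (Fin 1 ⊕ Empty)) : List (Letter ⊕ B)) =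
    unary B (Ctx.val x i) := rfl
  have hu : S₁ (Sum.inr (some (Sum.inl 0))) = unary B (Ctx.val x i) := by
    rw [hS₁, Function.update_self]
  refine (Frag.seq_runs (U := S₁) (Frag.drain_runs (by simp) (by simp) ?_ ?_)
    (Frag.drain_runs (by simp) (by simp) ?_ ?_)).of_eq rfl rfl ?_
  · simp [hS₁]
  · intro k hk
    by_cases h : k = Sum.inr (some (Sum.inl 0))
    · subst h
      rw [hu, h0, map_unary]
      simp [ctxStk, unary]
    · rw [hS₁, Function.update_of_ne h, Function.update_of_ne hk, if_neg (by simpa using h)]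
  · rfl
  · intro k hk
    rw [hu, map_unary]
    rcases k with j | _ | j | j
    · rw [hS₁, Function.update_of_ne (by simp)]
      by_cases h : j = i
      · subst h
        rw [if_pos (by simp), Function.update_self]
        simp [ctxStk, unary]
      · rw [if_neg (by simp [h]), Function.update_of_ne (by simp [h])]
        rfl
    · rw [hS₁, if_pos (by simp), Function.update_of_ne (by simp), Function.update_of_ne (by simp)]
      simp [ctxStk, unary]
    · exact absurd (by rw [Subsingleton.elim j 0]) hk
    · exact j.elim
  · rw [h0, hu]
    simp [unary]; omega

theorem append {F G : X → List Letter} (hF : Comp B F) (hG : Comp B G) :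
    Comp B fun x => F x ++ G x := by
  obtain ⟨W₁, _, _, P, p, hP⟩ := hF
  obtain ⟨W₂, _, _, Q, q, hQ⟩ := hG
  refine ⟨Fin 0 ⊕ (W₁ ⊕ W₂), inferInstance, inferInstance,
    (toOut (X := X) 0 P ⟨Sum.inl, Sum.inl_injective⟩).seq (toOut (X := X) 0 Q ⟨Sum.inr, Sum.inr_injective⟩),
    p + q, fun x => ⟨by simpa using add_le_add (hP x).1 (hQ x).1, fun l => ?_⟩⟩
  refine (Frag.seq_runs (toOut_runs (hP x).2 _ l (fun _ => []))
    (toOut_runs (hQ x).2 _ _ (fun _ => []))).of_eq ?_ ?_ ?_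
  · exact scratch_nil x l
  · rw [scratch_nil]; simp
  · simp

/-- Change the context. -/
theorem rename {Y : Type} [Ctx Y] {F : Y → List Letter} (hF : Comp B F) (g : X → Y)
    (ι : Ctx.I Y → Ctx.I X) (hι : Function.Injective ι)
    (hg : ∀ x i, Ctx.val (g x) i = Ctx.val x (ι i)) : Comp B fun x => F (g x) := by
  obtain ⟨W, _, _, P, p, hP⟩ := hF
  -- The entries of `g x` are distinct entries of `x`, so the size does not grow and the same time
  -- bound serves.
  have hs : ∀ x, ctxSize (g x) ≤ ctxSize x := by
    intro x
    unfold ctxSize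
    calc ∑ i, Ctx.val (g x) i = ∑ i, Ctx.val x (ι i) := by simp [hg]
      _ = ∑ j ∈ Finset.univ.map ⟨ι, hι⟩, Ctx.val x j := by simp
      _ ≤ _ := Finset.sum_le_sum_of_subset (Finset.subset_univ _)
  refine ⟨W, inferInstance, inferInstance, P.rename (alloc (fun i => Sum.inl (ι i)) (Sum.inr none)
    (fun i => Sum.inr (some i)) (fun i j h => hι (by simpa using h)) (fun i j h => by simpa using h)
    (by simp) (by simp) (by simp)), p, fun x =>
    ⟨(hP (g x)).1.trans (eval_mono p (hs x)), fun l => ?_⟩⟩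
  refine (rename_computes (hP (g x)).2 _ (l := l) (fun i => ?_) rfl (fun _ => rfl)).of_eq rfl ?_
    (eval_mono p (hs x))
  · rw [hg]; rfl
  · funext r
    rcases r with i | _ | i
    · exact Function.update_of_ne (by exact Sum.inl_ne_inr) _ _
    · exact Function.update_self _ _ _
    · refine Function.update_of_ne (fun h => ?_) _ _
      exact absurd (Sum.inr.inj h) (Option.some_ne_none i)

theorem fst {F : X → List Letter} (hF : Comp B F) : Comp B fun p : X × ℕ => F p.1 :=
  rename hF Prod.fst some (Option.some_injective _) fun _ _ => rfl

theorem snd {F : ℕ → List Letter} (hF : Comp B F) : Comp B fun p : X × ℕ => F p.2 :=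
  rename hF Prod.snd (fun _ => none) (fun _ _ _ => rfl) fun _ _ => rfl

/-- Here `S` is the loop invariant: `S j` are the stacks before round `j`, including the control
stack `r`. The induction runs over the number of remaining rounds. -/
theorem loop_tick_runs {R : Type} [DecidableEq R] {r : R} {P : Frag R (Letter ⊕ B)}
    (S : ℕ → R → List (Letter ⊕ B)) (T m : ℕ)
    (h : ∀ j < m, ∃ a l, S j r = a :: l ∧ P.Runs T (Function.update (S j) r l) (S (j + 1)))
    (hm : S m r = []) :
    (Frag.loop r letterClass fun _ => P).Runs (m * (T + 1) + 1) (S 0) (S m) := by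
  have key : ∀ d ≤ m, (Frag.loop r letterClass fun _ => P).Runs (d * (T + 1) + 1)
      (S (m - d)) (S m) := by
    intro d
    induction d with
    | zero => intro _; simpa using Frag.loop_nil hm
    | succ d ih =>
      intro hd
      obtain ⟨a, l, ha, hr⟩ := h (m - (d + 1)) (by omega)
      have hsucc : m - (d + 1) + 1 = m - d := by omega
      rw [hsucc] at hr
      refine (Frag.loop_cons ha hr (ih (by omega))).mono ?_
      ring_nf; omega
  simpa using key m le_rfl

/-- Concatenation over a range of unary numbers. -/
theorem range {N : X → List Letter} {F : X × ℕ → List Letter} (hN : Comp B N) (hF : Comp B F) :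
    Comp B fun x => (List.range (N x).length).flatMap fun j => F (x, j) := by
  obtain ⟨W₁, _, _, P, p, hP⟩ := hN
  obtain ⟨W₂, _, _, Q, q, hQ⟩ := hF
  -- The index of a round is at most the length of `N x`, hence at most `p`; adding it to the size
  -- of the tuple keeps the cost of a round polynomial.
  set qp : Polynomial ℕ := q.comp (Polynomial.X + p) with hqp
  have hq : ∀ (x : X) (j : ℕ), j ≤ p.eval (ctxSize x) → q.eval (ctxSize (x, j)) ≤ qp.eval (ctxSize x) := by
    intro x j hj
    rw [hqp, Polynomial.eval_comp, ctxSize_pair]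
    exact eval_mono q (by simp; omega)
  -- Scratch stack `1` tallies the finished rounds and is handed to the body as the last entry of
  -- its tuple; scratch stack `0` holds `N x` and controls the loop.
  let e : Ctx.I (X × ℕ) ⊕ Option W₂ ↪ Ctx.I X ⊕ Option (Fin 2 ⊕ (W₁ ⊕ W₂)) :=
    alloc (fun i : Option (Ctx.I X) => i.elim (Sum.inr (some (Sum.inl 1))) Sum.inl)
      (Sum.inr none) (fun i => Sum.inr (some (Sum.inr (Sum.inr i))))
      (by rintro (_ | i) (_ | j) h <;> simp_all) (fun i j h => by simpa using h)
      (by rintro (_ | i) <;> simp) (by simp) (by rintro (_ | i) <;> simp)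
  let body : Frag (Ctx.I X ⊕ Option (Fin 2 ⊕ (W₁ ⊕ W₂))) (Letter ⊕ B) :=
    (Q.rename e).seq
    (Frag.prim (Frag.pushWord (Sum.inr (some (Sum.inl 1))) [Sum.inl Token.tick]))
  refine ⟨Fin 2 ⊕ (W₁ ⊕ W₂), inferInstance, inferInstance,
    (toScratch (X := X) P ⟨Sum.inl, Sum.inl_injective⟩ 0).seq
    ((Frag.loop (Sum.inr (some (Sum.inl 0))) letterClass fun _ => body).seq
    (Frag.drain (Sum.inr (some (Sum.inl 1))) letterClass Sum.inl [])),
    p + (p * (qp + 2) + 1) + (2 * p + 1), fun x => ⟨?_, fun l => ?_⟩⟩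
  · rw [List.length_flatMap]
    refine (List.sum_le_card_nsmul _ (qp.eval (ctxSize x)) ?_).trans ?_
    · intro m hm
      obtain ⟨j, hj, rfl⟩ := List.mem_map.1 hm
      have := List.mem_range.1 hj
      exact (hQ (x, j)).1.trans (hq x j (by have := (hP x).1; omega))
    · have := Nat.mul_le_mul_right (qp.eval (ctxSize x)) (hP x).1
      simp only [List.length_map, List.length_range, smul_eq_mul, Polynomial.eval_add,
        Polynomial.eval_mul, Polynomial.eval_one, Polynomial.eval_ofNat]
      nlinarith
  · set m := (N x).length with hm
    let st : ℕ → Ctx.I X ⊕ Option (Fin 2 ⊕ (W₁ ⊕ W₂)) → List (Letter ⊕ B) := fun j =>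
      scratch (W₁ ⊕ W₂) B x (((List.range j).flatMap fun i => F (x, i)).reverse ++ l)
        ![((N x).reverse).drop j, List.replicate j Token.tick]
    have h₁ := toScratch_runs (k := 2) (W := W₁ ⊕ W₂) (hP x).2 ⟨Sum.inl, Sum.inl_injective⟩ l
      (fun _ => []) 0
    have h₂ : (Frag.loop (Sum.inr (some (Sum.inl 0))) letterClass fun _ => body).Runs
        (m * (qp.eval (ctxSize x) + 1 + 1) + 1) (st 0) (st m) := by
      refine loop_tick_runs st _ m ?_ ?_
      · intro j hj
        have hj' : j < (N x).reverse.length := by simpa using hj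
        refine ⟨Sum.inl ((N x).reverse[j]), ((N x).reverse.drop (j + 1)).map Sum.inl, ?_, ?_⟩
        · simp only [st, scratch, Sum.elim_inr, Option.elim_some, Sum.elim_inl, Matrix.cons_val_zero]
          rw [List.drop_eq_getElem_cons hj', List.map_cons]
        · simp only [st]
          rw [update_scratch]
          refine (Frag.seq_runs (rename_computes (hQ (x, j)).2 _
            (l := ((List.range j).flatMap fun i => F (x, i)).reverse ++ l) ?_ rfl (fun _ => rfl))
            (Frag.pushWord_runs _ _ _)).of_eq rfl ?_ ?_
          · rintro (_ | i)
            · change List.map Sum.inl (Function.update ![(N x).reverse.drop j,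
                List.replicate j Token.tick] 0 ((N x).reverse.drop (j + 1)) 1) = unary B j
              simp [unary]
            · rfl
          · have ho : e (Sum.inr none) = Sum.inr none := rfl
            rw [ho, update_scratch_out]
            have hs1 : ∀ (w : List Letter) (s : Fin 2 → List Letter),
                scratch (W₁ ⊕ W₂) B x w s (Sum.inr (some (Sum.inl 1))) = (s 1).map Sum.inl :=
              fun _ _ => rfl
            rw [hs1]
            have hp : ([Sum.inl Token.tick] : List (Letter ⊕ B)).reverse ++
              (Function.update ![((N x).reverse).drop j, List.replicate j Token.tick] 0
                ((N x).reverse.drop (j + 1)) 1).map Sum.inl =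
              (List.replicate (j + 1) (Token.tick : Letter)).map Sum.inl := by
              simp [List.replicate_succ]
            rw [hp, update_scratch]
            congr 1
            · simp [List.range_succ]
            · funext i
              fin_cases i <;> simp
          · exact add_le_add_left (hq x j (by have := (hP x).1; omega)) 1
      · have : (N x).reverse.drop m = [] := by simp [hm]
        simp [st, scratch, this]
    have h₃ := clear_scratch (B := B) (W := W₁ ⊕ W₂) x
      (((List.range m).flatMap fun i => F (x, i)).reverse ++ l)
        ![((N x).reverse).drop m, List.replicate m Token.tick] 1
    refine (Frag.seq_runs (U := st 0) (h₁.of_eq (scratch_nil x l) ?_ le_rfl)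
      (Frag.seq_runs (U := st m) h₂ h₃)).of_eq rfl ?_ ?_
    · simp only [st]
      congr 1
      funext i
      fin_cases i <;> simp
    · rw [← scratch_nil (k := 2)]
      congr 1
      funext i
      fin_cases i <;> simp [hm]
    · have := (hP x).1
      rw [← hm] at this
      have h4 := Nat.mul_le_mul_right (qp.eval (ctxSize x) + 2) this
      simp
      ring_nf at h4 ⊢
      omega

set_option synthInstance.maxHeartbeats 200000 in
set_option synthInstance.maxSize 1000 in
/-- Case distinction on a letter of a word at a given position. -/
theorem getCase {F N : X → List Letter} {H : Option Letter → X → List Letter} (hF : Comp B F)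
    (hN : Comp B N) (hH : ∀ o, Comp B (H o)) :
    Comp B fun x => H (F x)[(N x).length]? x := by
  obtain ⟨W₁, _, _, P, p, hP⟩ := hF
  obtain ⟨W₂, _, _, Q, q, hQ⟩ := hN
  choose W₃ hfin hdec R r hR using hH
  have : Fintype (Option Letter) := Fintype.ofFinite _
  -- There are finitely many branches, so the sum of their time bounds serves all of them.
  have hr : ∀ (o : Option Letter) (x : X), (r o).eval (ctxSize x) ≤ (∑ o, r o).eval (ctxSize x) := by
    intro o x
    rw [Polynomial.eval_finsetSum]
    exact Finset.single_le_sum (f := fun o => (r o).eval (ctxSize x)) (fun _ _ => Nat.zero_le _)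
      (Finset.mem_univ o)
  -- The word `F x` arrives reversed, and draining it once puts its first letter on top. For each
  -- letter of `N x` one letter is discarded; the next one is popped for the decision, and the rest
  -- is cleared before the chosen branch runs.
  refine ⟨Fin 3 ⊕ (W₁ ⊕ (W₂ ⊕ Σ o, W₃ o)), inferInstance, inferInstance,
    (toScratch (X := X) P ⟨Sum.inl, Sum.inl_injective⟩ 0).seq
    ((Frag.drain (Sum.inr (some (Sum.inl 0))) letterClass Sum.inl
      [Sum.inr (some (Sum.inl 1))]).seq
    ((toScratch (X := X) Q ⟨fun i => Sum.inr (Sum.inl i), fun i j h => by simpa using h⟩ 2).seq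
    ((Frag.loop (Sum.inr (some (Sum.inl 2))) letterClass fun _ =>
      Frag.popOne (Sum.inr (some (Sum.inl 1)))).seq
    (Frag.branch (Sum.inr (some (Sum.inl 1))) letterClass fun o =>
      (Frag.drain (Sum.inr (some (Sum.inl 1))) letterClass Sum.inl []).seq
      (toOut (X := X) 3 (R o) ⟨fun i => Sum.inr (Sum.inr ⟨o, i⟩), fun i j h => by simpa using h⟩))))),
    p + (2 * p + 1) + q + (q * 2 + 1) + (1 + (2 * p + 1)) + ∑ o, r o, fun x => ⟨?_, fun l => ?_⟩⟩
  · refine ((hR _ x).1.trans (hr _ x)).trans ?_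
    simp
  · set m := (N x).length with hm
    set v := (F x)[m]? with hv
    have h₁ := toScratch_runs (k := 3) (W := W₁ ⊕ (W₂ ⊕ Σ o, W₃ o)) (hP x).2 ⟨Sum.inl, Sum.inl_injective⟩ l
      (fun _ => []) 0
    have h₂ := drain_scratch (B := B) (W := W₁ ⊕ (W₂ ⊕ Σ o, W₃ o)) x l
      (Function.update (fun _ : Fin 3 => []) 0 ((F x).reverse ++ [])) (i := 0) (j := 1) (by simp)
    have h₃ := toScratch_runs (k := 3) (W := W₁ ⊕ (W₂ ⊕ Σ o, W₃ o)) (hQ x).2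
      ⟨fun i => Sum.inr (Sum.inl i), fun i j h => by simpa using h⟩ l ![[], F x, []] 2
    have h₄ : (Frag.loop (Sum.inr (some (Sum.inl 2))) letterClass fun _ =>
        Frag.popOne (Sum.inr (some (Sum.inl 1)))).Runs (m * (1 + 1) + 1)
        (scratch (W₁ ⊕ (W₂ ⊕ Σ o, W₃ o)) B x l ![[], (F x).drop 0, (N x).reverse.drop 0])
        (scratch (W₁ ⊕ (W₂ ⊕ Σ o, W₃ o)) B x l ![[], (F x).drop m, (N x).reverse.drop m]) := by
      refine loop_tick_runs (fun j => scratch (W₁ ⊕ (W₂ ⊕ Σ o, W₃ o)) B x l ![[], (F x).drop j, (N x).reverse.drop j])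
        1 m ?_ (by simp [scratch, hm])
      intro j hj
      have hj' : j < (N x).reverse.length := by simpa using hj
      refine ⟨Sum.inl ((N x).reverse[j]), ((N x).reverse.drop (j + 1)).map Sum.inl, ?_, ?_⟩
      · simp only [scratch, Sum.elim_inr, Option.elim_some, Sum.elim_inl, Matrix.cons_val]
        rw [List.drop_eq_getElem_cons hj', List.map_cons]
      · rw [update_scratch]
        refine (Frag.popOne_runs _ _).of_eq rfl ?_ le_rfl
        have hs1 : ∀ (s : Fin 3 → List Letter),
            (scratch (W₁ ⊕ (W₂ ⊕ Σ o, W₃ o)) B x l s (Sum.inr (some (Sum.inl 1)))).tail = (s 1).tail.map Sum.inl := by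
          intro s
          simp [scratch]
        rw [hs1, update_scratch]
        congr 1
        funext i
        fin_cases i <;> simp
    have h₅ := clear_scratch (B := B) (W := W₁ ⊕ (W₂ ⊕ Σ o, W₃ o)) x l ![[], (F x).drop (m + 1), []] 1
    have h₆ := toOut_runs (k := 3) (W := W₁ ⊕ (W₂ ⊕ Σ o, W₃ o)) (hR v x).2
      ⟨fun i => Sum.inr (Sum.inr ⟨v, i⟩), fun i j h => by simpa using h⟩ l ![[], [], []]
    have hnil : (![[], [], []] : Fin 3 → List Letter) = fun _ => [] := by
      funext i; fin_cases i <;> rfl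
    refine (Frag.seq_runs h₁ (Frag.seq_runs (U := scratch (W₁ ⊕ (W₂ ⊕ Σ o, W₃ o)) B x l ![[], F x, []]) (h₂.of_eq rfl ?_ le_rfl)
      (Frag.seq_runs h₃ (Frag.seq_runs (h₄.of_eq ?_ rfl le_rfl)
      (Frag.branch_runs (T := (2 * p.eval (ctxSize x) + 1) + (∑ o, r o).eval (ctxSize x)) ?_))))).of_eq
      (S' := ctxStk x l) (U' := ctxStk x ((H v x).reverse ++ l)) ?_ rfl ?_
    · congr 1
      funext i
      fin_cases i <;> simp
    · congr 1
      funext i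
      fin_cases i <;> simp
    · have hhead : ((scratch (W₁ ⊕ (W₂ ⊕ Σ o, W₃ o)) B x l ![[], (F x).drop m, (N x).reverse.drop m]
          (Sum.inr (some (Sum.inl 1)))).head?.map letterClass) = v := by
        simp [scratch, letterClass, hv, Function.comp_def]
      have htail : (scratch (W₁ ⊕ (W₂ ⊕ Σ o, W₃ o)) B x l ![[], (F x).drop m, (N x).reverse.drop m]
          (Sum.inr (some (Sum.inl 1)))).tail = ((F x).drop (m + 1)).map Sum.inl := by
        simp [scratch]
      rw [hhead, htail, update_scratch]
      refine (Frag.seq_runs h₅ (h₆.of_eq (by congr 1; funext i; fin_cases i <;> simp) rfl le_rfl)).of_eq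
        ?_ ?_ ?_
      · congr 1
        funext i
        fin_cases i <;> simp [hm]
      · rw [hnil, scratch_nil]
      · refine add_le_add ?_ (hr v x)
        have := (hP x).1
        simp; omega
    · exact scratch_nil x l
    · have h1 := (hP x).1
      have h2 := (hQ x).1
      simp; omega

end Comp

/-! ## Stack machines as black boxes -/

theorem stepAux_length_le {K Λ σ : Type} {Γ : K → Type} [DecidableEq K] (q : TM2.Stmt Γ Λ σ) :
    ∃ c, ∀ v S k, ((TM2.stepAux q v S).stk k).length ≤ (S k).length + c := by
  induction q with
  | push k f q ih =>
    obtain ⟨c, hc⟩ := ih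
    refine ⟨c + 1, fun v S j => (hc _ _ j).trans ?_⟩
    by_cases h : j = k
    · subst h; simp; omega
    · rw [Function.update_of_ne h]; omega
  | peek k f q ih => obtain ⟨c, hc⟩ := ih; exact ⟨c, fun v S j => hc _ _ j⟩
  | pop k f q ih =>
    obtain ⟨c, hc⟩ := ih
    refine ⟨c, fun v S j => (hc _ _ j).trans ?_⟩
    by_cases h : j = k
    · subst h; simp
    · rw [Function.update_of_ne h]
  | load a q ih => obtain ⟨c, hc⟩ := ih; exact ⟨c, fun v S j => hc _ _ j⟩
  | branch f q₁ q₂ ih₁ ih₂ =>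
    obtain ⟨c₁, hc₁⟩ := ih₁
    obtain ⟨c₂, hc₂⟩ := ih₂
    refine ⟨c₁ + c₂, fun v S j => ?_⟩
    simp only [TM2.stepAux]
    cases f v
    · have := hc₂ v S j; simp only [cond_false]; omega
    · have := hc₁ v S j; simp only [cond_true]; omega
  | goto f => exact ⟨0, fun v S j => le_rfl⟩
  | halt => exact ⟨0, fun v S j => le_rfl⟩

/-- A step pushes boundedly many letters, uniformly over the finitely many labels. This turns the
time bound of a given machine into the bound on the length of its output that `Comp` demands. -/
theorem steps_length_le {K Λ σ : Type} {Γ : K → Type} [DecidableEq K] [Finite Λ]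
    (M : Λ → TM2.Stmt Γ Λ σ) : ∃ c, ∀ t a b, Steps (TM2.step M) t a b →
      ∀ k, (b.stk k).length ≤ (a.stk k).length + t * c := by
  choose c hc using fun l => stepAux_length_le (M l)
  have := Fintype.ofFinite Λ
  refine ⟨∑ l, c l, fun t a b h k => ?_⟩
  induction h with
  | refl => simp
  | @head a b d t h _ ih =>
    obtain ⟨_ | l, v, S⟩ := a
    · simp [TM2.step] at h
    · simp only [TM2.step, Option.some.injEq] at h
      have h₁ := hc l v S k
      rw [h] at h₁
      have h₂ : c l ≤ ∑ l, c l := Finset.single_le_sum (fun _ _ => Nat.zero_le _)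
        (Finset.mem_univ l)
      have h₃ : (t + 1) * ∑ l, c l = t * ∑ l, c l + ∑ l, c l := by ring
      change (d.stk k).length ≤ (S k).length + _
      rw [h₃]
      omega

theorem initList_self (M : FinTM2) (s : List (M.Γ M.k₀)) : (initList M s).stk M.k₀ = s := by
  simp [initList]

theorem initList_ne (M : FinTM2) (s : List (M.Γ M.k₀)) {k : M.K} (h : k ≠ M.k₀) :
    (initList M s).stk k = [] := by
  simp [initList, h]

theorem haltList_self (M : FinTM2) (s : List (M.Γ M.k₁)) : (haltList M s).stk M.k₁ = s := by
  simp [haltList]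

theorem haltList_ne (M : FinTM2) (s : List (M.Γ M.k₁)) {k : M.K} (h : k ≠ M.k₁) :
    (haltList M s).stk k = [] := by
  simp [haltList, h]

theorem unaryEncodeNat_eq (n : ℕ) : Computability.unaryEncodeNat n = List.replicate n true := by
  induction n with
  | zero => rfl
  | succ n ih => simp [Computability.unaryEncodeNat, ih, List.replicate_succ]

open Classical in
/-- A stack machine whose letters are encoded by letters of `B`. -/
noncomputable def boxEmb (M : FinTM2) {B W : Type} (j : (Σ k, M.Γ k) ↪ B) (f : M.K ↪ W) :
    MachineEmb M.Γ (fun _ : W => Letter ⊕ B) M.Λ M.Λ M.σ M.σ where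
  stack := f
  stack_inj := f.injective
  enc k x := Sum.inr (j ⟨k, x⟩)
  dec k a := if h : ∃ x, a = Sum.inr (j ⟨k, x⟩) then some h.choose else none
  dec_enc k x := by
    have h : ∃ y, (Sum.inr (j ⟨k, x⟩) : Letter ⊕ B) = Sum.inr (j ⟨k, y⟩) := ⟨x, rfl⟩
    rw [dif_pos h]
    have := j.injective (Sum.inr.inj h.choose_spec)
    exact congrArg some (eq_of_heq (Sigma.mk.inj this).2).symm
  get := id
  set a _ := a
  get_set _ _ := rfl
  set_get _ := rfl
  set_set _ _ _ := rfl
  label := id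

/-- The stacks of the computation of the value of a black box with the stacks `K`. -/
abbrev BoxStack (W K : Type) : Type := Ctx.I ℕ ⊕ Option (Fin 1 ⊕ (W ⊕ K))

/-- The letters of a black box. -/
abbrev BoxLetter (M : FinTM2) : Type := Σ k, M.Γ k

/-- This is how given Turing machines enter. Their stacks become scratch stacks, with letters coded
in `B`; the input `1ⁿ` is produced from the variable, and the output stack is drained to the output.
A machine halts with its initial internal state and all stacks but the output empty, so everything
is restored as `Comp` requires. -/
theorem comp_of_machine {γ κ : Type} {enc : κ → List (Token γ)} {C : ℕ → κ}
    (h : TM2ComputableInPolyTime Computability.unaryEncodeNat enc C) (τ : Token γ → Letter)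
    {B : Type} (j : BoxLetter h.tm ↪ B) : Comp B fun n : ℕ => (enc (C n)).map τ := by
  obtain ⟨W, _, _, P, p, hP⟩ := Comp.entry (B := B) (X := ℕ) ()
  have := h.tm.ΛFin
  have := h.tm.σFin
  have := h.tm.kFin
  obtain ⟨c, hc⟩ := steps_length_le h.tm.m
  let f : h.tm.K ↪ BoxStack W h.tm.K := ⟨fun k => Sum.inr (some (Sum.inr (Sum.inr k))), fun a b h => by
    simpa using h⟩
  let E := boxEmb h.tm j f
  -- The output stack only holds codes of output letters, so the default `tick` is never used.
  let cls : Letter ⊕ B → Letter := fun a =>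
    ((E.dec h.tm.k₁ a).map fun x => τ (h.outputAlphabet x)).getD Token.tick
  have hrun : ∀ n : ℕ, (enc (C n)).length ≤ n + h.time.eval n * c ∧
      ∃ t ≤ h.time.eval n, Steps (TM2.step h.tm.m) t
        ⟨some h.tm.main, h.tm.initialState,
          (initList h.tm ((Computability.unaryEncodeNat n).map h.inputAlphabet.invFun)).stk⟩
        ⟨none, h.tm.initialState,
          (haltList h.tm ((enc (C n)).map h.outputAlphabet.invFun)).stk⟩ := by
    intro n
    have ho := h.outputsFun n
    have hst : Steps (TM2.step h.tm.m) ho.steps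
        ⟨some h.tm.main, h.tm.initialState,
          (initList h.tm ((Computability.unaryEncodeNat n).map h.inputAlphabet.invFun)).stk⟩
        ⟨none, h.tm.initialState,
          (haltList h.tm ((enc (C n)).map h.outputAlphabet.invFun)).stk⟩ :=
      steps_iff_iterate.2 ho.evals_in_steps
    have hle : ho.steps ≤ h.time.eval n := by
      have := ho.steps_le_m
      simpa [unaryEncodeNat_eq] using this
    refine ⟨?_, ho.steps, hle, hst⟩
    have h₁ := hc _ _ _ hst h.tm.k₁
    have h₂ : ((initList h.tm
        ((Computability.unaryEncodeNat n).map h.inputAlphabet.invFun)).stk h.tm.k₁).length ≤ n := by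
      by_cases hk : h.tm.k₁ = h.tm.k₀
      · rw [hk, initList_self]; simp [unaryEncodeNat_eq]
      · rw [initList_ne _ _ hk]; simp
    have h₃ := Nat.mul_le_mul_right c hle
    simp only [haltList_self, List.length_map] at h₁
    omega
  refine ⟨Fin 1 ⊕ (W ⊕ h.tm.K), inferInstance, inferInstance,
    (toScratch (X := ℕ) P ⟨Sum.inl, Sum.inl_injective⟩ 0).seq
    ((Frag.drain (Sum.inr (some (Sum.inl 0))) letterClass
      (fun _ => E.enc h.tm.k₀ (h.inputAlphabet.invFun true)) [f h.tm.k₀]).seq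
    ((Frag.ofMachine h.tm.m h.tm.main h.tm.initialState E).seq
    (Frag.drain (f h.tm.k₁) cls Sum.inl [Sum.inr none]))),
    p + (2 * Polynomial.X + 1) + h.time + (2 * (Polynomial.X + h.time * Polynomial.C c) + 1),
    fun n => ⟨?_, fun l => ?_⟩⟩
  · have := (hrun n).1
    simp [ctxSize_nat]; omega
  · obtain ⟨hlen, t, ht, hst⟩ := hrun n
    have h₁ := toScratch_runs (k := 1) (W := W ⊕ h.tm.K) (hP n).2 ⟨Sum.inl, Sum.inl_injective⟩ l
      (fun _ => []) 0
    let S₂ : BoxStack W h.tm.K → List (Letter ⊕ B) := Function.update (ctxStk n l) (f h.tm.k₀)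
      ((List.replicate n true).map fun x => E.enc h.tm.k₀ (h.inputAlphabet.invFun x))
    let S₃ : BoxStack W h.tm.K → List (Letter ⊕ B) := Function.update (ctxStk n l) (f h.tm.k₁)
      ((enc (C n)).map fun x => E.enc h.tm.k₁ (h.outputAlphabet.invFun x))
    have hf : ∀ k, f k = Sum.inr (some (Sum.inr (Sum.inr k))) := fun _ => rfl
    have hnil : ∀ k, (ctxStk n l : BoxStack W h.tm.K → List (Letter ⊕ B)) (f k) = [] := fun k => rfl
    refine (Frag.seq_runs h₁ (Frag.seq_runs (U := S₂) (T₁ := 2 * n + 1) ?_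
      (Frag.seq_runs (U := S₃) (T₁ := t)
        (Frag.ofMachine_runs (fun _ => rfl) (fun _ => rfl) (fun _ _ => rfl) hst le_rfl ?_ ?_ ?_)
        (T₂ := 2 * (enc (C n)).length + 1) ?_))).of_eq (scratch_nil n l) rfl ?_
    · have hs : (scratch (W ⊕ h.tm.K) B n l (Function.update (fun _ : Fin 1 => []) 0
          ((List.replicate (Ctx.val n ()) Token.tick).reverse ++ []))
            (Sum.inr (some (Sum.inl 0)))) = unary B n := by
        simp [scratch, unary, Ctx.val]
      have hl : 2 * n + 1 = 2 * (scratch (W ⊕ h.tm.K) B n l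
          (Function.update (fun _ : Fin 1 => []) 0
          ((List.replicate (Ctx.val n ()) Token.tick).reverse ++ []))
            (Sum.inr (some (Sum.inl 0)))).length + 1 := by
        rw [hs]; simp [unary]
      rw [hl]
      refine Frag.drain_runs (by simp) (by simp [hf]) ?_ ?_
      · simp only [S₂]
        rw [Function.update_of_ne (by simp [hf])]
        rfl
      · intro k hk
        rw [hs]
        by_cases hkf : k = f h.tm.k₀
        · subst hkf
          rw [if_pos (by simp)]
          simp only [S₂, Function.update_self]
          simp [unary, scratch, hf]
        · rw [if_neg (by simpa using hkf)]
          simp only [S₂]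
          rw [Function.update_of_ne hkf, ← scratch_nil (k := 1)]
          rcases k with k | _ | k | k
          · rfl
          · rfl
          · exact absurd (by rw [Subsingleton.elim k 0]) hk
          · rfl
    · intro k
      by_cases hk : k = h.tm.k₀
      · subst hk
        rw [initList_self, unaryEncodeNat_eq, List.map_map]
        exact Function.update_self _ _ _
      · rw [initList_ne _ _ hk]
        exact (Function.update_of_ne (fun h => hk (f.injective h)) _ _).trans (hnil k)
    · intro k
      by_cases hk : k = h.tm.k₁
      · subst hk
        rw [haltList_self, List.map_map]
        exact Function.update_self _ _ _
      · rw [haltList_ne _ _ hk]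
        exact (Function.update_of_ne (fun h => hk (f.injective h)) _ _).trans (hnil k)
    · intro r hr
      exact (Function.update_of_ne (fun h => hr ⟨_, h.symm⟩) _ _).trans
        (Function.update_of_ne (fun h => hr ⟨_, h.symm⟩) _ _).symm
    · have hl : 2 * (enc (C n)).length + 1 = 2 * (S₃ (f h.tm.k₁)).length + 1 := by
        simp [S₃]
      rw [hl]
      refine Frag.drain_runs (by simp) (by simp [hf]) rfl ?_
      intro k hk
      have hS : S₃ (f h.tm.k₁) = (enc (C n)).map fun x =>
        E.enc h.tm.k₁ (h.outputAlphabet.invFun x) := Function.update_self _ _ _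
      have hk' : S₃ k = ctxStk n l k := Function.update_of_ne hk _ _
      rw [hS, hk']
      by_cases hko : k = Sum.inr none
      · subst hko
        rw [if_pos (by simp)]
        simp [ctxStk, cls, E.dec_enc, Function.comp_def]
      · rw [if_neg (by simpa using hko)]
        rcases k with k | _ | k
        · rfl
        · exact absurd rfl hko
        · rfl
    · simp [ctxSize_nat]; omega

/-! ## From computed functions to Turing machines -/

section Wrapper

variable {γ W B : Type}

/-- The alphabets of a machine with a Boolean input stack, an output stack for descriptions, and
further stacks. -/
def IOLetter (γ R A : Type) : Bool ⊕ R → Type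
  | Sum.inl false => Bool
  | Sum.inl true => Token γ
  | Sum.inr _ => A

/-- The stacks of such a machine. -/
def ioStacks {R A : Type} (i : List Bool) (o : List (Token γ)) (S : R → List A) :
    ∀ k, List (IOLetter γ R A k)
  | Sum.inl false => i
  | Sum.inl true => o
  | Sum.inr r => S r

variable {R A : Type} [DecidableEq R]

theorem update_ioStacks_in (i i' : List Bool) (o : List (Token γ)) (S : R → List A) :
    Function.update (ioStacks i o S) (Sum.inl false) i' = ioStacks i' o S := by
  funext k
  rcases k with (_ | _) | r
  · exact Function.update_self _ _ _
  · exact Function.update_of_ne (by simp) _ _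
  · exact Function.update_of_ne (by simp) _ _

theorem update_ioStacks_out (i : List Bool) (o o' : List (Token γ)) (S : R → List A) :
    Function.update (ioStacks i o S) (Sum.inl true) o' = ioStacks i o' S := by
  funext k
  rcases k with (_ | _) | r
  · exact Function.update_of_ne (by simp) _ _
  · exact Function.update_self _ _ _
  · exact Function.update_of_ne (by simp) _ _

theorem update_ioStacks (i : List Bool) (o : List (Token γ)) (S : R → List A) (r : R)
    (l : List A) :
    Function.update (ioStacks i o S) (Sum.inr r) l = ioStacks i o (Function.update S r l) := by
  funext k
  rcases k with (_ | _) | r'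
  · exact Function.update_of_ne (by simp) _ _
  · exact Function.update_of_ne (by simp) _ _
  · by_cases h : r' = r
    · subst h
      exact (Function.update_self _ _ _).trans (Function.update_self (f := S) _ _).symm
    · exact (Function.update_of_ne (by simpa using h) _ _).trans
        (Function.update_of_ne (f := S) h _).symm

def ioEmb (γ Λ σ : Type) (R A : Type) :
    MachineEmb (fun _ : R => A) (IOLetter γ R A) Λ (Λ ⊕ Fin 3) σ (σ × Option Letter) where
  stack := Sum.inr
  stack_inj := Sum.inr_injective
  enc _ := id
  dec _ := some
  dec_enc _ _ := rfl
  get := Prod.fst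
  set a s := (a, s.2)
  get_set _ _ := rfl
  set_get _ := rfl
  set_set _ _ _ := rfl
  label := Sum.inl

/-- Move the input to the stack of the variable, run the fragment, clear the variable and move the
computed word to the output. -/
def ioProgram (ρ : Letter → Token γ) (P : Frag (Ctx.I ℕ ⊕ Option W) (Letter ⊕ B)) :
    P.Λ ⊕ Fin 3 → TM2.Stmt (IOLetter γ (Ctx.I ℕ ⊕ Option W) (Letter ⊕ B)) (P.Λ ⊕ Fin 3)
      (P.σ × Option Letter)
  | Sum.inl l => (ioEmb γ P.Λ P.σ _ _).stmt (.goto fun _ => Sum.inr 1) (P.m l)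
  | Sum.inr 0 => .pop (Sum.inl false) (fun s o => (s.1, o.map fun _ => Token.tick))
      (.branch (fun s => s.2.isSome)
        (.push (Sum.inr (Sum.inl ())) (fun _ => (Sum.inl Token.tick : Letter ⊕ B))
          (.goto fun _ => Sum.inr 0))
        (.goto fun _ => Sum.inl P.main))
  | Sum.inr 1 => .pop (Sum.inr (Sum.inl ())) (fun s o => (s.1, o.map fun _ => Token.tick))
      (.branch (fun s => s.2.isSome) (.goto fun _ => Sum.inr 1) (.goto fun _ => Sum.inr 2))
  | Sum.inr 2 => .pop (Sum.inr (Sum.inr none))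
        (fun s (o : Option (Letter ⊕ B)) => (s.1, o.map letterClass))
      (.branch (fun s => s.2.isSome)
        (.push (Sum.inl true) (fun s => ρ (s.2.getD Token.tick)) (.goto fun _ => Sum.inr 2))
        .halt)

variable [DecidableEq W] (ρ : Letter → Token γ)
  (P : Frag (Ctx.I ℕ ⊕ Option W) (Letter ⊕ B))

theorem ctxStk_update_var (n m : ℕ) (l : List Letter) :
    Function.update (ctxStk n l : Ctx.I ℕ ⊕ Option W → List (Letter ⊕ B)) (Sum.inl ())
      (unary B m) = ctxStk m l := by
  funext k
  rcases k with k | k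
  · exact Function.update_self _ _ _
  · exact Function.update_of_ne (by simp) _ _

theorem ctxStk_update_out (n : ℕ) (l w : List Letter) :
    Function.update (ctxStk n l : Ctx.I ℕ ⊕ Option W → List (Letter ⊕ B)) (Sum.inr none)
      (w.map Sum.inl) = ctxStk n w := by
  funext k
  rcases k with k | _ | k
  · exact Function.update_of_ne (by simp) _ _
  · exact Function.update_self _ _ _
  · exact Function.update_of_ne (by simp) _ _

theorem io_input (s : P.σ) (c : Option Letter) (n m : ℕ) :
    Steps (TM2.step (ioProgram ρ P)) (n + 1)
      ⟨some (Sum.inr 0), (s, c), ioStacks (List.replicate n true) [] (ctxStk m [])⟩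
      ⟨some (Sum.inl P.main), (s, none), ioStacks [] [] (ctxStk (n + m) [])⟩ := by
  induction n generalizing c m with
  | zero =>
    have e : 0 + m = m := Nat.zero_add m
    rw [e]
    exact Steps.head (congrArg (fun S => some (TM2.Cfg.mk (some (Sum.inl P.main)) (s, none) S))
      (update_ioStacks_in (List.replicate 0 true) [] [] (ctxStk m []))) (Steps.refl _)
  | succ n ih =>
    have h := ih (some Token.tick) (m + 1)
    rw [show n + (m + 1) = n + 1 + m by omega] at h
    refine Steps.head (congrArg (fun S => some (TM2.Cfg.mk (some (Sum.inr 0))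
      (s, some Token.tick) S)) ?_) h
    refine (congrArg (fun S : ∀ k, List (IOLetter γ (Ctx.I ℕ ⊕ Option W) (Letter ⊕ B) k) =>
      Function.update S (Sum.inr (Sum.inl ())) ((Sum.inl Token.tick : Letter ⊕ B) ::
        S (Sum.inr (Sum.inl ())))) (update_ioStacks_in _ _ _ _)).trans ?_
    exact (update_ioStacks _ _ _ _ _).trans
      (congrArg (ioStacks _ _) (ctxStk_update_var m (m + 1) []))

theorem io_clear (s : P.σ) (c : Option Letter) (n : ℕ) (l : List Letter) :
    Steps (TM2.step (ioProgram ρ P)) (n + 1)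
      ⟨some (Sum.inr 1), (s, c), ioStacks [] [] (ctxStk n l)⟩
      ⟨some (Sum.inr 2), (s, none), ioStacks [] [] (ctxStk 0 l)⟩ := by
  induction n generalizing c with
  | zero =>
    exact Steps.head (congrArg (fun S => some (TM2.Cfg.mk (some (Sum.inr 2)) (s, none) S))
      ((update_ioStacks _ _ _ _ _).trans (congrArg (ioStacks _ _) (ctxStk_update_var 0 0 l))))
      (Steps.refl _)
  | succ n ih =>
    exact Steps.head (congrArg (fun S => some (TM2.Cfg.mk (some (Sum.inr 1))
      (s, some Token.tick) S)) ((update_ioStacks _ _ _ _ _).trans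
        (congrArg (ioStacks _ _) (ctxStk_update_var (n + 1) n l)))) (ih (some Token.tick))

/-- Moving a word to another stack reverses it. This undoes the reversal in `Comp`, where the last
letter of the value lies on top. -/
theorem io_output (s : P.σ) (c : Option Letter) (w : List Letter) (o : List (Token γ)) :
    Steps (TM2.step (ioProgram ρ P)) (w.length + 1)
      ⟨some (Sum.inr 2), (s, c), ioStacks [] o (ctxStk 0 w)⟩
      ⟨none, (s, none), ioStacks [] ((w.map ρ).reverse ++ o) (ctxStk 0 [])⟩ := by
  induction w generalizing c o with
  | nil =>
    exact Steps.head (congrArg (fun S => some (TM2.Cfg.mk none (s, none) S))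
      ((update_ioStacks _ _ _ _ _).trans (congrArg (ioStacks _ _) (ctxStk_update_out 0 [] []))))
      (Steps.refl _)
  | cons a w ih =>
    have h := ih (some a) (ρ a :: o)
    rw [show (w.map ρ).reverse ++ ρ a :: o = ((a :: w).map ρ).reverse ++ o by simp] at h
    refine Steps.head (congrArg (fun S => some (TM2.Cfg.mk (some (Sum.inr 2))
      (s, some a) S)) ?_) h
    refine (congrArg (fun S : ∀ k, List (IOLetter γ (Ctx.I ℕ ⊕ Option W) (Letter ⊕ B) k) =>
      Function.update S (Sum.inl true) ((ρ (letterClass (Sum.inl a : Letter ⊕ B)) : Token γ) ::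
        S (Sum.inl true))) ((update_ioStacks _ _ _ _ _).trans
          (congrArg (ioStacks _ _) (ctxStk_update_out 0 (a :: w) w)))).trans ?_
    exact update_ioStacks_out _ _ _ _

end Wrapper

/-- A machine with the given stacks that runs `ioProgram`. -/
noncomputable def ioMachine {γ W B : Type} [Finite W] [DecidableEq W] (ρ : Letter → Token γ)
    (P : Frag (Ctx.I ℕ ⊕ Option W) (Letter ⊕ B)) : FinTM2 :=
  letI := Fintype.ofFinite W
  letI := Fintype.ofFinite P.Λ
  letI := Fintype.ofFinite P.σ
  letI := Fintype.ofFinite Letter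
  { K := Bool ⊕ (Unit ⊕ Option W)
    k₀ := Sum.inl false
    k₁ := Sum.inl true
    Γ := IOLetter γ (Ctx.I ℕ ⊕ Option W) (Letter ⊕ B)
    Λ := P.Λ ⊕ Fin 3
    main := Sum.inr 0
    σ := P.σ × Option Letter
    initialState := (P.init, none)
    Γk₀Fin := inferInstanceAs (Fintype Bool)
    m := ioProgram ρ P }

theorem ioMachine_outputs {γ W B : Type} [Finite W] [DecidableEq W] (ρ : Letter → Token γ)
    (P : Frag (Ctx.I ℕ ⊕ Option W) (Letter ⊕ B)) {T n : ℕ} {w : List Letter}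
    (h : P.Runs T (ctxStk n []) (ctxStk n w.reverse)) :
    ∃ t ≤ (n + 1) + (T + ((n + 1) + (w.length + 1))),
      (flip bind (ioMachine ρ P).step)^[t]
        (some (initList (ioMachine ρ P) (List.replicate n true))) =
        some (haltList (ioMachine ρ P) (w.map ρ)) := by
  obtain ⟨t, ht, hst⟩ := h
  obtain ⟨V, hV₁, hV₂, hV₃⟩ := (ioEmb γ P.Λ P.σ (Ctx.I ℕ ⊕ Option W) (Letter ⊕ B)).steps_of_steps
    (M' := ioProgram ρ P) (ex := .goto fun _ => Sum.inr 1) (fun _ => rfl) (s := (P.init, none))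
    (S' := ioStacks [] [] (ctxStk n [])) (fun k => (List.map_id _).symm) hst
  have hV : V = ioStacks [] [] (ctxStk n w.reverse) := by
    funext k
    rcases k with (_ | _) | r
    · exact hV₂ (Sum.inl false) (fun h => by obtain ⟨_, h⟩ := h; cases h)
    · exact hV₂ (Sum.inl true) (fun h => by obtain ⟨_, h⟩ := h; cases h)
    · exact (hV₁ r).trans (List.map_id _)
  subst hV
  have h₁ := io_input ρ P P.init none n 0
  have h₃ := io_clear ρ P P.init none n w.reverse
  have h₄ := io_output ρ P P.init none w.reverse []
  have hall := h₁.trans (Steps.trans hV₃ (h₃.trans h₄))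
  have hi : initList (ioMachine ρ P) (List.replicate n true) =
      ⟨some (Sum.inr 0), (P.init, none), ioStacks (List.replicate n true) [] (ctxStk 0 [])⟩ := by
    refine congrArg (TM2.Cfg.mk _ _) (funext fun k => ?_)
    rcases k with (_ | _) | _ | _ | k
    · exact initList_self (ioMachine ρ P) (List.replicate n true)
    · exact initList_ne (ioMachine ρ P) (List.replicate n true) (k := Sum.inl true) (by simp [ioMachine])
    · exact initList_ne (ioMachine ρ P) (List.replicate n true) (k := Sum.inr _) (by simp [ioMachine])
    · exact initList_ne (ioMachine ρ P) (List.replicate n true) (k := Sum.inr _) (by simp [ioMachine])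
    · exact initList_ne (ioMachine ρ P) (List.replicate n true) (k := Sum.inr _) (by simp [ioMachine])
  have hh : haltList (ioMachine ρ P) (w.map ρ) =
      ⟨none, (P.init, none), ioStacks [] ((w.reverse.map ρ).reverse ++ []) (ctxStk 0 [])⟩ := by
    have e : (w.reverse.map ρ).reverse ++ [] = w.map ρ := by
      rw [List.append_nil, List.map_reverse, List.reverse_reverse]
    rw [e]
    refine congrArg (TM2.Cfg.mk _ _) (funext fun k => ?_)
    rcases k with (_ | _) | _ | _ | k
    · exact haltList_ne (ioMachine ρ P) (w.map ρ) (k := Sum.inl false) (by simp [ioMachine])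
    · exact haltList_self (ioMachine ρ P) (w.map ρ)
    · exact haltList_ne (ioMachine ρ P) (w.map ρ) (k := Sum.inr _) (by simp [ioMachine])
    · exact haltList_ne (ioMachine ρ P) (w.map ρ) (k := Sum.inr _) (by simp [ioMachine])
    · exact haltList_ne (ioMachine ρ P) (w.map ρ) (k := Sum.inr _) (by simp [ioMachine])
  refine ⟨n + 1 + (t + (n + 1 + (w.reverse.length + 1))), ?_, ?_⟩
  · rw [List.length_reverse]
    omega
  · refine (congrArg (fun c => (flip bind (ioMachine ρ P).step)^[_] (some c)) hi).trans ?_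
    exact (steps_iff_iterate.1 hall).trans (congrArg some hh.symm)

/-- A computed function is printed by a Turing machine in polynomial time. -/
theorem polyTimeUniform_of_comp {γ κ B : Type} {enc : κ → List (Token γ)} {C : ℕ → κ}
    (τ : Token γ → Letter) (ρ : Letter → Token γ) (hρ : ∀ a, ρ (τ a) = a)
    (h : Comp B fun n : ℕ => (enc (C n)).map τ) : PolyTimeUniform enc C := by
  obtain ⟨W, _, _, P, p, hP⟩ := h
  -- The summands bound the input phase, the run, the clearing of the variable and the output phase;
  -- the last one uses that `p` also bounds the length of the word.
  have key : ∀ n : ℕ, ∃ t ≤ ((Polynomial.X + 1) + (p + ((Polynomial.X + 1) + (p + 1)))).eval n,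
      (flip bind (ioMachine ρ P).step)^[t]
        (some (initList (ioMachine ρ P) (List.replicate n true))) =
        some (haltList (ioMachine ρ P) (enc (C n))) := by
    intro n
    obtain ⟨hlen, hrun⟩ := hP n
    rw [ctxSize_nat] at hlen hrun
    beta_reduce at hlen hrun
    have hr := hrun []
    rw [List.append_nil] at hr
    obtain ⟨t, ht, h⟩ := ioMachine_outputs ρ P hr
    refine ⟨t, ht.trans ?_, ?_⟩
    · simp only [Polynomial.eval_add, Polynomial.eval_X, Polynomial.eval_one]
      omega
    · have e : ((enc (C n)).map τ).map ρ = enc (C n) := by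
        rw [List.map_map]
        exact (List.map_congr_left fun a _ => hρ a).trans (List.map_id _)
      exact h.trans (congrArg (fun l => some (haltList (ioMachine ρ P) l)) e)
  choose t ht h using key
  exact ⟨{  tm := ioMachine ρ P
            inputAlphabet := Equiv.refl Bool
            outputAlphabet := Equiv.refl (Token γ)
            time := (Polynomial.X + 1) + (p + ((Polynomial.X + 1) + (p + 1)))
            outputsFun := fun n =>
              { steps := t n
                evals_in_steps := by
                  have h' := h n
                  have e₁ : (Computability.unaryEncodeNat n).map (Equiv.refl Bool).invFun =
                      List.replicate n true := by
                    rw [unaryEncodeNat_eq]; exact List.map_id _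
                  have e₂ : (enc (C n)).map (Equiv.refl (Token γ)).invFun = enc (C n) :=
                    List.map_id _
                  exact (congrArg (fun l => (flip bind (ioMachine ρ P).step)^[t n]
                    (some (initList (ioMachine ρ P) l))) e₁).trans (h'.trans
                      (congrArg (fun l => some (haltList (ioMachine ρ P) l)) e₂.symm))
                steps_le_m := by
                  have h' := ht n
                  rw [unaryEncodeNat_eq, List.length_replicate]
                  exact h' } }⟩

/-! ## Closure properties -/

theorem Comp.congr {X B : Type} [Ctx X] {F G : X → List Letter} (h : Comp B F)
    (e : ∀ x, F x = G x) : Comp B G := by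
  have : F = G := funext e
  exact this ▸ h

/-- The function `N` is computed in polynomial time on unary numbers. -/
def NComp (B : Type) {X : Type} [Ctx X] (N : X → ℕ) : Prop :=
  Comp B fun x => List.replicate (N x) Token.tick

/-- The predicate `P` can be decided in polynomial time on unary numbers. -/
structure DComp (B : Type) {X : Type} [Ctx X] (P : X → Prop) : Prop where
  cond : ∀ F G : X → List Letter, Comp B F → Comp B G →
    Comp B fun x => open Classical in if P x then F x else G x

variable {X B : Type} [Ctx X]

namespace DComp

theorem select {P : X → Prop} [DecidablePred P] (h : DComp B P) {F G : X → List Letter}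
    (hF : Comp B F) (hG : Comp B G) : Comp B fun x => if P x then F x else G x :=
  (h.cond F G hF hG).congr fun x => by congr

theorem congr {P Q : X → Prop} (h : DComp B P) (e : ∀ x, P x ↔ Q x) : DComp B Q := by
  have : P = Q := funext fun x => propext (e x)
  exact this ▸ h

theorem not {P : X → Prop} (hP : DComp B P) : DComp B fun x => ¬ P x := by
  refine ⟨fun F G hF hG => ?_⟩
  classical
  refine (hP.select hG hF).congr fun x => ?_
  by_cases h : P x <;> simp [h]

theorem and {P Q : X → Prop} (hP : DComp B P) (hQ : DComp B Q) : DComp B fun x => P x ∧ Q x := by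
  refine ⟨fun F G hF hG => ?_⟩
  classical
  refine (hP.select (hQ.select hF hG) hG).congr fun x => ?_
  by_cases h : P x <;> by_cases h' : Q x <;> simp [h, h']

theorem or {P Q : X → Prop} (hP : DComp B P) (hQ : DComp B Q) : DComp B fun x => P x ∨ Q x := by
  refine ⟨fun F G hF hG => ?_⟩
  classical
  refine (hP.select hF (hQ.select hF hG)).congr fun x => ?_
  by_cases h : P x <;> by_cases h' : Q x <;> simp [h, h']

/-- The primitive decision from which the others are derived. The predicate `s` is arbitrary because
`getCase` allows a separate branch for every letter of the finite alphabet. -/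
theorem letter {F : X → List Letter} {N : X → ℕ} (hF : Comp B F) (hN : NComp B N)
    (s : Letter → Prop) : DComp B fun x => ∃ a, (F x)[N x]? = some a ∧ s a := by
  refine ⟨fun G H hG hH => ?_⟩
  classical
  refine (hF.getCase (H := fun o => if ∃ a, o = some a ∧ s a then G else H) hN fun o => ?_).congr
    fun x => ?_
  · split_ifs <;> assumption
  · simp only [List.length_replicate]
    split_ifs <;> rfl

/-- A word of `M x` ticks has a letter at position `N x` exactly when `N x < M x`. -/
theorem lt {N M : X → ℕ} (hN : NComp B N) (hM : NComp B M) : DComp B fun x => N x < M x := by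
  refine (letter (s := fun _ => True) hM hN).congr fun x => ?_
  by_cases h : N x < M x
  · simp [h]
  · simp [h]

theorem le {N M : X → ℕ} (hN : NComp B N) (hM : NComp B M) : DComp B fun x => N x ≤ M x :=
  (lt hM hN).not.congr fun _ => not_lt

theorem eq {N M : X → ℕ} (hN : NComp B N) (hM : NComp B M) : DComp B fun x => N x = M x :=
  ((le hN hM).and (le hM hN)).congr fun _ => le_antisymm_iff.symm

end DComp

/-- Substitution of a computed number, obtained from a loop over `j ≤ N x` in which every round
except the last contributes the empty word. -/
theorem Comp.letNat {N : X → ℕ} {F : X × ℕ → List Letter} (hN : NComp B N) (hF : Comp B F) :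
    Comp B fun x => F (x, N x) := by
  have h : NComp B fun x => N x + 1 :=
    (Comp.append hN (.const [Token.tick])).congr fun x => by
      simp [List.replicate_add]
  have h₂ : NComp B fun p : X × ℕ => N p.1 := Comp.fst hN
  have h₃ : NComp B fun p : X × ℕ => p.2 := Comp.entry (X := X × ℕ) none
  refine (Comp.range h ((DComp.eq h₃ h₂).select hF (.const []))).congr fun x => ?_
  have h₀ : (List.range (N x)).flatMap (fun j => if j = N x then F (x, j) else []) = [] := by
    rw [List.flatMap_eq_nil_iff]
    intro j hj
    rw [if_neg (List.mem_range.1 hj).ne]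
  simp [List.range_succ, h₀]

theorem Comp.flatMapRange {N : X → ℕ} {F : X × ℕ → List Letter} (hN : NComp B N)
    (hF : Comp B F) : Comp B fun x => (List.range (N x)).flatMap fun j => F (x, j) :=
  (Comp.range hN hF).congr fun x => by simp

namespace NComp

theorem congr {N M : X → ℕ} (h : NComp B N) (e : ∀ x, N x = M x) : NComp B M :=
  Comp.congr h fun x => by rw [e x]

theorem const (c : ℕ) : NComp B fun _ : X => c := Comp.const _

theorem id : NComp B fun n : ℕ => n := Comp.entry (X := ℕ) ()

theorem snd : NComp B fun p : X × ℕ => p.2 := Comp.entry (X := X × ℕ) none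

theorem fst {N : X → ℕ} (h : NComp B N) : NComp B fun p : X × ℕ => N p.1 := Comp.fst h

theorem ite {P : X → Prop} [DecidablePred P] {N M : X → ℕ} (hP : DComp B P) (hN : NComp B N)
    (hM : NComp B M) : NComp B fun x => if P x then N x else M x :=
  (hP.select hN hM).congr fun x => by dsimp only; split_ifs <;> rfl

theorem add {N M : X → ℕ} (hN : NComp B N) (hM : NComp B M) : NComp B fun x => N x + M x :=
  (Comp.append hN hM).congr fun _ => List.replicate_append_replicate

theorem sum {N : X → ℕ} {M : X × ℕ → ℕ} (hN : NComp B N) (hM : NComp B M) :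
    NComp B fun x => ∑ j ∈ Finset.range (N x), M (x, j) := by
  refine (Comp.flatMapRange hN hM).congr fun x => ?_
  dsimp only
  induction N x with
  | zero => rfl
  | succ n ih =>
    rw [List.range_succ, List.flatMap_append, ih, Finset.sum_range_succ]
    simp [List.replicate_append_replicate]

theorem mul {N M : X → ℕ} (hN : NComp B N) (hM : NComp B M) : NComp B fun x => N x * M x :=
  (sum hN hM.fst).congr fun x => by simp

theorem pow {N : X → ℕ} (hN : NComp B N) (k : ℕ) : NComp B fun x => N x ^ k := by
  induction k with
  | zero => exact (const 1).congr fun x => (pow_zero _).symm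
  | succ k ih => exact (ih.mul hN).congr fun x => (pow_succ _ _).symm

/-- Arithmetic by counting: the difference is the number of `j < N x` with `M x ≤ j`. -/
theorem sub {N M : X → ℕ} (hN : NComp B N) (hM : NComp B M) : NComp B fun x => N x - M x := by
  refine (sum hN (ite (DComp.le (B := B) hM.fst snd) (const 1) (const 0))).congr fun x => ?_
  rw [← Finset.sum_filter, Finset.sum_const, smul_eq_mul, mul_one]
  have : (Finset.range (N x)).filter (fun j => M x ≤ j) = Finset.Ico (M x) (N x) := by
    ext j; simp; tauto
  rw [this, Nat.card_Ico]

theorem length {F : X → List Letter} (hF : Comp B F) : NComp B fun x => (F x).length :=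
  (Comp.range hF (.const [Token.tick])).congr fun x => by
    simp only [List.flatMap_def, List.map_const', List.length_range]
    induction (F x).length with
    | zero => rfl
    | succ n ih => rw [List.replicate_succ, List.flatten_cons, ih]; rfl

end NComp

/-- Evaluation of a function of one variable at a computed number. -/
theorem Comp.at₁ {F : ℕ → List Letter} {N : X → ℕ} (hF : Comp B F) (hN : NComp B N) :
    Comp B fun x => F (N x) := Comp.letNat hN (Comp.snd hF)

theorem Comp.at₂ {F : ℕ × ℕ → List Letter} {N M : X → ℕ} (hF : Comp B F) (hN : NComp B N)
    (hM : NComp B M) : Comp B fun x => F (N x, M x) := by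
  have h : Comp B fun p : (X × ℕ) × ℕ => F (p.1.2, p.2) :=
    Comp.rename hF (fun p : (X × ℕ) × ℕ => (p.1.2, p.2))
      (fun i => i.elim none fun _ => some none)
      (by rintro (_ | _) (_ | _) h <;> first | rfl | cases h) (by rintro x (_ | _) <;> rfl)
  exact Comp.letNat hN (Comp.letNat (hM.fst) h)

theorem NComp.at₁ {F : ℕ → ℕ} {N : X → ℕ} (hF : NComp B F) (hN : NComp B N) :
    NComp B fun x => F (N x) := Comp.at₁ (F := fun n => List.replicate (F n) _) hF hN

theorem NComp.at₂ {F : ℕ × ℕ → ℕ} {N M : X → ℕ} (hF : NComp B F) (hN : NComp B N)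
    (hM : NComp B M) : NComp B fun x => F (N x, M x) :=
  Comp.at₂ (F := fun n => List.replicate (F n) _) hF hN hM

theorem DComp.of_ite {P : X → Prop} [DecidablePred P]
    (h : NComp B fun x => if P x then 1 else 0) : DComp B P := by
  refine (DComp.lt (NComp.const 0) h).congr fun x => ?_
  split_ifs with hx <;> simp [hx]

theorem DComp.ite {P : X → Prop} [DecidablePred P] (h : DComp B P) :
    NComp B fun x => if P x then 1 else 0 := NComp.ite h (.const 1) (.const 0)

theorem DComp.at₂ {P : ℕ × ℕ → Prop} {N M : X → ℕ} (hP : DComp B P) (hN : NComp B N)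
    (hM : NComp B M) : DComp B fun x => P (N x, M x) := by
  classical
  exact of_ite ((NComp.at₂ (F := fun n => if P n then 1 else 0) hP.ite hN hM).congr fun _ => rfl)

/-- A bounded existential statement says that a sum of indicators is positive. -/
theorem DComp.existsLt {N : X → ℕ} {P : X × ℕ → Prop} (hN : NComp B N) (hP : DComp B P) :
    DComp B fun x => ∃ j < N x, P (x, j) := by
  classical
  refine (DComp.lt (NComp.const 0) (NComp.sum hN hP.ite)).congr fun x => ?_
  rw [Finset.sum_pos_iff]
  simp only [Finset.mem_range, Nat.pos_iff_ne_zero]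
  simp

theorem DComp.forallLt {N : X → ℕ} {P : X × ℕ → Prop} (hN : NComp B N) (hP : DComp B P) :
    DComp B fun x => ∀ j < N x, P (x, j) :=
  (DComp.existsLt hN hP.not).not.congr fun x => by push Not; rfl

/-- The search for a cofactor is bounded by `M x`: for `N x = 0` the cofactor `0` will do, and
otherwise a cofactor is at most the product. -/
theorem DComp.dvd {N M : X → ℕ} (hN : NComp B N) (hM : NComp B M) :
    DComp B fun x => N x ∣ M x := by
  refine (DComp.existsLt (P := fun p => M p.1 = N p.1 * p.2) (hM.add (.const 1))
    (DComp.eq hM.fst (hN.fst.mul .snd))).congr fun x => ?_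
  constructor
  · rintro ⟨j, -, h⟩; exact ⟨j, h⟩
  · rintro ⟨j, h⟩
    rcases Nat.eq_zero_or_pos (N x) with h0 | h0
    · exact ⟨0, Nat.succ_pos _, by simpa [h0] using h⟩
    · exact ⟨j, by rw [h]; nlinarith, h⟩

/-- A positive number that is not a power of two has an odd prime factor. The right-hand side is a
bounded search, to which the closure rules apply. -/
theorem isPowerOfTwo_iff (s : ℕ) :
    (∃ k, s = 2 ^ k) ↔ 0 < s ∧ ∀ d < s + 1, d ∣ s → d = 1 ∨ 2 ∣ d := by
  constructor
  · rintro ⟨k, rfl⟩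
    refine ⟨by positivity, fun d _ hd => ?_⟩
    obtain ⟨j, -, rfl⟩ := (Nat.dvd_prime_pow Nat.prime_two).1 hd
    rcases j with _ | j
    · exact Or.inl rfl
    · exact Or.inr ⟨2 ^ j, by rw [pow_succ]; ring⟩
  · rintro ⟨h0, h⟩
    rcases Nat.eq_two_pow_or_exists_odd_prime_and_dvd s with h' | ⟨p, hp, hps, hodd⟩
    · exact h'
    · rcases h p (Nat.lt_succ_of_le (Nat.le_of_dvd h0 hps)) hps with h₁ | h₂
      · exact absurd h₁ hp.ne_one
      · exact absurd hodd (by rw [Nat.not_odd_iff_even]; exact even_iff_two_dvd.2 h₂)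

theorem DComp.isPowerOfTwo {N : X → ℕ} (hN : NComp B N) : DComp B fun x => ∃ k, N x = 2 ^ k := by
  refine ((DComp.lt (.const 0) hN).and (DComp.forallLt (P := fun p => p.2 ∣ N p.1 → p.2 = 1 ∨ 2 ∣ p.2)
    (hN.add (.const 1)) ?_)).congr fun x => (isPowerOfTwo_iff (N x)).symm
  refine ((DComp.dvd .snd hN.fst).not.or ((DComp.eq .snd (.const 1)).or
    (DComp.dvd (.const 2) .snd))).congr fun x => ?_
  tauto

/-! ### Polynomials with rational coefficients -/

theorem NComp.polynomial (p : Polynomial ℕ) : NComp B fun n : ℕ => p.eval n := by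
  have h : (fun n : ℕ => p.eval n) = fun n => ∑ j ∈ Finset.range (p.natDegree + 1), p.coeff j * n ^ j :=
    funext fun n => Polynomial.eval_eq_sum_range n
  rw [h]
  induction p.natDegree + 1 with
  | zero => exact (NComp.const 0).congr fun n => by simp
  | succ d ih =>
    exact (ih.add ((NComp.const (p.coeff d)).mul (NComp.id.pow d))).congr fun n => by
      rw [Finset.sum_range_succ]

/-- Clearing denominators and separating signs makes rational polynomials accessible to unary
arithmetic. -/
theorem exists_nat_polynomials (p : Polynomial ℚ) : ∃ (c : ℕ) (P Q : Polynomial ℕ), 0 < c ∧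
    ∀ n : ℕ, (c : ℚ) * p.eval (n : ℚ) = P.eval n - Q.eval n := by
  induction p using Polynomial.induction_on' with
  | add p q hp hq =>
    obtain ⟨c, P, Q, hc, h⟩ := hp
    obtain ⟨c', P', Q', hc', h'⟩ := hq
    refine ⟨c * c', Polynomial.C c' * P + Polynomial.C c * P', Polynomial.C c' * Q + Polynomial.C c * Q',
      Nat.mul_pos hc hc', fun n => ?_⟩
    simp only [Polynomial.eval_add, Polynomial.eval_mul, Polynomial.eval_C, Nat.cast_add,
      Nat.cast_mul]
    linear_combination (c' : ℚ) * h n + (c : ℚ) * h' n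
  | monomial k a =>
    refine ⟨a.den, Polynomial.monomial k a.num.toNat, Polynomial.monomial k (-a.num).toNat, a.pos,
      fun n => ?_⟩
    have h : (a.den : ℚ) * a = ((a.num.toNat : ℤ) - ((-a.num).toNat : ℤ) : ℤ) := by
      rw [Rat.den_mul_eq_num]
      congr 1; omega
    simp only [Polynomial.eval_monomial]
    push_cast at h ⊢
    rw [← mul_assoc, h]
    ring

/-- With `c * t = P - Q` the division by `c` is done by counting the `j` with `c * (j + 1) ≤ P n - Q
n`; searching `j < P n` is enough because `t n ≤ P n`. The value at `0`, about which the hypothesis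
says nothing, is put in as a constant. -/
theorem NComp.of_rational_polynomial {t : ℕ → ℕ}
    (ht : ∃ p : Polynomial ℚ, ∀ n : ℕ, 1 ≤ n → (t n : ℚ) = p.eval (n : ℚ)) : NComp B t := by
  obtain ⟨p, hp⟩ := ht
  obtain ⟨c, P, Q, hc, h⟩ := exists_nat_polynomials p
  have hP := NComp.polynomial (B := B) P
  have hQ := NComp.polynomial (B := B) Q
  refine (NComp.ite (DComp.eq .id (.const 0)) (.const (t 0)) (NComp.sum hP (NComp.ite
    (DComp.le ((NComp.const c).mul (NComp.snd.add (.const 1))) (hP.fst.sub hQ.fst)) (.const 1)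
      (.const 0)))).congr fun n => ?_
  dsimp only
  split_ifs with hn
  · rw [hn]
  have h₁ := h n
  rw [← hp n (Nat.pos_of_ne_zero hn)] at h₁
  have h₂ : c * t n + Q.eval n = P.eval n := by
    have : ((c * t n + Q.eval n : ℕ) : ℚ) = (P.eval n : ℕ) := by
      push_cast; linarith
    exact_mod_cast this
  have h₃ : P.eval n - Q.eval n = c * t n := by omega
  have h₄ : t n ≤ P.eval n := by nlinarith
  simp only [h₃, Nat.mul_le_mul_left_iff hc]
  rw [← Finset.sum_filter, Finset.sum_const, smul_eq_mul, mul_one]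
  have : (Finset.range (P.eval n)).filter (fun j => j + 1 ≤ t n) = Finset.range (t n) := by
    ext j; simp; omega
  rw [this, Finset.card_range]

/-! ## Reading descriptions -/

section Reading

variable {X B : Type} [Ctx X]

theorem countP_take_eq_sum (m : Letter → Bool) (l : List Letter) (p : ℕ) :
    (l.take p).countP m =
      ∑ i ∈ Finset.range p, if (∃ a, l[i]? = some a ∧ m a = true) then 1 else 0 := by
  induction p with
  | zero => simp
  | succ p ih =>
    rw [Finset.sum_range_succ, ← ih, List.take_add_one, List.countP_append]
    congr 1
    rcases l[p]? with _ | a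
    · simp
    · by_cases h : m a <;> simp [h]

theorem NComp.countP_take (m : Letter → Bool) {F : X → List Letter} {N : X → ℕ} (hF : Comp B F)
    (hN : NComp B N) : NComp B fun x => ((F x).take (N x)).countP m := by
  classical
  exact (NComp.sum hN (DComp.letter (s := fun a => m a = true) hF.fst .snd).ite).congr fun x =>
    (countP_take_eq_sum m (F x) (N x)).symm

theorem NComp.countP (m : Letter → Bool) {F : X → List Letter} (hF : Comp B F) :
    NComp B fun x => (F x).countP m :=
  (NComp.countP_take m hF (.length hF)).congr fun x => by rw [List.take_length]

/-- The number of ticks at the beginning of a word. -/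
noncomputable def leadTicks (l : List Letter) : ℕ := (l.takeWhile (· = Token.tick)).length

theorem lt_leadTicks (l : List Letter) (j : ℕ) :
    j < leadTicks l ↔ ∀ i < j + 1, ∃ a, l[i]? = some a ∧ a = Token.tick := by
  induction l generalizing j with
  | nil => simp [leadTicks]; exact ⟨0, Nat.zero_le _⟩
  | cons a l ih =>
    by_cases ha : a = Token.tick
    · have hl : leadTicks (a :: l) = leadTicks l + 1 := by simp [leadTicks, ha]
      rw [hl]
      rcases j with _ | j
      · simp [ha]
      · rw [Nat.add_lt_add_iff_right, ih]
        constructor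
        · rintro h (_ | i) hi
          · exact ⟨a, rfl, ha⟩
          · exact h i (by omega)
        · intro h i hi
          exact h (i + 1) (by omega)
    · have hl : leadTicks (a :: l) = 0 := by simp [leadTicks, ha]
      rw [hl]
      constructor
      · intro h; omega
      · intro h
        obtain ⟨b, hb, hb'⟩ := h 0 (Nat.succ_pos _)
        exact absurd ((Option.some.inj hb).trans hb') ha

theorem NComp.leadTicks_drop {F : X → List Letter} {N : X → ℕ} (hF : Comp B F)
    (hN : NComp B N) : NComp B fun x => leadTicks ((F x).drop (N x)) := by
  classical
  refine (NComp.sum (.length hF) (DComp.ite (P := fun p : X × ℕ => ∀ i < p.2 + 1,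
    ∃ a, (F p.1)[N p.1 + i]? = some a ∧ a = Token.tick) (DComp.forallLt
      (P := fun q : (X × ℕ) × ℕ => ∃ a, (F q.1.1)[N q.1.1 + q.2]? = some a ∧ a = Token.tick)
      (NComp.snd.add (.const 1))
      (DComp.letter hF.fst.fst (hN.fst.fst.add .snd) _)))).congr fun x => ?_
  have h : ∀ j, (∀ i < j + 1, ∃ a, (F x)[N x + i]? = some a ∧ a = Token.tick) ↔
      j < leadTicks ((F x).drop (N x)) := by
    intro j
    simp only [lt_leadTicks, List.getElem?_drop]
  simp only [h]
  rw [← Finset.sum_filter, Finset.sum_const, smul_eq_mul, mul_one]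
  have hle : leadTicks ((F x).drop (N x)) ≤ (F x).length :=
    (List.IsPrefix.length_le (List.takeWhile_prefix _)).trans (by simp)
  have : (Finset.range (F x).length).filter (fun j => j < leadTicks ((F x).drop (N x))) =
      Finset.range (leadTicks ((F x).drop (N x))) := by
    ext j; simp; omega
  rw [this, Finset.card_range]

/-- The description of a wire number among the letters. -/
def wireWord (i : ℕ) : List Letter := List.replicate i Token.tick ++ [Token.sep]

theorem leadTicks_wireWord (i : ℕ) (l : List Letter) : leadTicks (wireWord i ++ l) = i := by
  induction i with
  | zero => simp [leadTicks, wireWord]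
  | succ i ih =>
    have : leadTicks (wireWord (i + 1) ++ l) = leadTicks (wireWord i ++ l) + 1 := by
      simp [leadTicks, wireWord, List.replicate_succ]
    rw [this, ih]

/-- Position `p` of `l` holds the `k`-th letter of `l` that satisfies `m`. -/
def IsMark (m : Letter → Bool) (l : List Letter) (k p : ℕ) : Prop :=
  (∃ a, l[p]? = some a ∧ m a = true) ∧ (l.take p).countP m = k

open Classical in
/-- The position of the `k`-th letter of `l` that satisfies `m`. -/
noncomputable def markPos (m : Letter → Bool) (l : List Letter) (k : ℕ) : ℕ :=
  ∑ p ∈ Finset.range l.length, if IsMark m l k p then p else 0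

theorem NComp.markPos (m : Letter → Bool) {F : X → List Letter} {K : X → ℕ} (hF : Comp B F)
    (hK : NComp B K) : NComp B fun x => markPos m (F x) (K x) := by
  classical
  refine (NComp.sum (.length hF) (NComp.ite (P := fun p : X × ℕ => IsMark m (F p.1) (K p.1) p.2)
    ((DComp.letter hF.fst .snd _).and (DComp.eq (.countP_take m hF.fst .snd) hK.fst)) .snd
      (.const 0))).congr fun x => ?_
  exact Finset.sum_congr rfl fun p _ => rfl

/-- Passing a mark raises the count, so no two positions can both hold the mark with a given number,
and the sum defining `markPos` reduces to one term. -/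
theorem markPos_eq {m : Letter → Bool} {l₁ l₂ : List Letter} {a : Letter} (ha : m a = true) :
    markPos m (l₁ ++ a :: l₂) (l₁.countP m) = l₁.length := by
  classical
  have hmono : ∀ {p q : ℕ}, p < q → IsMark m (l₁ ++ a :: l₂) (l₁.countP m) p →
      IsMark m (l₁ ++ a :: l₂) (l₁.countP m) q → False := by
    rintro p q hpq ⟨⟨b, hb, hmb⟩, hp⟩ ⟨-, hq⟩
    have h₁ : ((l₁ ++ a :: l₂).take (p + 1)).countP m = l₁.countP m + 1 := by
      rw [List.take_add_one, List.countP_append, hp, hb]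
      simp [hmb]
    have h₂ : ((l₁ ++ a :: l₂).take (p + 1)).countP m ≤
        ((l₁ ++ a :: l₂).take q).countP m := by
      refine List.Sublist.countP_le ?_
      exact (List.take_prefix_take_left (by omega)).sublist
    omega
  have hself : IsMark m (l₁ ++ a :: l₂) (l₁.countP m) l₁.length := by
    refine ⟨⟨a, by simp, ha⟩, by simp⟩
  rw [markPos, Finset.sum_eq_single l₁.length]
  · rw [if_pos hself]
  · intro q _ hq
    rw [if_neg]
    intro h
    rcases lt_or_gt_of_ne hq with h' | h'
    · exact hmono h' h hself
    · exact hmono h' hself h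
  · intro h
    simp at h

/-- The description of an instruction: a letter followed by wire numbers. -/
def itemWord (t : Letter × List ℕ) : List Letter := t.1 :: t.2.flatMap wireWord

/-- The letters that start an instruction. -/
noncomputable def isMarkLetter (a : Letter) : Bool := a ≠ Token.tick ∧ a ≠ Token.sep

theorem countP_wireWord {m : Letter → Bool} (hm : m Token.tick = false) (hm' : m Token.sep = false)
    (i : ℕ) : (wireWord i).countP m = 0 := by
  simp [wireWord, hm, hm']

theorem countP_itemWord {m : Letter → Bool} (hm : m Token.tick = false) (hm' : m Token.sep = false)
    (t : Letter × List ℕ) : (itemWord t).countP m = if m t.1 then 1 else 0 := by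
  have h : (t.2.flatMap wireWord).countP m = 0 := by
    rw [List.countP_flatMap, List.sum_eq_zero]
    intro n hn
    obtain ⟨i, -, rfl⟩ := List.mem_map.1 hn
    exact countP_wireWord hm hm' i
  rw [itemWord, List.countP_cons, h]
  simp

theorem countP_items {m : Letter → Bool} (hm : m Token.tick = false) (hm' : m Token.sep = false)
    (l : List (Letter × List ℕ)) : (l.flatMap itemWord).countP m = l.countP fun t => m t.1 := by
  induction l with
  | nil => rfl
  | cons t l ih =>
    rw [List.flatMap_cons, List.countP_append, ih, countP_itemWord hm hm', List.countP_cons]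
    omega

/-- The position of the `i`-th wire number of the `k`-th instruction. -/
noncomputable def argPos (l : List Letter) (k : ℕ) : ℕ → ℕ
  | 0 => markPos isMarkLetter l k + 1
  | i + 1 => argPos l k i + (leadTicks (l.drop (argPos l k i)) + 1)

/-- The `i`-th wire number of the `k`-th instruction. -/
noncomputable def argNat (l : List Letter) (k i : ℕ) : ℕ := leadTicks (l.drop (argPos l k i))

theorem NComp.argPos {F : X → List Letter} {K : X → ℕ} (hF : Comp B F) (hK : NComp B K) (i : ℕ) :
    NComp B fun x => argPos (F x) (K x) i := by
  induction i with
  | zero => exact (NComp.markPos _ hF hK).add (.const 1)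
  | succ i ih => exact ih.add ((NComp.leadTicks_drop hF ih).add (.const 1))

theorem NComp.argNat {F : X → List Letter} {K : X → ℕ} (hF : Comp B F) (hK : NComp B K) (i : ℕ) :
    NComp B fun x => argNat (F x) (K x) i :=
  NComp.leadTicks_drop hF (NComp.argPos hF hK i)

/-! ### Locating an instruction in a description -/

variable {pre : List Letter} {items : List (Letter × List ℕ)} {t : Letter × List ℕ} {k : ℕ}

/-- Wire numbers consist of ticks and separators, so the marks are exactly the heads of instructions
and the `k`-th mark starts the `k`-th instruction. The prefix `pre` accounts for the width written
in front of a quantum circuit. -/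
theorem split_items (hpre : pre.countP isMarkLetter = 0) (hmark : ∀ t ∈ items, isMarkLetter t.1 = true)
    (hk : items[k]? = some t) : ∃ l₁ l₂, pre ++ items.flatMap itemWord =
      l₁ ++ t.1 :: (t.2.flatMap wireWord ++ l₂) ∧
        markPos isMarkLetter (pre ++ items.flatMap itemWord) k = l₁.length := by
  obtain ⟨hk', rfl⟩ := List.getElem?_eq_some_iff.1 hk
  have hsplit : items = items.take k ++ items[k] :: items.drop (k + 1) := by
    rw [List.getElem_cons_drop, List.take_append_drop]
  have hw : pre ++ items.flatMap itemWord = (pre ++ (items.take k).flatMap itemWord) ++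
      items[k].1 :: (items[k].2.flatMap wireWord ++ (items.drop (k + 1)).flatMap itemWord) := by
    have h : items.flatMap itemWord = (items.take k).flatMap itemWord ++
        (itemWord items[k] ++ (items.drop (k + 1)).flatMap itemWord) := by
      rw [← List.flatMap_cons, ← List.flatMap_append, ← hsplit]
    rw [h]
    simp [itemWord, List.append_assoc]
  refine ⟨_, _, hw, ?_⟩
  have hc : (pre ++ (items.take k).flatMap itemWord).countP isMarkLetter = k := by
    rw [List.countP_append, hpre, countP_items (by simp [isMarkLetter]) (by simp [isMarkLetter]),
      List.countP_eq_length.2 fun t ht => hmark t (List.mem_of_mem_take ht), List.length_take]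
    omega
  have := markPos_eq (l₁ := pre ++ (items.take k).flatMap itemWord)
    (l₂ := items[k].2.flatMap wireWord ++ (items.drop (k + 1)).flatMap itemWord)
    (hmark _ (List.getElem_mem hk'))
  rw [hc] at this
  rw [hw, this]

theorem drop_argPos (hpre : pre.countP isMarkLetter = 0)
    (hmark : ∀ t ∈ items, isMarkLetter t.1 = true) (hk : items[k]? = some t) :
    ∃ l₂, ∀ i ≤ t.2.length, (pre ++ items.flatMap itemWord).drop
      (argPos (pre ++ items.flatMap itemWord) k i) = (t.2.drop i).flatMap wireWord ++ l₂ := by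
  obtain ⟨l₁, l₂, hw, hpos⟩ := split_items hpre hmark hk
  refine ⟨l₂, fun i => ?_⟩
  induction i with
  | zero =>
    intro _
    rw [argPos, hpos, hw]
    simp
  | succ i ih =>
    intro hi
    have h := ih (by omega)
    rw [argPos, ← List.drop_drop, h, List.drop_eq_getElem_cons (by omega : i < t.2.length),
      List.flatMap_cons, List.append_assoc, leadTicks_wireWord]
    have : (wireWord t.2[i]).length = t.2[i] + 1 := by simp [wireWord]
    rw [← this, List.drop_left]

theorem argNat_eq (hpre : pre.countP isMarkLetter = 0)
    (hmark : ∀ t ∈ items, isMarkLetter t.1 = true) (hk : items[k]? = some t) {i : ℕ}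
    (hi : i < t.2.length) : argNat (pre ++ items.flatMap itemWord) k i = t.2[i] := by
  obtain ⟨l₂, h⟩ := drop_argPos hpre hmark hk
  rw [argNat, h i hi.le, List.drop_eq_getElem_cons hi, List.flatMap_cons, List.append_assoc,
    leadTicks_wireWord]

theorem letter_markPos (hpre : pre.countP isMarkLetter = 0)
    (hmark : ∀ t ∈ items, isMarkLetter t.1 = true) (hk : items[k]? = some t) :
    (pre ++ items.flatMap itemWord)[markPos isMarkLetter (pre ++ items.flatMap itemWord) k]? =
      some t.1 := by
  obtain ⟨l₁, l₂, hw, hpos⟩ := split_items hpre hmark hk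
  rw [hpos, hw]
  simp

end Reading

/-! ## Circuits as computed lists -/

/-- Translation of a description along a map of the names of gates. -/
def Token.map {γ δ : Type} (f : γ → δ) : Token γ → Token δ
  | .tick => .tick
  | .sep => .sep
  | .out => .out
  | .gate g => .gate (f g)

theorem Token.map_map_of_leftInverse {γ δ : Type} {f : γ → δ} {g : δ → γ}
    (h : Function.LeftInverse g f) (a : Token γ) : (a.map f).map g = a := by
  cases a <;> simp [Token.map, h _]

/-- A classical gate as an instruction. -/
def BoolGate.item : BoolGate → Letter × List ℕ
  | .zero => (.gate (.inl .zero), [])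
  | .nand i j => (.gate (.inl .nand), [i, j])

/-- An output wire as an instruction. -/
def outItem (i : ℕ) : Letter × List ℕ := (.out, [i])

/-- A quantum gate as a name and a list of wire numbers. -/
abbrev RawGate : Type := QGateName × List ℕ

/-- A quantum gate as an instruction. -/
def RawGate.item (g : RawGate) : Letter × List ℕ := (.gate (.inr g.1), g.2)

/-- The name and the wire numbers of a quantum gate. -/
def QGate.raw {w : ℕ} (g : QGate w) : RawGate := (g.name, List.ofFn fun j => (g.wires j : ℕ))

theorem map_encodeWire {γ δ : Type} (f : γ → δ) (i : ℕ) :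
    (encodeWire i).map (Token.map f) = (encodeWire i : List (Token δ)) := by
  simp [encodeWire, Token.map]

theorem flatMap_outItem {γ : Type} (f : γ → BoolGateName ⊕ QGateName) (l : List ℕ) :
    (l.flatMap fun i => Token.out :: encodeWire i).map (Token.map f) =
      (l.map outItem).flatMap itemWord := by
  rw [List.map_flatMap, List.flatMap_map]
  congr 1; funext i
  simp [map_encodeWire, outItem, itemWord, Token.map]
  rfl

theorem BoolCircuit.map_encode (c : BoolCircuit) :
    c.encode.map (Token.map Sum.inl) =
      (c.gates.map BoolGate.item).flatMap itemWord ++ (c.outs.map outItem).flatMap itemWord := by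
  rw [BoolCircuit.encode, List.map_append, flatMap_outItem]
  congr 1
  rw [List.map_flatMap, List.flatMap_map]
  congr 1; funext g
  cases g
  · rfl
  · simp [BoolGate.encode, BoolGate.item, map_encodeWire, itemWord, Token.map]
    rfl

theorem QCircuit.map_encode (c : QCircuit) :
    c.encode.map (Token.map Sum.inr) = wireWord c.width ++
      ((c.gates.map fun g => g.raw.item).flatMap itemWord ++
        ((c.outs.map Fin.val).map outItem).flatMap itemWord) := by
  have h' : (c.outs.flatMap fun i => (Token.out : Token QGateName) :: encodeWire (i : ℕ)) =
      (c.outs.map Fin.val).flatMap fun i => Token.out :: encodeWire i := by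
    congr 1
    exact List.flatMap_pure_eq_map _ _
  rw [QCircuit.encode, List.map_append, List.map_append, h', flatMap_outItem, map_encodeWire,
    List.append_assoc]
  refine congrArg₂ _ rfl (congrArg₂ _ ?_ rfl)
  rw [List.map_flatMap, List.flatMap_map]
  congr 1; funext g
  simp only [QGate.encode, List.map_cons, Token.map, List.map_flatten, itemWord, RawGate.item,
    QGate.raw]
  congr 1
  rw [List.flatMap_def, List.map_ofFn, List.map_ofFn]
  congr 2
  funext j
  exact map_encodeWire _ _

/-! ### Recovering circuits from their descriptions -/

section Reading

variable {B : Type} {κ α : Type} {F : ℕ → List Letter}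

/-- The instruction starts with the name of a gate. -/
def isGateLetter : Letter → Bool
  | .gate _ => true
  | _ => false

def isOutLetter : Letter → Bool
  | .out => true
  | _ => false

theorem NComp.length_gates {pre : ℕ → List Letter} {gs : ℕ → List (Letter × List ℕ)}
    {os : ℕ → List ℕ} (hF : Comp B fun n => pre n ++ ((gs n).flatMap itemWord ++
      ((os n).map outItem).flatMap itemWord))
    (hpre : ∀ n, (pre n).countP isGateLetter = 0)
    (hg : ∀ n, ∀ t ∈ gs n, isGateLetter t.1 = true) : NComp B fun n => (gs n).length := by
  refine (NComp.countP isGateLetter hF).congr fun n => ?_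
  rw [List.countP_append, List.countP_append, hpre, countP_items rfl rfl, countP_items rfl rfl,
    List.countP_eq_length.2 (hg n), List.countP_eq_zero.2]
  · omega
  · intro t ht
    obtain ⟨i, -, rfl⟩ := List.mem_map.1 ht
    simp [outItem, isGateLetter]

theorem NComp.length_outs {pre : ℕ → List Letter} {gs : ℕ → List (Letter × List ℕ)}
    {os : ℕ → List ℕ} (hF : Comp B fun n => pre n ++ ((gs n).flatMap itemWord ++
      ((os n).map outItem).flatMap itemWord))
    (hpre : ∀ n, (pre n).countP isOutLetter = 0)
    (hg : ∀ n, ∀ t ∈ gs n, isGateLetter t.1 = true) : NComp B fun n => (os n).length := by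
  refine (NComp.countP isOutLetter hF).congr fun n => ?_
  rw [List.countP_append, List.countP_append, hpre, countP_items rfl rfl, countP_items rfl rfl,
    List.countP_eq_zero.2, List.countP_eq_length.2, List.length_map]
  · omega
  · intro t ht
    obtain ⟨i, -, rfl⟩ := List.mem_map.1 ht
    rfl
  · intro t ht h
    have h' := hg n t ht
    rcases t with ⟨_ | _ | _ | _, _⟩ <;> simp_all [isOutLetter, isGateLetter]

theorem isMarkLetter_of_item {gs : List (Letter × List ℕ)} {os : List ℕ}
    (hg : ∀ t ∈ gs, isGateLetter t.1 = true) (t : Letter × List ℕ)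
    (ht : t ∈ gs ++ os.map outItem) : isMarkLetter t.1 = true := by
  rcases List.mem_append.1 ht with ht | ht
  · have h := hg t ht
    rcases t with ⟨_ | _ | _ | _, _⟩ <;> simp_all [isMarkLetter, isGateLetter]
  · obtain ⟨i, -, rfl⟩ := List.mem_map.1 ht
    simp [outItem, isMarkLetter]

theorem outs_eq {pre : List Letter} {gs : List (Letter × List ℕ)} {os : List ℕ}
    (hpre : pre.countP isMarkLetter = 0)
    (hg : ∀ t ∈ gs, isGateLetter t.1 = true) :
    os = (List.range os.length).map fun k => argNat (pre ++ (gs.flatMap itemWord ++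
      (os.map outItem).flatMap itemWord)) (gs.length + k) 0 := by
  refine List.ext_getElem (by simp) fun k h₁ h₂ => ?_
  rw [List.getElem_map, List.getElem_range, ← List.flatMap_append]
  exact (argNat_eq (t := outItem os[k]) (i := 0) hpre (isMarkLetter_of_item hg)
    (by simp [h₁]) (by simp [outItem])).symm

/-- The gates and the output wires of a family of circuits can be computed from its description. -/
theorem boolCircuit_data {C : ℕ → BoolCircuit}
    (hC : Comp B fun n => (C n).encode.map (Token.map Sum.inl)) :
    NComp B (fun n => (C n).gates.length) ∧ NComp B (fun n => (C n).outs.length) ∧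
    ∃ (z : ℕ × ℕ → Prop) (a₁ a₂ o : ℕ × ℕ → ℕ), DComp B z ∧ NComp B a₁ ∧ NComp B a₂ ∧ NComp B o ∧
      (∀ n, (C n).gates = (List.range (C n).gates.length).map fun k =>
        open Classical in if z (n, k) then .zero else .nand (a₁ (n, k)) (a₂ (n, k))) ∧
      ∀ n, (C n).outs = (List.range (C n).outs.length).map fun k => o (n, k) := by
  classical
  have hC' : Comp B fun n => [] ++ (((C n).gates.map BoolGate.item).flatMap itemWord ++
      ((C n).outs.map outItem).flatMap itemWord) :=
    hC.congr fun n => (C n).map_encode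
  have hg : ∀ n, ∀ t ∈ (C n).gates.map BoolGate.item, isGateLetter t.1 = true := by
    intro n t ht
    obtain ⟨g, -, rfl⟩ := List.mem_map.1 ht
    cases g <;> rfl
  have h₁ : NComp B fun n => (C n).gates.length :=
    (NComp.length_gates hC' (fun _ => rfl) hg).congr fun n => List.length_map _
  have h₂ := NComp.length_outs hC' (fun _ => rfl) hg
  set L := fun n => [] ++ (((C n).gates.map BoolGate.item).flatMap itemWord ++
      ((C n).outs.map outItem).flatMap itemWord) with hL
  refine ⟨h₁, h₂, fun p => ∃ a, (L p.1)[markPos isMarkLetter (L p.1) p.2]? = some a ∧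
      a = Token.gate (.inl .zero), fun p => argNat (L p.1) p.2 0, fun p => argNat (L p.1) p.2 1,
      fun p => argNat (L p.1) ((C p.1).gates.length + p.2) 0,
      DComp.letter hC'.fst (NComp.markPos _ hC'.fst .snd) _, NComp.argNat hC'.fst .snd 0,
      NComp.argNat hC'.fst .snd 1, NComp.argNat hC'.fst (h₁.fst.add .snd) 0, fun n => ?_,
      fun n => ?_⟩
  · refine List.ext_getElem (by simp) fun k hk _ => ?_
    rw [List.getElem_map, List.getElem_range]
    dsimp only
    have hLn : L n = [] ++ ((C n).gates.map BoolGate.item ++ (C n).outs.map outItem).flatMap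
      itemWord := by rw [List.flatMap_append]
    have hk' : ((C n).gates.map BoolGate.item ++ (C n).outs.map outItem)[k]? =
        some ((C n).gates[k]).item := by
      rw [List.getElem?_append_left (by simpa using hk)]
      simp [hk]
    have hm := isMarkLetter_of_item (os := (C n).outs) (hg n)
    have h₀ : (L n)[markPos isMarkLetter (L n) k]? = some ((C n).gates[k]).item.1 := by
      rw [hLn]
      exact letter_markPos rfl hm hk'
    simp only [h₀]
    rcases hgk : (C n).gates[k] with _ | ⟨i, j⟩ <;> rw [hgk] at hk'
    · simp [BoolGate.item]
    · rw [if_neg (by simp [BoolGate.item]), hLn, argNat_eq rfl hm hk' (i := 0) (by simp [BoolGate.item]),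
        argNat_eq rfl hm hk' (i := 1) (by simp [BoolGate.item])]
      rfl
  · have := outs_eq (pre := []) (os := (C n).outs) rfl (hg n)
    simpa only [List.length_map] using this

theorem qCircuit_data {C : ℕ → QCircuit}
    (hC : Comp B fun n => (C n).encode.map (Token.map Sum.inr)) :
    NComp B (fun n => (C n).gates.length) ∧ NComp B (fun n => (C n).outs.length) ∧
    NComp B (fun n => (C n).width) ∧
    ∃ (z : ℕ × ℕ → QGateName) (a : ℕ × ℕ → ℕ → ℕ) (o : ℕ × ℕ → ℕ), (∀ g, DComp B fun p => z p = g) ∧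
      (∀ i, NComp B fun p => a p i) ∧ NComp B o ∧
      (∀ n, (C n).gates.map QGate.raw = (List.range (C n).gates.length).map fun k =>
        (z (n, k), (List.range (z (n, k)).arity).map (a (n, k)))) ∧
      ∀ n, (C n).outs.map Fin.val = (List.range (C n).outs.length).map fun k => o (n, k) := by
  classical
  have hC' : Comp B fun n => wireWord (C n).width ++
      (((C n).gates.map fun g => g.raw.item).flatMap itemWord ++
      (((C n).outs.map Fin.val).map outItem).flatMap itemWord) :=
    hC.congr fun n => (C n).map_encode
  have hg : ∀ n, ∀ t ∈ (C n).gates.map fun g => g.raw.item, isGateLetter t.1 = true := by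
    intro n t ht
    obtain ⟨g, -, rfl⟩ := List.mem_map.1 ht
    rfl
  have hpre : ∀ n, (wireWord (C n).width).countP isMarkLetter = 0 := fun n =>
    countP_wireWord (by simp [isMarkLetter]) (by simp [isMarkLetter]) _
  have h₁ : NComp B fun n => (C n).gates.length :=
    (NComp.length_gates hC' (fun _ => countP_wireWord rfl rfl _) hg).congr fun n => List.length_map _
  have h₂ : NComp B fun n => (C n).outs.length :=
    (NComp.length_outs hC' (fun _ => countP_wireWord rfl rfl _) hg).congr fun n => List.length_map _
  have h₃ : NComp B fun n => (C n).width :=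
    (NComp.leadTicks_drop hC' (.const 0)).congr fun n => by
      rw [List.drop_zero, leadTicks_wireWord]
  set L := fun n => wireWord (C n).width ++
      (((C n).gates.map fun g => g.raw.item).flatMap itemWord ++
      (((C n).outs.map Fin.val).map outItem).flatMap itemWord) with hL
  set lt : ℕ × ℕ → Option Letter := fun p => (L p.1)[markPos isMarkLetter (L p.1) p.2]? with hlt
  have hltD : ∀ s : Letter → Prop, DComp B fun p => ∃ a, lt p = some a ∧ s a := fun s =>
    DComp.letter hC'.fst (NComp.markPos _ hC'.fst .snd) _
  refine ⟨h₁, h₂, h₃, fun p => match lt p with | some (.gate (.inr g)) => g | _ => .X,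
    fun p i => argNat (L p.1) p.2 i, fun p => argNat (L p.1) ((C p.1).gates.length + p.2) 0,
      fun g => ?_, fun i => NComp.argNat hC'.fst .snd i,
      NComp.argNat hC'.fst (h₁.fst.add .snd) 0, fun n => ?_, fun n => ?_⟩
  -- The name `.X` also serves as the default where there is no quantum gate, so it has to be
  -- recognised by excluding the other names.
  · by_cases hX : g = .X
    · refine (hltD fun a => ∃ g', g' ≠ .X ∧ a = .gate (.inr g')).not.congr fun p => ?_
      subst hX
      rcases h : lt p with _ | _ | _ | _ | _ | _ <;> simp [h]
    · refine (hltD fun a => a = .gate (.inr g)).congr fun p => ?_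
      rcases h : lt p with _ | _ | _ | _ | _ | _ <;> simp [h, Ne.symm hX]
  · refine List.ext_getElem (by simp) fun k hk₁ hk₂ => ?_
    have hk : k < (C n).gates.length := by simpa using hk₁
    rw [List.getElem_map, List.getElem_map, List.getElem_range]
    dsimp only
    have hLn : L n = wireWord (C n).width ++ ((C n).gates.map (fun g => g.raw.item) ++
        ((C n).outs.map Fin.val).map outItem).flatMap itemWord := by rw [List.flatMap_append]
    have hk' : ((C n).gates.map (fun g => g.raw.item) ++ ((C n).outs.map Fin.val).map outItem)[k]? =
        some ((C n).gates[k]).raw.item := by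
      rw [List.getElem?_append_left (by simpa using hk)]
      simp [hk]
    have hm := isMarkLetter_of_item (os := (C n).outs.map Fin.val) (hg n)
    have h₀ : lt (n, k) = some ((C n).gates[k]).raw.item.1 := by
      rw [hlt]
      dsimp only
      rw [hLn]
      exact letter_markPos (hpre n) hm hk'
    rw [h₀]
    dsimp only [RawGate.item, QGate.raw]
    congr 1
    refine List.ext_getElem (by simp) fun i hi _ => ?_
    rw [List.getElem_map, List.getElem_range, hLn, argNat_eq (hpre n) hm hk' (i := i)]
    · rfl
  · have := outs_eq (os := (C n).outs.map Fin.val) (hpre n) (hg n)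
    simpa only [List.length_map] using this

end Reading

/-! ### Computed lists -/

/-- The list `L` can be computed in polynomial time when its entries are described by `e`. -/
def LComp (B : Type) {X α : Type} [Ctx X] (e : α → List Letter) (L : X → List α) : Prop :=
  Comp B fun x => (L x).flatMap e

namespace LComp

variable {X B α : Type} [Ctx X] {e : α → List Letter} {L M : X → List α}

theorem congr (h : LComp B e L) (he : ∀ x, L x = M x) : LComp B e M :=
  Comp.congr h fun x => by rw [he x]

theorem nil : LComp B e fun _ : X => [] := Comp.const []

theorem append (hL : LComp B e L) (hM : LComp B e M) : LComp B e fun x => L x ++ M x :=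
  (Comp.append hL hM).congr fun _ => List.flatMap_append.symm

theorem flatMapRange {N : X → ℕ} {K : X × ℕ → List α} (hN : NComp B N) (hK : LComp B e K) :
    LComp B e fun x => (List.range (N x)).flatMap fun j => K (x, j) :=
  (Comp.flatMapRange hN hK).congr fun _ => List.flatMap_assoc.symm

theorem ite {P : X → Prop} [DecidablePred P] (hP : DComp B P) (hL : LComp B e L)
    (hM : LComp B e M) : LComp B e fun x => if P x then L x else M x :=
  (hP.select hL hM).congr fun x => by dsimp only; split_ifs <;> rfl

theorem singleton {a : X → α} (h : Comp B fun x => e (a x)) : LComp B e fun x => [a x] :=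
  h.congr fun x => by simp

end LComp

theorem Comp.wireWord {X B : Type} [Ctx X] {N : X → ℕ} (h : NComp B N) :
    Comp B fun x => wireWord (N x) := Comp.append h (.const [Token.sep])

theorem Comp.item {X B : Type} [Ctx X] (a : Letter) {l : List (X → ℕ)} (h : ∀ N ∈ l, NComp B N) :
    Comp B fun x => itemWord (a, l.map fun N => N x) := by
  have : Comp B fun x => (l.map fun N => N x).flatMap QuantumPRG.wireWord := by
    induction l with
    | nil => exact Comp.const []
    | cons N l ih =>
      exact (Comp.append (Comp.wireWord (h N (by simp))) (ih fun N' h' => h N' (by simp [h']))).congr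
        fun x => by simp
  exact (Comp.append (.const [a]) this).congr fun x => rfl

/-! ## The classical circuit of the generator -/

/-- Run a list of gates on given wires. -/
def runGates (gs : List BoolGate) (v : List Bool) : List Bool :=
  gs.foldl (fun v g => v ++ [g.eval v]) v

theorem runGates_append (gs hs : List BoolGate) (v : List Bool) :
    runGates (gs ++ hs) v = runGates hs (runGates gs v) := List.foldl_append

theorem exists_runGates (gs : List BoolGate) (v : List Bool) :
    ∃ w, runGates gs v = v ++ w ∧ w.length = gs.length := by
  induction gs generalizing v with
  | nil => exact ⟨[], by simp [runGates], rfl⟩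
  | cons g gs ih =>
    obtain ⟨w, hw, hl⟩ := ih (v ++ [g.eval v])
    exact ⟨g.eval v :: w, by rw [runGates, List.foldl_cons]; exact hw.trans (by simp), by simp [hl]⟩

theorem length_runGates (gs : List BoolGate) (v : List Bool) :
    (runGates gs v).length = v.length + gs.length := by
  obtain ⟨w, hw, hl⟩ := exists_runGates gs v
  rw [hw, List.length_append, hl]

theorem runGates_getD (gs : List BoolGate) {v : List Bool} {i : ℕ} (hi : i < v.length) :
    (runGates gs v).getD i false = v.getD i false := by
  obtain ⟨w, hw, -⟩ := exists_runGates gs v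
  rw [hw, List.getD_append _ _ _ _ hi]

/-- The `k`-th gate reads only from the wires below `m + k`. -/
def LegalFrom : ℕ → List BoolGate → Prop
  | _, [] => True
  | m, g :: gs => g.ReadsBelow m ∧ LegalFrom (m + 1) gs

theorem legalFrom_iff (m : ℕ) (gs : List BoolGate) :
    LegalFrom m gs ↔ ∀ (k : ℕ) (hk : k < gs.length), (gs[k]).ReadsBelow (m + k) := by
  induction gs generalizing m with
  | nil => simp [LegalFrom]
  | cons g gs ih =>
    rw [LegalFrom, ih]
    constructor
    · rintro ⟨h₁, h₂⟩ (_ | k) hk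
      · exact h₁
      · have := h₂ k (by simpa using hk)
        rwa [add_assoc, add_comm 1 k] at this
    · intro h
      refine ⟨h 0 (by simp), fun k hk => ?_⟩
      have := h (k + 1) (by simpa using hk)
      rwa [show m + (k + 1) = m + 1 + k by omega] at this

theorem legalFrom_append (m : ℕ) (gs hs : List BoolGate) :
    LegalFrom m (gs ++ hs) ↔ LegalFrom m gs ∧ LegalFrom (m + gs.length) hs := by
  induction gs generalizing m with
  | nil => simp [LegalFrom]
  | cons g gs ih =>
    rw [List.cons_append, LegalFrom, LegalFrom, ih, List.length_cons, and_assoc,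
      show m + 1 + gs.length = m + (gs.length + 1) by omega]

/-- Rename the wires that a gate reads. -/
def BoolGate.rename (ρ : ℕ → ℕ) : BoolGate → BoolGate
  | .zero => .zero
  | .nand i j => .nand (ρ i) (ρ j)

/-- `ρ` places the wires of a circuit on `n` inputs on top of `L` existing wires. -/
structure Placement (n L : ℕ) (ρ : ℕ → ℕ) : Prop where
  input : ∀ i < n, ρ i < L
  new : ∀ k, ρ (n + k) = L + k

theorem Placement.lt {n L : ℕ} {ρ : ℕ → ℕ} (h : Placement n L ρ) {k i : ℕ} (hi : i < n + k) :
    ρ i < L + k := by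
  by_cases hn : i < n
  · exact (h.input i hn).trans_le (Nat.le_add_right _ _)
  · obtain ⟨m, rfl⟩ := Nat.exists_eq_add_of_le (not_lt.1 hn)
    rw [h.new]; omega

theorem LegalFrom.rename {n L : ℕ} {ρ : ℕ → ℕ} (h : Placement n L ρ) {gs : List BoolGate}
    (hgs : LegalFrom n gs) : LegalFrom L (gs.map (BoolGate.rename ρ)) := by
  rw [legalFrom_iff] at hgs ⊢
  intro k hk
  rw [List.length_map] at hk
  have := hgs k hk
  rw [List.getElem_map]
  rcases hg : gs[k] with _ | ⟨i, j⟩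
  · trivial
  · rw [hg] at this
    exact ⟨h.lt this.1, h.lt this.2⟩

/-- A circuit may be placed on top of existing wires: its gates write to consecutive new wires, as
`Placement` records, so every wire carries the same value as in the original run. The induction
removes the last gate. -/
theorem runGates_rename {n : ℕ} {ρ : ℕ → ℕ} {x v : List Bool} (hx : x.length = n)
    (h : Placement n v.length ρ) (hv : ∀ i < n, v.getD (ρ i) false = x.getD i false)
    {gs : List BoolGate} (hgs : LegalFrom n gs) : ∀ i < n + gs.length,
    (runGates (gs.map (BoolGate.rename ρ)) v).getD (ρ i) false = (runGates gs x).getD i false := by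
  induction gs using List.reverseRecOn with
  | nil => exact hv
  | append_singleton gs g ih =>
    obtain ⟨h₁, h₂, -⟩ := (legalFrom_append _ _ _).1 hgs
    have ih := ih h₁
    intro i hi
    rw [List.map_append, runGates_append, runGates_append]
    have hl₁ := length_runGates (gs.map (BoolGate.rename ρ)) v
    have hl₂ := length_runGates gs x
    rw [List.length_map] at hl₁
    rw [hx] at hl₂
    rw [List.length_append, List.length_singleton] at hi
    by_cases hi' : i < n + gs.length
    · rw [runGates_getD (List.map _ [g]) (hl₁.symm ▸ h.lt hi'),
        runGates_getD [g] (hl₂.symm ▸ hi'), ih i hi']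
    · have : i = n + gs.length := by omega
      subst this
      rw [h.new, ← hl₁, ← hl₂]
      simp only [List.map_cons, List.map_nil, runGates, List.foldl_cons, List.foldl_nil]
      rw [List.getD_append_right _ _ _ _ le_rfl, List.getD_append_right _ _ _ _ le_rfl,
        Nat.sub_self, Nat.sub_self]
      change BoolGate.eval _ _ = BoolGate.eval _ _
      rcases g with _ | ⟨a, b⟩
      · rfl
      · simp only [BoolGate.eval, BoolGate.rename]
        exact congrArg₂ (fun p q => !(p && q)) (ih a h₂.1) (ih b h₂.2)

/-- A `nand` of a wire with itself is a negation. Two rows of negations copy scattered output wires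
to consecutive new ones, where the next block expects its input. -/
theorem runGates_not (n : ℕ) (o : ℕ → ℕ) (v : List Bool) (ho : ∀ i < n, o i < v.length) :
    runGates ((List.range n).map fun i => .nand (o i) (o i)) v =
      v ++ (List.range n).map fun i => !(v.getD (o i) false) := by
  induction n with
  | zero => simp [runGates]
  | succ n ih =>
    rw [List.range_succ, List.map_append, runGates_append, ih fun i hi => ho i (by omega)]
    simp only [List.map_cons, List.map_nil, runGates, List.foldl_cons, List.foldl_nil,
      BoolGate.eval, List.map_append, Bool.and_self]
    rw [List.getD_append _ _ _ _ (ho n (by omega)), List.append_assoc]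

theorem legalFrom_not (n m : ℕ) (o : ℕ → ℕ) (ho : ∀ i < n, o i < m) :
    LegalFrom m ((List.range n).map fun i => .nand (o i) (o i)) := by
  rw [legalFrom_iff]
  intro k hk
  rw [List.getElem_map, List.getElem_range]
  have := ho k (by simpa using hk)
  exact ⟨by omega, by omega⟩

/-- The number of wires that a block of the circuit of the generator adds. -/
def blockSize (n : ℕ) (cf cb : BoolCircuit) : ℕ := 2 * n + cb.gates.length + cf.gates.length

/-- The wires of the circuit of the permutation in a block that starts at wire `L`. -/
def blockWire (n gb L w : ℕ) : ℕ := if w < n then L + w else L + gb + w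

/-- The gates that compute the hard-core bit and the next state from the state on the wires
`L, …, L + n - 1`. -/
def blockGates (n : ℕ) (cf cb : BoolCircuit) (L : ℕ) : List BoolGate :=
  cb.gates.map (BoolGate.rename fun w => L + w) ++
    (cf.gates.map (BoolGate.rename (blockWire n cb.gates.length L)) ++
      (((List.range n).map fun i => .nand (blockWire n cb.gates.length L (cf.outs.getD i 0))
          (blockWire n cb.gates.length L (cf.outs.getD i 0))) ++
        (List.range n).map fun i => .nand (L + n + cb.gates.length + cf.gates.length + i)
          (L + n + cb.gates.length + cf.gates.length + i)))

/-! ### Correctness of one block of the generator -/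

section Block

variable {n : ℕ} {cf cb : BoolCircuit} {L : ℕ}

theorem length_blockGates : (blockGates n cf cb L).length = blockSize n cf cb := by
  simp [blockGates, blockSize]; omega

theorem placement_shift : Placement n (L + n) fun w => L + w :=
  ⟨fun _ hi => by omega, fun _ => by omega⟩

theorem placement_blockWire (g : ℕ) : Placement n (L + n + g) (blockWire n g L) :=
  ⟨fun _ hi => by rw [blockWire, if_pos hi]; omega,
    fun k => by rw [blockWire, if_neg (by omega)]; omega⟩

theorem outs_getD_lt (hf : cf.WellFormed n) (ho : cf.outs.length = n) {i : ℕ} (hi : i < n) :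
    blockWire n cb.gates.length L (cf.outs.getD i 0) < L + n + cb.gates.length + cf.gates.length := by
  have h := hf.2 (cf.outs.getD i 0) (by
    rw [List.getD_eq_getElem _ _ (by omega)]; exact List.getElem_mem _)
  exact (placement_blockWire (L := L) cb.gates.length).lt h

theorem legalFrom_blockGates (hf : cf.WellFormed n) (hb : cb.WellFormed n)
    (ho : cf.outs.length = n) : LegalFrom (L + n) (blockGates n cf cb L) := by
  simp only [blockGates, legalFrom_append, List.length_map, List.length_range]
  refine ⟨((legalFrom_iff _ _).2 hb.1).rename placement_shift,
    ((legalFrom_iff _ _).2 hf.1).rename (placement_blockWire _), legalFrom_not _ _ _ fun i hi => ?_,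
    legalFrom_not _ _ _ fun i hi => ?_⟩
  · exact outs_getD_lt hf ho hi
  · omega

/-- One round of the invariant that the current state occupies the last `n` wires. Both subcircuits
read the state from there, the rows of negations move the new state to the end, and the hard-core
bit stays where it was computed because wires are never overwritten. -/
theorem runGates_blockGates (hf : cf.WellFormed n) (hb : cb.WellFormed n)
    (ho : cf.outs.length = n) {x v : List Bool} (hx : x.length = n) (hv : v.length = L + n)
    (hvx : v.drop L = x) {ob : ℕ} (hob : ob ∈ cb.outs) :
    (runGates (blockGates n cf cb L) v).drop (L + blockSize n cf cb) = cf.eval x ∧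
      (runGates (blockGates n cf cb L) v).getD (L + ob) false = (cb.wires x).getD ob false := by
  simp only [blockGates, runGates_append]
  set v₁ := runGates (cb.gates.map (BoolGate.rename fun w => L + w)) v with hv₁
  set v₂ := runGates (cf.gates.map (BoolGate.rename (blockWire n cb.gates.length L))) v₁ with hv₂
  have hvget : ∀ i < n, v.getD (L + i) false = x.getD i false := by
    intro i hi
    rw [← hvx, List.getD_eq_getElem?_getD, List.getD_eq_getElem?_getD, List.getElem?_drop]
  have hl₁ : v₁.length = L + n + cb.gates.length := by
    rw [hv₁, length_runGates, List.length_map, hv]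
  have hl₂ : v₂.length = L + n + cb.gates.length + cf.gates.length := by
    rw [hv₂, length_runGates, List.length_map, hl₁]
  have h₁ : ∀ i < n + cb.gates.length, v₁.getD (L + i) false = (cb.wires x).getD i false :=
    runGates_rename (ρ := fun w => L + w) hx (by rw [hv]; exact placement_shift) hvget
      ((legalFrom_iff _ _).2 hb.1)
  have h₂ : ∀ i < n + cf.gates.length,
      v₂.getD (blockWire n cb.gates.length L i) false = (cf.wires x).getD i false := by
    refine runGates_rename hx (by rw [hl₁]; exact placement_blockWire _) (fun i hi => ?_)
      ((legalFrom_iff _ _).2 hf.1)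
    rw [blockWire, if_pos hi, hv₁, runGates_getD _ (by omega), hvget i hi]
  have hob' := hb.2 ob hob
  set o : ℕ → ℕ := fun i => blockWire n cb.gates.length L (cf.outs.getD i 0) with hodef
  have hoL : ∀ i < n, o i < v₂.length := fun i hi => by rw [hl₂]; exact outs_getD_lt hf ho hi
  constructor
  · rw [runGates_not n o v₂ hoL, runGates_not]
    · rw [List.drop_append_of_le_length (by simp [hl₂, blockSize]; omega), List.drop_eq_nil_of_le
        (by simp [hl₂, blockSize]; omega), List.nil_append]
      refine List.ext_getElem (by simp [BoolCircuit.eval, ho]) fun i hi _ => ?_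
      have hin : i < n := by simpa using hi
      have hof : cf.outs.getD i 0 = cf.outs[i] := List.getD_eq_getElem _ _ (by omega)
      rw [List.getElem_map, List.getElem_range,
        List.getD_append_right _ _ _ _ (by rw [hl₂]; omega),
        show L + n + cb.gates.length + cf.gates.length + i - v₂.length = i by omega,
        List.getD_eq_getElem _ _ (by simpa using hin), List.getElem_map, List.getElem_range,
        Bool.not_not, hodef]
      dsimp only
      rw [h₂ _ (by rw [hof]; exact hf.2 _ (List.getElem_mem _)), hof]
      simp [BoolCircuit.eval]
    · intro i hi
      simp [hl₂, hi]
  · rw [runGates_getD, runGates_getD, hv₂, runGates_getD, h₁ ob hob']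
    · omega
    · omega
    · rw [length_runGates, hl₂]; omega

end Block

/-- The circuit of the generator. -/
def generatorCircuit (n t : ℕ) (cf cb : BoolCircuit) : BoolCircuit where
  gates := (List.range t).flatMap fun j => blockGates n cf cb (j * blockSize n cf cb)
  outs := (List.range t).map fun k => (t - 1 - k) * blockSize n cf cb + cb.outs.getD 0 0

/-! ### Correctness of the circuit of the generator -/

section Generator

variable {n : ℕ} {cf cb : BoolCircuit} {f : List Bool → List Bool} {b : List Bool → Bool}

theorem length_generatorGates (t : ℕ) :
    ((List.range t).flatMap fun j => blockGates n cf cb (j * blockSize n cf cb)).length =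
      t * blockSize n cf cb := by
  induction t with
  | zero => simp
  | succ t ih =>
    rw [List.range_succ, List.flatMap_append, List.length_append, ih]
    simp [length_blockGates, add_mul]

theorem generatorCircuit_wellFormed (hf : cf.WellFormed n) (hb : cb.WellFormed n)
    (ho : cf.outs.length = n) (hob : cb.outs.length = 1) (t : ℕ) :
    (generatorCircuit n t cf cb).WellFormed n := by
  have hlt : cb.outs.getD 0 0 < n + cb.gates.length :=
    hb.2 _ (by rw [List.getD_eq_getElem _ _ (by omega)]; exact List.getElem_mem _)
  constructor
  · rw [← legalFrom_iff, generatorCircuit]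
    dsimp only
    induction t with
    | zero => trivial
    | succ t ih =>
      rw [List.range_succ, List.flatMap_append, legalFrom_append, length_generatorGates]
      refine ⟨ih, ?_⟩
      rw [List.flatMap_singleton, add_comm]
      exact legalFrom_blockGates hf hb ho
  · intro i hi
    obtain ⟨k, hk, rfl⟩ := List.mem_map.1 hi
    rw [generatorCircuit, length_generatorGates]
    have hk' := List.mem_range.1 hk
    have h₁ : (t - 1 - k + 1) * blockSize n cf cb ≤ t * blockSize n cf cb :=
      Nat.mul_le_mul_right _ (by omega)
    rw [add_mul, one_mul] at h₁
    have h₂ : n + cb.gates.length + n ≤ blockSize n cf cb + 0 := by rw [blockSize]; omega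
    omega

theorem generatorCircuit_eval (hf : cf.WellFormed n) (hb : cb.WellFormed n)
    (hfe : ∀ x : List Bool, x.length = n → cf.eval x = f x ∧ (f x).length = n)
    (hbe : ∀ x : List Bool, x.length = n → cb.eval x = [b x])
    (t : ℕ) {s : List Bool} (hs : s.length = n) :
    (generatorCircuit n t cf cb).eval s = ((List.range t).reverse).map fun i => b (f^[i] s) := by
  have ho : cf.outs.length = n := by
    rw [← (hfe s hs).2, ← (hfe s hs).1, BoolCircuit.eval, List.length_map]
  have hol : cb.outs.length = 1 := by
    have := congrArg List.length (hbe s hs)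
    simpa [BoolCircuit.eval] using this
  obtain ⟨ob, hob⟩ := List.length_eq_one_iff.1 hol
  have hit : ∀ j, (f^[j] s).length = n := by
    intro j
    induction j with
    | zero => exact hs
    | succ j ih => rw [Function.iterate_succ_apply']; exact (hfe _ ih).2
  -- After `m` blocks the last `n` wires hold the `m`-th iterate, and the bit of each earlier block
  -- is still available at a known position.
  have key : ∀ m, (runGates ((List.range m).flatMap fun j =>
      blockGates n cf cb (j * blockSize n cf cb)) s).drop (m * blockSize n cf cb) = f^[m] s ∧
      ∀ j < m, (runGates ((List.range m).flatMap fun j =>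
        blockGates n cf cb (j * blockSize n cf cb)) s).getD (j * blockSize n cf cb + ob) false =
          b (f^[j] s) := by
    intro m
    induction m with
    | zero => exact ⟨by simp [runGates], by simp⟩
    | succ m ih =>
      rw [List.range_succ, List.flatMap_append, runGates_append, List.flatMap_singleton]
      set v := runGates ((List.range m).flatMap fun j =>
        blockGates n cf cb (j * blockSize n cf cb)) s with hv
      have hvl : v.length = m * blockSize n cf cb + n := by
        rw [hv, length_runGates, length_generatorGates, hs, add_comm]
      obtain ⟨h₁, h₂⟩ := runGates_blockGates hf hb ho (hit m) hvl ih.1 (ob := ob) (by simp [hob])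
      refine ⟨?_, fun j hj => ?_⟩
      · rw [add_mul, one_mul, h₁, (hfe _ (hit m)).1, Function.iterate_succ_apply']
      · rcases Nat.lt_succ_iff_lt_or_eq.1 hj with hj | rfl
        · rw [runGates_getD, ih.2 j hj]
          have hlt := hb.2 ob (by simp [hob])
          have h₃ : (j + 1) * blockSize n cf cb ≤ m * blockSize n cf cb :=
            Nat.mul_le_mul_right _ hj
          rw [add_mul, one_mul] at h₃
          have h₄ : n + cb.gates.length + n ≤ blockSize n cf cb + 0 := by rw [blockSize]; omega
          omega
        · rw [h₂]
          have := hbe _ (hit j)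
          rw [BoolCircuit.eval, hob] at this
          simpa using this
  have hw : (generatorCircuit n t cf cb).wires s = runGates ((List.range t).flatMap fun j =>
      blockGates n cf cb (j * blockSize n cf cb)) s := rfl
  -- The generator outputs the latest bit first, so output `k` is read from block `t - 1 - k`.
  have hr : (List.range t).reverse = (List.range t).map (t - 1 - ·) :=
    List.ext_getElem (by simp) fun i _ _ => by simp
  rw [BoolCircuit.eval, hw, hr, List.map_map, generatorCircuit, List.map_map, hob]
  refine List.map_congr_left fun k hk => ?_
  exact (key t).2 _ (by have := List.mem_range.1 hk; omega)

end Generator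

/-! ## The generator is computable in polynomial time -/

section Description

variable {B X : Type} [Ctx X]

theorem Comp.atSnd {F : X × ℕ → List Letter} {M : X × ℕ → ℕ} (hF : Comp B F) (hM : NComp B M) :
    Comp B fun p : X × ℕ => F (p.1, M p) := by
  have h : Comp B fun p : (X × ℕ) × ℕ => F (p.1.1, p.2) :=
    Comp.rename hF (fun p : (X × ℕ) × ℕ => (p.1.1, p.2)) (fun i => i.elim none fun j => some (some j))
      (by rintro (_ | i) (_ | j) h <;> first | rfl | cases h; rfl | cases h) (by rintro x (_ | _) <;> rfl)
  exact Comp.letNat hM h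

theorem NComp.atSnd {F M : X × ℕ → ℕ} (hF : NComp B F) (hM : NComp B M) :
    NComp B fun p : X × ℕ => F (p.1, M p) :=
  Comp.atSnd (F := fun p => List.replicate (F p) _) hF hM

/-- The description of a classical gate among the letters. -/
def BoolGate.word (g : BoolGate) : List Letter := itemWord g.item

theorem LComp.nand {M N : X → ℕ} (hM : NComp B M) (hN : NComp B N) :
    LComp B BoolGate.word fun x => [BoolGate.nand (M x) (N x)] :=
  LComp.singleton (Comp.item (B := B) (l := [M, N]) _ (by simp [hM, hN]))

theorem LComp.mapRange {α : Type} {e : α → List Letter} {N : X → ℕ} {a : X × ℕ → α}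
    (hN : NComp B N) (ha : LComp B e fun p => [a p]) :
    LComp B e fun x => (List.range (N x)).map fun j => a (x, j) :=
  (LComp.flatMapRange hN ha).congr fun x => by simp [List.map_eq_flatMap]

theorem LComp.renamedGates {C : ℕ → BoolCircuit}
    (hC : Comp B fun n => (C n).encode.map (Token.map Sum.inl)) {N : X → ℕ} {ρ : X × ℕ → ℕ}
    (hN : NComp B N) (hρ : NComp B ρ) :
    LComp B BoolGate.word fun x => (C (N x)).gates.map (BoolGate.rename fun w => ρ (x, w)) := by
  classical
  obtain ⟨hg, -, z, a₁, a₂, o, hz, h₁, h₂, -, hgates, -⟩ := boolCircuit_data hC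
  refine (LComp.mapRange (N := fun x => (C (N x)).gates.length)
    (a := fun p : X × ℕ => if z (N p.1, p.2) then BoolGate.zero else
      .nand (ρ (p.1, a₁ (N p.1, p.2))) (ρ (p.1, a₂ (N p.1, p.2)))) (hg.at₁ hN) ?_).congr fun x => ?_
  · refine (LComp.ite (P := fun p : X × ℕ => z (N p.1, p.2)) (hz.at₂ hN.fst .snd)
      (LComp.singleton (a := fun _ => BoolGate.zero) (Comp.const _))
      (LComp.nand (hρ.atSnd (h₁.at₂ hN.fst .snd)) (hρ.atSnd (h₂.at₂ hN.fst .snd)))).congr fun p => ?_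
    split_ifs <;> rfl
  · conv_rhs => rw [hgates (N x), List.map_map]
    refine List.map_congr_left fun k _ => ?_
    dsimp only [Function.comp]
    split_ifs <;> rfl

/-- Gates and outputs of the given circuits are read back from their descriptions; the renaming of
wires within a block is a computable function of the block number and the wire. -/
theorem comp_generatorCircuit {cf cb : ℕ → BoolCircuit} {t : ℕ → ℕ}
    (hf : Comp B fun n => (cf n).encode.map (Token.map Sum.inl))
    (hb : Comp B fun n => (cb n).encode.map (Token.map Sum.inl)) (ht : NComp B t)
    (ho : ∀ n, (cf n).outs.length = n) (hob : ∀ n, (cb n).outs.length = 1) :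
    Comp B fun n => (generatorCircuit n (t n) (cf n) (cb n)).encode.map (Token.map Sum.inl) := by
  obtain ⟨hgf, -, -, -, -, o, -, -, -, hof, -, houtf⟩ := boolCircuit_data hf
  obtain ⟨hgb, -, -, -, -, o', -, -, -, hob', -, houtb⟩ := boolCircuit_data hb
  have hd : NComp B fun n => blockSize n (cf n) (cb n) :=
    (((NComp.const 2).mul .id).add hgb).add hgf
  have hL : NComp B fun p : ℕ × ℕ => p.2 * blockSize p.1 (cf p.1) (cb p.1) :=
    NComp.snd.mul hd.fst
  have hn : NComp B fun p : ℕ × ℕ => p.1 := NComp.id.fst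
  have hbw : NComp B fun q : (ℕ × ℕ) × ℕ => blockWire q.1.1 (cb q.1.1).gates.length
      (q.1.2 * blockSize q.1.1 (cf q.1.1) (cb q.1.1)) q.2 :=
    (NComp.ite (DComp.lt .snd hn.fst) (hL.fst.add .snd) ((hL.fst.add hgb.fst.fst).add .snd))
  have hofl : ∀ n i, i < n → (cf n).outs.getD i 0 = o (n, i) := by
    intro n i hi
    have h : i < (cf n).outs.length := by rw [ho]; exact hi
    conv_lhs => rw [houtf n]
    rw [List.getD_eq_getElem _ _ (by simpa using h), List.getElem_map, List.getElem_range]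
  have hob₀ : ∀ n, (cb n).outs.getD 0 0 = o' (n, 0) := by
    intro n
    conv_lhs => rw [houtb n, hob n]
    rfl
  have hmid : NComp B fun q : (ℕ × ℕ) × ℕ => q.1.2 * blockSize q.1.1 (cf q.1.1) (cb q.1.1) +
      q.1.1 + (cb q.1.1).gates.length + (cf q.1.1).gates.length + q.2 :=
    (((hL.fst.add hn.fst).add hgb.fst.fst).add hgf.fst.fst).add .snd
  have hbo : NComp B fun q : (ℕ × ℕ) × ℕ => blockWire q.1.1 (cb q.1.1).gates.length
      (q.1.2 * blockSize q.1.1 (cf q.1.1) (cb q.1.1)) (o (q.1.1, q.2)) :=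
    hbw.atSnd (hof.at₂ hn.fst .snd)
  have hblock : LComp B BoolGate.word fun p : ℕ × ℕ => blockGates p.1 (cf p.1) (cb p.1)
      (p.2 * blockSize p.1 (cf p.1) (cb p.1)) := by
    refine (LComp.append (LComp.renamedGates hb (ρ := fun q : (ℕ × ℕ) × ℕ =>
        q.1.2 * blockSize q.1.1 (cf q.1.1) (cb q.1.1) + q.2) hn (hL.fst.add .snd))
      (LComp.append (LComp.renamedGates hf hn hbw) (LComp.append
        (LComp.mapRange hn (LComp.nand hbo hbo))
        (LComp.mapRange hn (LComp.nand hmid hmid))))).congr fun p => ?_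
    have e : (List.range p.1).map (fun i => BoolGate.nand (blockWire p.1 (cb p.1).gates.length
          (p.2 * blockSize p.1 (cf p.1) (cb p.1)) (o (p.1, i))) (blockWire p.1
          (cb p.1).gates.length (p.2 * blockSize p.1 (cf p.1) (cb p.1)) (o (p.1, i)))) =
        (List.range p.1).map fun i => BoolGate.nand (blockWire p.1 (cb p.1).gates.length
          (p.2 * blockSize p.1 (cf p.1) (cb p.1)) ((cf p.1).outs.getD i 0)) (blockWire p.1
          (cb p.1).gates.length (p.2 * blockSize p.1 (cf p.1) (cb p.1))
          ((cf p.1).outs.getD i 0)) :=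
      List.map_congr_left fun i hi => by rw [hofl _ _ (List.mem_range.1 hi)]
    rw [blockGates, ← e]
  have hgates := LComp.flatMapRange ht hblock
  have houts : LComp B (fun i : ℕ => itemWord (outItem i)) fun n =>
      (List.range (t n)).map fun k => (t n - 1 - k) * blockSize n (cf n) (cb n) + o' (n, 0) := by
    refine LComp.mapRange (a := fun p : ℕ × ℕ => (t p.1 - 1 - p.2) *
      blockSize p.1 (cf p.1) (cb p.1) + o' (p.1, 0)) ht (LComp.singleton (Comp.item (B := B)
        (l := [fun p : ℕ × ℕ => (t p.1 - 1 - p.2) * blockSize p.1 (cf p.1) (cb p.1) +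
          o' (p.1, 0)]) _ ?_))
    intro N hN
    rw [List.mem_singleton.1 hN]
    exact (((ht.fst.sub (.const 1)).sub .snd).mul hd.fst).add (hob'.at₂ hn (.const 0))
  refine (Comp.append hgates houts).congr fun n => ?_
  rw [BoolCircuit.map_encode, generatorCircuit, List.flatMap_map, List.flatMap_map, List.flatMap_map]
  simp only [hob₀]
  rw [List.flatMap_map]
  rfl

end Description

theorem boolToken_inv (a : Token BoolGateName) :
    ((a.map Sum.inl : Letter).map fun s => s.elim id fun _ => BoolGateName.zero) = a :=
  Token.map_map_of_leftInverse (fun _ => rfl) a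

/-- The generator is computed by a polynomial-time algorithm. -/
theorem ptComputable_iteratedGenerator {f : List Bool → List Bool} {b : List Bool → Bool} {t : ℕ → ℕ}
    (hf : PTComputable f) (hfl : ∀ x, (f x).length = x.length) (hb : PTComputable fun x => [b x])
    (ht : ∃ p : Polynomial ℚ, ∀ n : ℕ, 1 ≤ n → (t n : ℚ) = p.eval (n : ℚ)) :
    PTComputable (iteratedGenerator f b t) := by
  obtain ⟨cf, ⟨uf⟩, wf, ef⟩ := hf
  obtain ⟨cb, ⟨ub⟩, wb, eb⟩ := hb
  -- Both machines have to run inside one program, so letters are coded in the disjoint union of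
  -- their alphabets.
  have hf' := comp_of_machine (B := BoxLetter uf.tm ⊕ BoxLetter ub.tm) uf (Token.map Sum.inl)
    ⟨Sum.inl, Sum.inl_injective⟩
  have hb' := comp_of_machine (B := BoxLetter uf.tm ⊕ BoxLetter ub.tm) ub (Token.map Sum.inl)
    ⟨Sum.inr, Sum.inr_injective⟩
  have hfe : ∀ n (x : List Bool), x.length = n → (cf n).eval x = f x ∧ (f x).length = n := by
    rintro _ x rfl
    exact ⟨ef x, hfl x⟩
  have hbe : ∀ n (x : List Bool), x.length = n → (cb n).eval x = [b x] := by
    rintro _ x rfl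
    exact eb x
  have ho : ∀ n, (cf n).outs.length = n := by
    intro n
    have h := hfe n (List.replicate n false) (List.length_replicate)
    have := congrArg List.length h.1
    simp only [BoolCircuit.eval, List.length_map] at this
    rw [this, h.2]
  have hob : ∀ n, (cb n).outs.length = 1 := by
    intro n
    have := congrArg List.length (hbe n (List.replicate n false) (List.length_replicate))
    simpa [BoolCircuit.eval] using this
  refine ⟨fun n => generatorCircuit n (t n) (cf n) (cb n), ?_, fun n =>
    generatorCircuit_wellFormed (wf n) (wb n) (ho n) (hob n) _, fun x =>
      generatorCircuit_eval (wf _) (wb _) (hfe _) (hbe _) _ rfl⟩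
  exact polyTimeUniform_of_comp (B := BoxLetter uf.tm ⊕ BoxLetter ub.tm) (Token.map Sum.inl)
    (Token.map fun s => s.elim id fun _ => BoolGateName.zero) boolToken_inv
    (comp_generatorCircuit hf' hb' (NComp.of_rational_polynomial ht) ho hob)

/-! ## Gates on basis operators -/

section Extend

variable {k l w : ℕ}

theorem eq_extend_iff (v : Fin k ↪ Fin w) (a : Fin k → Bool) (z p : Fin w → Bool) :
    p = Function.extend v a z ↔ (∀ i, i ∉ Set.range v → p i = z i) ∧ p ∘ v = a := by
  constructor
  · rintro rfl
    exact ⟨fun i hi => Function.extend_apply' _ _ _ fun ⟨j, hj⟩ => hi ⟨j, hj⟩,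
      Function.extend_comp v.injective _ _⟩
  · rintro ⟨h, rfl⟩
    funext i
    by_cases hi : i ∈ Set.range v
    · obtain ⟨j, rfl⟩ := hi
      rw [v.injective.extend_apply]; rfl
    · rw [Function.extend_apply' _ _ _ fun ⟨j, hj⟩ => hi ⟨j, hj⟩, h i hi]

theorem extend_trans (v : Fin k ↪ Fin l) (ι : Fin l ↪ Fin w) (a : Fin k → Bool)
    (x : Fin l → Bool) (c : Fin w → Bool) :
    Function.extend (v.trans ι) a (Function.extend ι x c) =
      Function.extend ι (Function.extend v a x) c := by
  refine ((eq_extend_iff _ _ _ _).2 ⟨fun i hi => ?_, ?_⟩).symm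
  · by_cases h : i ∈ Set.range ι
    · obtain ⟨j, rfl⟩ := h
      rw [ι.injective.extend_apply, ι.injective.extend_apply, Function.extend_apply']
      rintro ⟨m, rfl⟩
      exact hi ⟨m, rfl⟩
    · rw [Function.extend_apply' _ _ _ fun ⟨j, hj⟩ => h ⟨j, hj⟩,
        Function.extend_apply' _ _ _ fun ⟨j, hj⟩ => h ⟨j, hj⟩]
  · funext j
    simp only [Function.comp, Function.Embedding.trans_apply]
    rw [ι.injective.extend_apply, v.injective.extend_apply]

/-- From a basis state `z` a gate on the wires `v` leads only to states in which these wires are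
overwritten. -/
theorem liftOp_eq_sum (v : Fin k ↪ Fin w) (K : QOp k) (p z : Fin w → Bool) :
    liftOp v K p z = ∑ a, K a (z ∘ v) * if p = Function.extend v a z then 1 else 0 := by
  classical
  simp only [liftOp, Matrix.of_apply, eq_extend_iff, mul_ite, mul_one, mul_zero]
  split_ifs with h
  · simp only [fun a => (and_iff_right h : _ ∧ p ∘ v = a ↔ _), Finset.sum_ite_eq,
      Finset.mem_univ, if_true]
    rfl
  · simp only [fun a => (iff_false_intro fun h' => h h'.1 : _ ∧ p ∘ v = a ↔ _), if_false,
      Finset.sum_const_zero]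

end Extend

/-- The operator `|z⟩⟨z'|`. -/
noncomputable def ketBra {w : ℕ} (z z' : Fin w → Bool) : QOp w := Matrix.single z z' 1

/-- The map performed by a gate as a linear map. -/
noncomputable def QGate.applyL {w : ℕ} (g : QGate w) : QOp w →ₗ[ℂ] QOp w where
  toFun := g.apply
  map_add' ρ σ := by
    simp only [QGate.apply, mul_add, add_mul, List.sum_map_add]
  map_smul' c ρ := by
    simp only [QGate.apply, Matrix.mul_smul, Matrix.smul_mul, List.smul_sum, RingHom.id_apply,
      List.map_map]
    rfl

theorem QGate.applyL_apply {w : ℕ} (g : QGate w) (ρ : QOp w) : g.applyL ρ = g.apply ρ := rfl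

/-- The basis formula for gates. By linearity it determines their action, and the rules for
individual gates below are derived from it. -/
theorem QGate.apply_ketBra {w : ℕ} (g : QGate w) (z z' : Fin w → Bool) :
    g.apply (ketBra z z') = (g.name.kraus.map fun K => ∑ a, ∑ b,
      (K a (z ∘ g.wires) * star (K b (z' ∘ g.wires))) •
        ketBra (Function.extend g.wires a z) (Function.extend g.wires b z')).sum := by
  rw [QGate.apply]
  congr 1
  refine List.map_congr_left fun K _ => ?_
  ext p q
  have h : (liftOp g.wires K * ketBra z z' * (liftOp g.wires K)ᴴ) p q =
      liftOp g.wires K p z * star (liftOp g.wires K q z') := by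
    rw [ketBra, Matrix.mul_assoc, Matrix.mul_apply, Finset.sum_eq_single z]
    · rw [Matrix.mul_apply, Finset.sum_eq_single z']
      · simp [Matrix.conjTranspose_apply]
      · intro i _ hi; simp [Ne.symm hi]
      · simp
    · intro i _ hi
      rw [Matrix.mul_apply, Finset.sum_eq_zero, mul_zero]
      intro j _; simp [Ne.symm hi]
    · simp
  rw [h, liftOp_eq_sum, liftOp_eq_sum, star_sum, Finset.sum_mul_sum, Matrix.sum_apply]
  refine Finset.sum_congr rfl fun a _ => ?_
  rw [Matrix.sum_apply]
  refine Finset.sum_congr rfl fun b _ => ?_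
  rw [Matrix.smul_apply, ketBra, Matrix.single_apply, smul_eq_mul]
  rw [star_mul', mul_mul_mul_comm]
  simp only [eq_comm (a := p), eq_comm (a := q), ite_and]
  split_ifs <;> simp

/-- Linear maps on operators are determined by their values on basis operators. -/
theorem linearMap_ext_ketBra {w : ℕ} {M : Type} [AddCommMonoid M] [Module ℂ M]
    {f g : QOp w →ₗ[ℂ] M} (h : ∀ z z', f (ketBra z z') = g (ketBra z z')) : f = g := by
  refine Matrix.ext_linearMap ℂ fun z z' => LinearMap.ext_ring ?_
  exact h z z'

/-- The operators of a register on the wires `ι` of a larger register whose other wires are in the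
state `c`. -/
noncomputable def embedOp {l w : ℕ} (ι : Fin l ↪ Fin w) (c : Fin w → Bool) :
    QOp l →ₗ[ℂ] QOp w :=
  ∑ x, ∑ x', (LinearMap.toSpanSingleton ℂ (QOp w)
    (ketBra (Function.extend ι x c) (Function.extend ι x' c))).comp (Matrix.entryLinearMap ℂ ℂ x x')

theorem embedOp_ketBra {l w : ℕ} (ι : Fin l ↪ Fin w) (c : Fin w → Bool) (x x' : Fin l → Bool) :
    embedOp ι c (ketBra x x') = ketBra (Function.extend ι x c) (Function.extend ι x' c) := by
  simp only [embedOp, LinearMap.sum_apply, LinearMap.comp_apply, Matrix.entryLinearMap_apply,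
    LinearMap.toSpanSingleton_apply]
  rw [Finset.sum_eq_single x, Finset.sum_eq_single x']
  · simp [ketBra]
  · intro b _ hb; simp [ketBra, Ne.symm hb]
  · simp
  · intro b _ hb
    exact Finset.sum_eq_zero fun i _ => by simp [ketBra, Ne.symm hb]
  · simp

/-- The gate on a larger register. -/
def QGate.embed {l w : ℕ} (ι : Fin l ↪ Fin w) (g : QGate l) : QGate w := ⟨g.name, g.wires.trans ι⟩

/-- Idle wires in a fixed basis state do not interact with the gate. On `|x⟩⟨x'|` this is the fact
that overwriting wires commutes with the inclusion of the register, `extend_trans`. -/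
theorem QGate.embed_apply {l w : ℕ} (ι : Fin l ↪ Fin w) (c : Fin w → Bool) (g : QGate l)
    (ρ : QOp l) : (g.embed ι).apply (embedOp ι c ρ) = embedOp ι c (g.apply ρ) := by
  have : (g.embed ι).applyL.comp (embedOp ι c) = (embedOp ι c).comp g.applyL := by
    refine linearMap_ext_ketBra fun x x' => ?_
    rw [LinearMap.comp_apply, LinearMap.comp_apply, embedOp_ketBra, QGate.applyL_apply,
      QGate.applyL_apply, QGate.apply_ketBra, QGate.apply_ketBra, map_list_sum, List.map_map]
    congr 1
    refine List.map_congr_left fun K _ => ?_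
    have h : ∀ y : Fin l → Bool, Function.extend ι y c ∘ (g.embed ι).wires = y ∘ g.wires := by
      intro y
      funext j
      exact ι.injective.extend_apply _ _ _
    have hr : ∀ K : QOp g.name.arity, embedOp ι c (∑ a, ∑ b,
        (K a (x ∘ g.wires) * star (K b (x' ∘ g.wires))) •
          ketBra (Function.extend g.wires a x) (Function.extend g.wires b x')) =
        ∑ a, ∑ b, (K a (x ∘ g.wires) * star (K b (x' ∘ g.wires))) •
          ketBra (Function.extend ι (Function.extend g.wires a x) c)
            (Function.extend ι (Function.extend g.wires b x') c) := by
      intro K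
      simp only [map_sum, map_smul, embedOp_ketBra]
    refine Eq.trans ?_ (hr K).symm
    refine Finset.sum_congr rfl fun a _ => Finset.sum_congr rfl fun b _ => ?_
    exact congrArg₂ (· • ·) (congrArg₂ (· * ·) (congrArg (K a) (h x))
      (congrArg (fun c => star (K b c)) (h x')))
      (congrArg₂ ketBra (extend_trans _ _ _ _ _) (extend_trans _ _ _ _ _))
  exact LinearMap.congr_fun this ρ

/-- Apply a list of gates. -/
noncomputable def applyGates {w : ℕ} (gs : List (QGate w)) : QOp w →ₗ[ℂ] QOp w :=
  gs.foldl (fun φ g => g.applyL.comp φ) LinearMap.id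

theorem applyGates_eq {w : ℕ} (gs : List (QGate w)) (ρ : QOp w) :
    applyGates gs ρ = gs.foldl (fun ρ g => g.apply ρ) ρ := by
  have : ∀ φ : QOp w →ₗ[ℂ] QOp w, gs.foldl (fun φ g => g.applyL.comp φ) φ ρ =
      gs.foldl (fun ρ g => g.apply ρ) (φ ρ) := by
    induction gs with
    | nil => intro φ; rfl
    | cons g gs ih => intro φ; exact ih _
  exact this _

theorem applyGates_cons {w : ℕ} (g : QGate w) (gs : List (QGate w)) (ρ : QOp w) :
    applyGates (g :: gs) ρ = applyGates gs (g.apply ρ) := by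
  simp only [applyGates_eq, List.foldl_cons]

theorem applyGates_append {w : ℕ} (gs hs : List (QGate w)) (ρ : QOp w) :
    applyGates (gs ++ hs) ρ = applyGates hs (applyGates gs ρ) := by
  simp only [applyGates_eq, List.foldl_append]

theorem applyGates_embed {l w : ℕ} (ι : Fin l ↪ Fin w) (c : Fin w → Bool) (gs : List (QGate l))
    (ρ : QOp l) : applyGates (gs.map (QGate.embed ι)) (embedOp ι c ρ) =
      embedOp ι c (applyGates gs ρ) := by
  induction gs generalizing ρ with
  | nil => rfl
  | cons g gs ih => rw [List.map_cons, applyGates_cons, QGate.embed_apply, ih, applyGates_cons]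

/-! ### Traces -/

theorem sum_fin_one {M : Type} [AddCommMonoid M] (F : (Fin 1 → Bool) → M) :
    ∑ a, F a = F (fun _ => true) + F fun _ => false := by
  rw [← (Equiv.funUnique (Fin 1) Bool).symm.sum_comp, Fintype.sum_bool]
  rfl

/-- The gate permutes the basis states. -/
def QGateName.IsPerm (g : QGateName) (π : (Fin g.arity → Bool) → Fin g.arity → Bool) : Prop :=
  Function.Injective π ∧ ∃ K, g.kraus = [K] ∧ ∀ a c, K a c = if a = π c then 1 else 0

theorem isPerm_X : QGateName.IsPerm .X fun c _ => !c 0 := by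
  refine ⟨fun c c' h => ?_, _, rfl, fun a c => ?_⟩
  · funext i
    rw [Subsingleton.elim i 0]
    simpa using congrFun h 0
  · rw [Matrix.of_apply]
    simp only [funext_iff, Fin.forall_fin_one]

theorem isPerm_cnot : QGateName.IsPerm .cnot fun c => ![c 0, xor (c 1) (c 0)] := by
  refine ⟨fun c c' h => ?_, _, rfl, fun a c => ?_⟩
  · have h₀ : c 0 = c' 0 := congrFun h 0
    have h₁ : xor (c 1) (c 0) = xor (c' 1) (c' 0) := congrFun h 1
    rw [h₀, Bool.xor_left_inj] at h₁
    exact funext (Fin.forall_fin_two.2 ⟨h₀, h₁⟩)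
  · rw [Matrix.of_apply]
    simp only [funext_iff, Fin.forall_fin_two]
    rfl

theorem isPerm_toffoli :
    QGateName.IsPerm .toffoli fun c => ![c 0, c 1, xor (c 2) (c 0 && c 1)] := by
  refine ⟨fun c c' h => ?_, _, rfl, fun a c => ?_⟩
  · have h₀ : c 0 = c' 0 := congrFun h 0
    have h₁ : c 1 = c' 1 := congrFun h 1
    have h₂ : xor (c 2) (c 0 && c 1) = xor (c' 2) (c' 0 && c' 1) := congrFun h 2
    rw [h₀, h₁, Bool.xor_left_inj] at h₂
    funext i
    fin_cases i
    exacts [h₀, h₁, h₂]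
  · rw [Matrix.of_apply]
    have : (a = ![c 0, c 1, xor (c 2) (c 0 && c 1)]) ↔
        a 0 = c 0 ∧ a 1 = c 1 ∧ a 2 = xor (c 2) (c 0 && c 1) := by
      constructor
      · rintro rfl
        exact ⟨rfl, rfl, rfl⟩
      · rintro ⟨h₀, h₁, h₂⟩
        funext i
        fin_cases i
        exacts [h₀, h₁, h₂]
    simp only [this]

theorem QGateName.IsPerm.complete {g : QGateName} {π : (Fin g.arity → Bool) → Fin g.arity → Bool}
    (h : g.IsPerm π) (c c' : Fin g.arity → Bool) :
    (g.kraus.map fun K => ∑ a, K a c * star (K a c')).sum = if c = c' then 1 else 0 := by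
  obtain ⟨hπ, K, hK, h⟩ := h
  rw [hK, List.map_singleton, List.sum_singleton]
  simp only [h]
  rw [Finset.sum_eq_single (π c)]
  · by_cases hc : c = c'
    · simp [hc]
    · rw [if_pos rfl, if_neg fun h => hc (hπ h), if_neg hc]; simp
  · intro a _ ha; simp [ha]
  · simp

/-- The entries of the relation `∑ Kᴴ K = 1`, which makes gates trace preserving. It is needed so
that the two values of an output bit have total probability `1`. -/
theorem kraus_complete (g : QGateName) (c c' : Fin g.arity → Bool) :
    (g.kraus.map fun K => ∑ a, K a c * star (K a c')).sum = if c = c' then 1 else 0 := by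
  have hone : ∀ c c' : Fin 1 → Bool, c = c' ↔ c 0 = c' 0 := fun c c' => by
    simp only [funext_iff, Fin.forall_fin_one]
  have hsqrt : ((Real.sqrt 2 : ℝ) : ℂ) * ((Real.sqrt 2 : ℝ) : ℂ) = 2 := by
    rw [← Complex.ofReal_mul, Real.mul_self_sqrt (by norm_num)]; norm_num
  have hs0 : ((Real.sqrt 2 : ℝ) : ℂ) ≠ 0 := fun h => by simp [h] at hsqrt
  have hexp : Complex.exp (Complex.I * (Real.pi / 4 : ℝ)) *
      star (Complex.exp (Complex.I * (Real.pi / 4 : ℝ))) = 1 := by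
    change _ * (starRingEnd ℂ) _ = 1
    rw [Complex.mul_conj, Complex.normSq_eq_norm_sq, mul_comm, Complex.norm_exp_ofReal_mul_I]
    norm_num
  rcases g with _ | _ | _ | _ | _ | _
  · exact isPerm_X.complete c c'
  · simp only [QGateName.kraus, List.map_cons, List.map_nil, List.sum_singleton]
    rw [sum_fin_one]
    simp only [Matrix.of_apply, hone c c']
    rcases h : c 0 <;> rcases h' : c' 0 <;> simp <;> field_simp <;> simp [pow_two, hsqrt] <;> norm_num
  · simp only [QGateName.kraus, List.map_cons, List.map_nil, List.sum_singleton]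
    rw [sum_fin_one]
    simp only [Matrix.of_apply, hone c c']
    rcases h : c 0 <;> rcases h' : c' 0
    exacts [by simp, by simp, by simp, by simpa using hexp]
  · exact isPerm_cnot.complete c c'
  · exact isPerm_toffoli.complete c c'
  · simp only [QGateName.kraus, List.map_cons, List.map_nil, List.sum_cons, List.sum_nil, add_zero]
    rw [sum_fin_one, sum_fin_one]
    simp only [Matrix.of_apply, hone c c']
    rcases h : c 0 <;> rcases h' : c' 0 <;> simp

theorem QGate.trace_apply {w : ℕ} (g : QGate w) (ρ : QOp w) : (g.apply ρ).trace = ρ.trace := by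
  have : (Matrix.traceLinearMap (Fin w → Bool) ℂ ℂ).comp g.applyL =
      Matrix.traceLinearMap (Fin w → Bool) ℂ ℂ := by
    refine linearMap_ext_ketBra fun z z' => ?_
    have htr : ∀ p q : Fin w → Bool, (ketBra p q).trace = if p = q then (1 : ℂ) else 0 := by
      intro p q
      by_cases h : p = q
      · subst h; simp [ketBra]
      · rw [if_neg h]; exact Matrix.trace_single_eq_of_ne _ _ _ h
    rw [LinearMap.comp_apply, QGate.applyL_apply, QGate.apply_ketBra, map_list_sum, List.map_map,
      Matrix.traceLinearMap_apply, htr]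
    have hext : ∀ a b, (Function.extend g.wires a z = Function.extend g.wires b z') ↔
        (∀ i, i ∉ Set.range g.wires → z i = z' i) ∧ a = b := by
      intro a b
      rw [eq_extend_iff, Function.extend_comp g.wires.injective]
      refine and_congr_left fun _ => forall₂_congr fun i hi => ?_
      rw [Function.extend_apply' _ _ _ fun ⟨j, hj⟩ => hi ⟨j, hj⟩]
    have heq : z = z' ↔ (∀ i, i ∉ Set.range g.wires → z i = z' i) ∧
        z ∘ g.wires = z' ∘ g.wires := by
      rw [← eq_extend_iff, (eq_extend_iff g.wires (z' ∘ g.wires) z' z').2 ⟨fun _ _ => rfl, rfl⟩ |>.symm]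
    by_cases hag : ∀ i, i ∉ Set.range g.wires → z i = z' i
    · have := kraus_complete g.name (z ∘ g.wires) (z' ∘ g.wires)
      rw [show (if z = z' then (1 : ℂ) else 0) = _ from (if_congr (heq.trans (and_iff_right hag)) rfl rfl),
        ← this]
      congr 1
      refine List.map_congr_left fun K _ => ?_
      simp only [Function.comp_apply, Matrix.traceLinearMap_apply, Matrix.trace_sum,
        Matrix.trace_smul, htr, hext, and_iff_right hag, smul_eq_mul, mul_ite, mul_one, mul_zero,
        Finset.sum_ite_eq, Finset.mem_univ, if_true]
    · rw [if_neg fun h => hag (heq.1 h).1]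
      refine List.sum_eq_zero fun t ht => ?_
      obtain ⟨K, -, rfl⟩ := List.mem_map.1 ht
      have hno : ∀ a b : Fin g.name.arity → Bool,
          ¬((∀ i, i ∉ Set.range g.wires → z i = z' i) ∧ a = b) := fun a b h => hag h.1
      simp only [Function.comp_apply, Matrix.traceLinearMap_apply, Matrix.trace_sum,
        Matrix.trace_smul, htr, hext, hno, if_false, smul_zero, Finset.sum_const_zero]
  exact LinearMap.congr_fun this ρ

theorem trace_applyGates {w : ℕ} (gs : List (QGate w)) (ρ : QOp w) :
    (applyGates gs ρ).trace = ρ.trace := by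
  induction gs generalizing ρ with
  | nil => rfl
  | cons g gs ih => rw [applyGates_cons, ih, QGate.trace_apply]

/-! ## Circuits on named wires -/

/-- The gate with the given name and wire numbers, if it exists. -/
def QGate.ofRaw (w : ℕ) (g : RawGate) : Option (QGate w) :=
  if h : g.2.length = g.1.arity ∧ g.2.Nodup ∧ ∀ i ∈ g.2, i < w then
    some ⟨g.1, ⟨fun j => ⟨g.2.get (Fin.cast h.1.symm j), h.2.2 _ (List.get_mem _ _)⟩, fun _ _ hj =>
      Fin.cast_injective _ ((List.nodup_iff_injective_get.1 h.2.1) (congrArg Fin.val hj))⟩⟩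
  else none

theorem QGate.raw_of_ofRaw {w : ℕ} {g : RawGate} {q : QGate w} (h : QGate.ofRaw w g = some q) :
    q.raw = g := by
  rw [QGate.ofRaw] at h
  split_ifs at h with h'
  obtain rfl := Option.some.inj h
  refine Prod.ext rfl ?_
  refine List.ext_getElem ?_ fun i _ _ => ?_
  · simpa [QGate.raw] using h'.1.symm
  · simp [QGate.raw]

theorem QGate.ofRaw_raw {w : ℕ} (q : QGate w) : QGate.ofRaw w q.raw = some q := by
  have h : q.raw.2.length = q.raw.1.arity ∧ q.raw.2.Nodup ∧ ∀ i ∈ q.raw.2, i < w := by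
    refine ⟨by simp [QGate.raw], ?_, ?_⟩
    · exact List.nodup_ofFn.2 fun i j hij => q.wires.injective (Fin.ext hij)
    · intro i hi
      obtain ⟨j, rfl⟩ := (List.mem_ofFn' _ _).1 hi
      exact (q.wires j).2
  rw [QGate.ofRaw, dif_pos h]
  congr 1
  rcases q with ⟨name, v⟩
  simp only [QGate.raw]
  congr 1
  ext j
  simp only [Function.Embedding.coeFn_mk, List.get_ofFn]
  rfl

/-- The wires of a register under names. The names that satisfy `ok` are in use. -/
structure Layout (Q : Type) (w : ℕ) where
  loc : Q → ℕ
  ok : Q → Prop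
  lt : ∀ q, ok q → loc q < w
  inj : ∀ q q', ok q → ok q' → loc q = loc q' → q = q'

/-- A gate on named wires. -/
abbrev NamedGate (Q : Type) : Type := QGateName × List Q

namespace Layout

variable {Q : Type} {w : ℕ} (L : Layout Q w)

/-- The wire with the given name. -/
def wire (q : {q // L.ok q}) : Fin w := ⟨L.loc q, L.lt _ q.2⟩

theorem wire_injective : Function.Injective L.wire := fun q q' h =>
  Subtype.ext (L.inj _ _ q.2 q'.2 (congrArg Fin.val h))

/-- The basis state in which the named wires have the given values and all others are `0`. -/
noncomputable def ket (z : Q → Bool) : Fin w → Bool :=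
  Function.extend L.wire (fun q => z q) fun _ => false

theorem ket_wire (z : Q → Bool) (q : {q // L.ok q}) : L.ket z (L.wire q) = z q :=
  L.wire_injective.extend_apply _ _ _

theorem ket_of_notMem (z : Q → Bool) {i : Fin w} (h : i ∉ Set.range L.wire) : L.ket z i = false :=
  Function.extend_apply' _ _ _ fun ⟨j, hj⟩ => h ⟨j, hj⟩

/-- The operator `|z⟩⟨z'|` for values of the named wires. -/
noncomputable def op (z z' : Q → Bool) : QOp w := ketBra (L.ket z) (L.ket z')

/-- The gate acts on distinct wires in use. -/
structure Good (g : NamedGate Q) : Prop where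
  length : g.2.length = g.1.arity
  nodup : g.2.Nodup
  ok : ∀ q ∈ g.2, L.ok q

theorem Good.lt {L : Layout Q w} {g : NamedGate Q} (h : L.Good g) (j : Fin g.1.arity) :
    (j : ℕ) < g.2.length := by rw [h.length]; exact j.2

/-- The wire numbers of a gate. -/
def raw (g : NamedGate Q) : RawGate := (g.1, g.2.map L.loc)

theorem Good.exists_gate {L : Layout Q w} {g : NamedGate Q} (h : L.Good g) :
    ∃ v : Fin g.1.arity ↪ Fin w, QGate.ofRaw w (L.raw g) = some ⟨g.1, v⟩ ∧
      ∀ j : Fin g.1.arity, ∃ hj, v j = L.wire ⟨g.2[(j : ℕ)]'(h.lt j), hj⟩ := by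
  have h' : (L.raw g).2.length = (L.raw g).1.arity ∧ (L.raw g).2.Nodup ∧
      ∀ i ∈ (L.raw g).2, i < w := by
    refine ⟨by simpa [raw] using h.length, ?_, ?_⟩
    · refine (List.nodup_map_iff_inj_on h.nodup).2 fun q hq q' hq' e => ?_
      exact L.inj q q' (h.ok q hq) (h.ok q' hq') e
    · intro i hi
      obtain ⟨q, hq, rfl⟩ := List.mem_map.1 hi
      exact L.lt _ (h.ok q hq)
  rw [QGate.ofRaw, dif_pos h']
  refine ⟨_, rfl, fun j => ⟨h.ok _ (List.getElem_mem _), ?_⟩⟩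
  ext
  simp only [raw, wire, Function.Embedding.coeFn_mk, List.get_eq_getElem, List.getElem_map]
  rfl

/-- Apply a list of gates with numbered wires, ignoring those that do not exist. -/
noncomputable def runRaw (w : ℕ) (gs : List RawGate) : QOp w →ₗ[ℂ] QOp w :=
  applyGates (gs.filterMap (QGate.ofRaw w))

theorem runRaw_append (gs hs : List RawGate) (ρ : QOp w) :
    runRaw w (gs ++ hs) ρ = runRaw w hs (runRaw w gs ρ) := by
  rw [runRaw, List.filterMap_append, applyGates_append]; rfl

theorem runRaw_map_raw (gs : List (QGate w)) : runRaw w (gs.map QGate.raw) = applyGates gs := by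
  rw [runRaw, List.filterMap_map]
  congr 1
  have : QGate.ofRaw w ∘ QGate.raw = some := funext QGate.ofRaw_raw
  rw [this, List.filterMap_some]

/-- Apply a list of gates on named wires. -/
noncomputable def run (gs : List (NamedGate Q)) : QOp w →ₗ[ℂ] QOp w := runRaw w (gs.map L.raw)

theorem run_append (gs hs : List (NamedGate Q)) (ρ : QOp w) :
    L.run (gs ++ hs) ρ = L.run hs (L.run gs ρ) := by
  rw [run, List.map_append, runRaw_append]; rfl

theorem run_nil (ρ : QOp w) : L.run [] ρ = ρ := rfl

theorem run_cons {g : NamedGate Q} {v : Fin g.1.arity ↪ Fin w}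
    (h : QGate.ofRaw w (L.raw g) = some ⟨g.1, v⟩) (gs : List (NamedGate Q)) (ρ : QOp w) :
    L.run (g :: gs) ρ = L.run gs (QGate.apply ⟨g.1, v⟩ ρ) := by
  rw [run, List.map_cons, runRaw, List.filterMap_cons_some h, applyGates_cons]; rfl

variable {L} {g : NamedGate Q}

theorem extend_ket (h : L.Good g) {v : Fin g.1.arity ↪ Fin w}
    (hv : ∀ j : Fin g.1.arity, ∃ hj, v j = L.wire ⟨g.2[(j : ℕ)]'(h.lt j), hj⟩)
    {z z₁ : Q → Bool} {a : Fin g.1.arity → Bool} (h₁ : ∀ q, q ∉ g.2 → z₁ q = z q)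
    (h₂ : ∀ j : Fin g.1.arity, z₁ (g.2[(j : ℕ)]'(h.lt j)) = a j) :
    Function.extend v a (L.ket z) = L.ket z₁ := by
  refine ((eq_extend_iff _ _ _ _).2 ⟨fun i hi => ?_, ?_⟩).symm
  · by_cases hi' : i ∈ Set.range L.wire
    · obtain ⟨q, rfl⟩ := hi'
      rw [ket_wire, ket_wire, h₁]
      intro hq
      obtain ⟨j, hj, hjq⟩ := List.getElem_of_mem hq
      refine hi ⟨⟨j, h.length ▸ hj⟩, ?_⟩
      obtain ⟨_, e⟩ := hv ⟨j, h.length ▸ hj⟩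
      rw [e]
      exact congrArg L.wire (Subtype.ext hjq)
    · rw [ket_of_notMem _ _ hi', ket_of_notMem _ _ hi']
  · funext j
    obtain ⟨_, e⟩ := hv j
    rw [Function.comp_apply, e, ket_wire]
    exact h₂ j

theorem ket_comp (h : L.Good g) {v : Fin g.1.arity ↪ Fin w}
    (hv : ∀ j : Fin g.1.arity, ∃ hj, v j = L.wire ⟨g.2[(j : ℕ)]'(h.lt j), hj⟩) (z : Q → Bool) :
    L.ket z ∘ v = fun j : Fin g.1.arity => z (g.2[(j : ℕ)]'(h.lt j)) := by
  funext j
  obtain ⟨_, e⟩ := hv j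
  rw [Function.comp_apply, e, ket_wire]

theorem _root_.QuantumPRG.QGateName.IsPerm.apply_ketBra {name : QGateName} {π}
    (h : name.IsPerm π) (v : Fin name.arity ↪ Fin w) (z z' : Fin w → Bool) :
    QGate.apply ⟨name, v⟩ (ketBra z z') =
      ketBra (Function.extend v (π (z ∘ v)) z) (Function.extend v (π (z' ∘ v)) z') := by
  obtain ⟨-, K, hK, h⟩ := h
  rw [QGate.apply_ketBra]
  dsimp only
  rw [hK, List.map_singleton, List.sum_singleton, Finset.sum_eq_single (π (z ∘ v)),
    Finset.sum_eq_single (π (z' ∘ v))]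
  · simp [h]
  · intro b _ hb; simp [h, hb]
  · simp
  · intro a _ ha
    exact Finset.sum_eq_zero fun b _ => by simp [h, ha]
  · simp

theorem good_one {name : QGateName} {a : Q} (hn : name.arity = 1) (ha : L.ok a) :
    L.Good (name, [a]) := ⟨hn.symm, List.nodup_singleton _, by simpa using ha⟩

theorem good_two {name : QGateName} {a b : Q} (hn : name.arity = 2) (ha : L.ok a) (hb : L.ok b)
    (hab : a ≠ b) : L.Good (name, [a, b]) := ⟨hn.symm, by simpa using hab, by simp [ha, hb]⟩

theorem good_three {name : QGateName} {a b c : Q} (hn : name.arity = 3) (ha : L.ok a)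
    (hb : L.ok b) (hc : L.ok c) (hab : a ≠ b) (hac : a ≠ c) (hbc : b ≠ c) :
    L.Good (name, [a, b, c]) := ⟨hn.symm, by simp [hab, hac, hbc], by simp [ha, hb, hc]⟩

variable [DecidableEq Q]

/-- The action of the classical gates on the values of the wires. -/
def act : NamedGate Q → (Q → Bool) → Q → Bool
  | (.X, [a]), z => Function.update z a (!z a)
  | (.cnot, [a, b]), z => Function.update z b (xor (z b) (z a))
  | (.toffoli, [a, b, c]), z => Function.update z c (xor (z c) (z a && z b))
  | _, z => z

/-- The gate is one of the classical gates. -/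
def IsClassical (g : NamedGate Q) : Prop := g.1 = .X ∨ g.1 = .cnot ∨ g.1 = .toffoli

/-- Such a gate has a single Kraus operator, which permutes the basis states. It therefore acts on
ket and bra separately, without phases or sums, and it suffices to follow an assignment of bits. -/
theorem run_cons_classical (h : L.Good g) (hc : IsClassical g) (gs : List (NamedGate Q))
    (z z' : Q → Bool) : L.run (g :: gs) (L.op z z') = L.run gs (L.op (act g z) (act g z')) := by
  obtain ⟨v, hv, hvw⟩ := h.exists_gate
  rw [L.run_cons hv]
  congr 1
  rw [op, op]
  rcases g with ⟨name, l⟩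
  rcases hc with rfl | rfl | rfl
  · obtain ⟨a, rfl⟩ := List.length_eq_one_iff.1 h.length
    rw [isPerm_X.apply_ketBra]
    congr 1
    all_goals
    · refine extend_ket h hvw (fun q hq => ?_) fun j => ?_
      · rw [act, Function.update_of_ne (by simpa using hq)]
      · rw [ket_comp h hvw]
        have : j = 0 := Subsingleton.elim _ _
        subst this
        simp [act]
  · obtain ⟨a, b, rfl⟩ := List.length_eq_two.1 h.length
    have hab : a ≠ b := by simpa using h.nodup
    rw [isPerm_cnot.apply_ketBra]
    congr 1
    all_goals
    · refine extend_ket h hvw (fun q hq => ?_) fun j => ?_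
      · rw [act, Function.update_of_ne]
        rintro rfl; simp at hq
      · rw [ket_comp h hvw]
        fin_cases j <;> simp [act, hab]
  · obtain ⟨a, b, c, rfl⟩ := List.length_eq_three.1 h.length
    have hab : (a ≠ b ∧ a ≠ c) ∧ b ≠ c := by simpa using h.nodup
    rw [isPerm_toffoli.apply_ketBra]
    congr 1
    all_goals
    · refine extend_ket h hvw (fun q hq => ?_) fun j => ?_
      · rw [act, Function.update_of_ne]
        rintro rfl; simp at hq
      · rw [ket_comp h hvw]
        fin_cases j <;> simp [act, hab]

theorem run_classical {gs : List (NamedGate Q)} (h : ∀ g ∈ gs, L.Good g ∧ IsClassical g)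
    (z z' : Q → Bool) : L.run gs (L.op z z') =
      L.op (gs.foldl (fun z g => act g z) z) (gs.foldl (fun z g => act g z) z') := by
  induction gs generalizing z z' with
  | nil => rfl
  | cons g gs ih =>
    rw [run_cons_classical (h g (by simp)).1 (h g (by simp)).2, ih fun g hg => h g (by simp [hg])]
    rfl

/-- Discarding a qubit is a partial trace: a term whose ket and bra disagree on that wire vanishes.
-/
theorem run_reset {a : Q} (ha : L.ok a) (gs : List (NamedGate Q)) (z z' : Q → Bool) :
    L.run ((.reset, [a]) :: gs) (L.op z z') = if z a = z' a then
      L.run gs (L.op (Function.update z a false) (Function.update z' a false)) else 0 := by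
  have h : L.Good (.reset, [a]) := good_one rfl ha
  obtain ⟨v, hv, hvw⟩ := h.exists_gate
  have hx : ∀ (z : Q → Bool) (b : Bool), Function.extend v (fun _ => b) (L.ket z) =
      L.ket (Function.update z a b) := by
    intro z b
    refine extend_ket h hvw (fun q hq => ?_) fun j => ?_
    · rw [Function.update_of_ne (by simpa using hq)]
    · have : j = 0 := Subsingleton.elim _ _
      subst this
      simp
  have hk : ∀ z : Q → Bool, L.ket z ∘ v = fun _ => z a := by
    intro z
    rw [ket_comp h hvw]
    funext j
    have : j = 0 := Subsingleton.elim _ _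
    subst this
    simp
  rw [L.run_cons hv, ← map_zero (L.run gs), ← apply_ite (L.run gs)]
  congr 1
  rw [op, QGate.apply_ketBra]
  simp only [QGateName.kraus, List.map_cons, List.map_nil, List.sum_cons, List.sum_nil, add_zero]
  simp only [sum_fin_one, hx, hk, Matrix.of_apply, op]
  rcases z a <;> rcases z' a <;> simp

theorem run_H {a : Q} (ha : L.ok a) (gs : List (NamedGate Q)) {z z' : Q → Bool}
    (hz : z a = false) (hz' : z' a = false) :
    L.run ((.H, [a]) :: gs) (L.op z z') = (1 / 2 : ℂ) • L.run gs (
      L.op (Function.update z a true) (Function.update z' a true) +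
      L.op (Function.update z a true) (Function.update z' a false) +
      L.op (Function.update z a false) (Function.update z' a true) +
      L.op (Function.update z a false) (Function.update z' a false)) := by
  have h : L.Good (.H, [a]) := good_one rfl ha
  obtain ⟨v, hv, hvw⟩ := h.exists_gate
  have hx : ∀ (z : Q → Bool) (b : Bool), Function.extend v (fun _ => b) (L.ket z) =
      L.ket (Function.update z a b) := by
    intro z b
    refine extend_ket h hvw (fun q hq => ?_) fun j => ?_
    · rw [Function.update_of_ne (by simpa using hq)]
    · have : j = 0 := Subsingleton.elim _ _
      subst this
      simp
  have hk : ∀ z : Q → Bool, L.ket z ∘ v = fun _ => z a := by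
    intro z
    rw [ket_comp h hvw]
    funext j
    have : j = 0 := Subsingleton.elim _ _
    subst this
    simp
  have hsqrt : ((Real.sqrt 2 : ℝ) : ℂ) * ((Real.sqrt 2 : ℝ) : ℂ) = 2 := by
    rw [← Complex.ofReal_mul, Real.mul_self_sqrt (by norm_num)]; norm_num
  have hs : (((Real.sqrt 2 : ℝ) : ℂ))⁻¹ * (((Real.sqrt 2 : ℝ) : ℂ))⁻¹ = 1 / 2 := by
    rw [← mul_inv, hsqrt]; norm_num
  rw [L.run_cons hv, ← map_smul]
  congr 1
  rw [op, QGate.apply_ketBra]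
  simp only [QGateName.kraus, List.map_cons, List.map_nil, List.sum_singleton]
  simp only [sum_fin_one, hx, hk, Matrix.of_apply, op, hz, hz']
  simp [hs, smul_add]
  abel

/-- The gates that replace the wire `a` in the state `0` by a uniformly random bit. -/
def coin (a anc : Q) : List (NamedGate Q) := [(.H, [a]), (.cnot, [a, anc]), (.reset, [anc])]

/-- The Hadamard gate creates a superposition, the `cnot` copies it to `anc`, and the reset of `anc`
removes the two cross terms. A fair mixture remains, and `anc` is `0` again and can be reused. -/
theorem run_coin {a anc : Q} (ha : L.ok a) (hanc : L.ok anc) (hne : a ≠ anc) {z : Q → Bool}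
    (hz : z a = false) (hz' : z anc = false) :
    L.run (coin a anc) (L.op z z) = (1 / 2 : ℂ) •
      (L.op (Function.update z a true) (Function.update z a true) + L.op z z) := by
  rw [coin, run_H ha _ hz hz]
  have hg : L.Good (.cnot, [a, anc]) := good_two rfl ha hanc hne
  have hc : IsClassical ((.cnot, [a, anc]) : NamedGate Q) := Or.inr (Or.inl rfl)
  have hu : Function.update z anc false = z := by
    rw [← hz', Function.update_eq_self]
  have hu' : Function.update (Function.update z a true) anc false = Function.update z a true := by
    rw [Function.update_eq_self_iff, Function.update_of_ne hne.symm, hz']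
  have hu'' : Function.update z a false = z := by rw [← hz, Function.update_eq_self]
  simp only [map_add, run_cons_classical hg hc, run_reset hanc, run_nil, act, Function.update_self,
    Function.update_of_ne hne.symm, hz', Function.update_idem, hu', hu'']
  simp [hz, hu]

end Layout

/-! ## The predictor built from a distinguisher -/

/-- The wires of the predictor: the input and the simulated circuit of the generator, two auxiliary
wires, the guessed bit, random bits, a random number in one-hot form, and the register of the
distinguisher. -/
inductive Wire : Type
  | inp (i : ℕ) : Wire
  | anc : Wire
  | tmp : Wire
  | guess : Wire
  | rand (j : ℕ) : Wire
  | hot (m : ℕ) : Wire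
  | dist (p : ℕ) : Wire

noncomputable instance : DecidableEq Wire := Classical.decEq _

/-- The placement of the wires of the predictor: `a` wires for the input and the generator, `t` for
random bits and `m` for the distinguisher. -/
def wireLoc (a t : ℕ) : Wire → ℕ
  | .inp i => i
  | .anc => a
  | .tmp => a + 1
  | .guess => a + 2
  | .rand j => a + 3 + j
  | .hot k => a + 3 + t + k
  | .dist p => a + 3 + t + (2 * t + 1) + p

def WireOk (a t m : ℕ) : Wire → Prop
  | .inp i => i < a
  | .rand j => j < t
  | .hot k => k < 2 * t + 1
  | .dist p => p < m
  | _ => True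

/-- The number of wires of the predictor. -/
def predWidth (a t m : ℕ) : ℕ := a + 3 + t + (2 * t + 1) + m

/-- The register of the predictor. -/
def predLayout (a t m : ℕ) : Layout Wire (predWidth a t m) where
  loc := wireLoc a t
  ok := WireOk a t m
  lt q h := by cases q <;> simp only [wireLoc, WireOk, predWidth] at h ⊢ <;> omega
  inj q q' h h' e := by
    cases q <;> cases q' <;> simp only [wireLoc, WireOk] at h h' e <;>
      first | rfl | exact congrArg _ (by omega) | omega

/-- Values of the wires of the predictor. -/
def wireState (l : List Bool) (c g : Bool) (r h d : ℕ → Bool) : Wire → Bool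
  | .inp i => l.getD i false
  | .anc => false
  | .tmp => c
  | .guess => g
  | .rand j => r j
  | .hot k => h k
  | .dist p => d p

/-! ### Changing a single wire of the predictor -/

section WireState

variable (l : List Bool) (c g : Bool) (r h d : ℕ → Bool)

/-- Wires beyond the list read as `0`, so writing to the first of them appends to the list. -/
theorem update_inp (b : Bool) : Function.update (wireState l c g r h d) (.inp l.length) b =
    wireState (l ++ [b]) c g r h d := by
  funext q
  cases q with
  | inp i =>
    rw [Function.update_apply]
    simp only [wireState, Wire.inp.injEq]
    rcases lt_trichotomy i l.length with hi | hi | hi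
    · rw [if_neg hi.ne, List.getD_append _ _ _ _ hi]
    · subst hi; rw [if_pos rfl, List.getD_append_right _ _ _ _ le_rfl]; simp
    · rw [if_neg hi.ne', List.getD_eq_default _ _ hi.le, List.getD_eq_default _ _ (by simp; omega)]
  | _ => rw [Function.update_of_ne (by simp)]; rfl

theorem wireState_append_false : wireState (l ++ [false]) c g r h d = wireState l c g r h d := by
  rw [← update_inp, Function.update_eq_self_iff]
  simp [wireState]

theorem update_tmp (b : Bool) : Function.update (wireState l c g r h d) .tmp b =
    wireState l b g r h d := by
  funext q
  cases q with
  | tmp => rw [Function.update_self]; rfl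
  | _ => rw [Function.update_of_ne (by simp)]; rfl

theorem update_guess (b : Bool) : Function.update (wireState l c g r h d) .guess b =
    wireState l c b r h d := by
  funext q
  cases q with
  | guess => rw [Function.update_self]; rfl
  | _ => rw [Function.update_of_ne (by simp)]; rfl

theorem update_rand (j : ℕ) (b : Bool) : Function.update (wireState l c g r h d) (.rand j) b =
    wireState l c g (Function.update r j b) h d := by
  funext q
  cases q with
  | rand i => rw [Function.update_apply]; simp only [wireState, Wire.rand.injEq, Function.update_apply]
  | _ => rw [Function.update_of_ne (by simp)]; rfl

theorem update_hot (j : ℕ) (b : Bool) : Function.update (wireState l c g r h d) (.hot j) b =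
    wireState l c g r (Function.update h j b) d := by
  funext q
  cases q with
  | hot i => rw [Function.update_apply]; simp only [wireState, Wire.hot.injEq, Function.update_apply]
  | _ => rw [Function.update_of_ne (by simp)]; rfl

theorem update_dist (j : ℕ) (b : Bool) : Function.update (wireState l c g r h d) (.dist j) b =
    wireState l c g r h (Function.update d j b) := by
  funext q
  cases q with
  | dist i => rw [Function.update_apply]; simp only [wireState, Wire.dist.injEq, Function.update_apply]
  | _ => rw [Function.update_of_ne (by simp)]; rfl

end WireState

open Layout

/-! ### The phases of the predictor -/

/-- Simulation of a gate of the generator. -/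
def simGate (n k : ℕ) : BoolGate → List (NamedGate Wire)
  | .zero => []
  | .nand i j =>
    [if i = j then (.cnot, [.inp (n + 1 + i), .inp (2 * n + 1 + k)])
      else (.toffoli, [.inp (n + 1 + i), .inp (n + 1 + j), .inp (2 * n + 1 + k)]),
      (.X, [.inp (2 * n + 1 + k)])]

/-- Simulation of a circuit on the wires after `1ⁿ 0`. -/
def simGates (n : ℕ) (gs : List BoolGate) : List (NamedGate Wire) :=
  (List.range gs.length).flatMap fun k => simGate n k (gs.getD k .zero)

/-- Random bits. -/
def coinGates (t : ℕ) : List (NamedGate Wire) :=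
  (List.range t).flatMap fun j => coin (.rand j) .anc

/-- Choose randomly whether to increase the number in one-hot form by `s`. -/
def doubleGates (s : ℕ) : List (NamedGate Wire) :=
  coin .tmp .anc ++ ((List.range s).flatMap fun i =>
    [(.toffoli, [.hot i, .tmp, .hot (i + s)]), (.cnot, [.hot (i + s), .hot i])]) ++
      [(.reset, [.tmp])]

open Classical in
/-- Choose a random number below the least power of two that is at least `t`. -/
noncomputable def hotGates (t : ℕ) : List (NamedGate Wire) :=
  (.X, [.hot 0]) :: (List.range t).flatMap fun s => if ∃ k, s = 2 ^ k then doubleGates s else []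

/-- The wire that provides the `p`-th input bit of the distinguisher in the `u`-th hybrid. -/
def sourceWire (n t : ℕ) (o : ℕ → ℕ) (u p : ℕ) : Wire :=
  if p < u then .inp (n + 1 + o (t - u + p)) else if p = u then .guess else .rand p

/-- Load the input of the distinguisher. -/
def loadGates (n t : ℕ) (o : ℕ → ℕ) : List (NamedGate Wire) :=
  (List.range t).flatMap fun u => (List.range t).map fun p =>
    (.toffoli, [.hot u, sourceWire n t o u p, .dist p])

section Evolution

variable {a t m n : ℕ}

/-- The part `1ⁿ 0` of the input. -/
def paramPrefix (n : ℕ) : List Bool := List.replicate n true ++ [false]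

theorem length_paramPrefix (n : ℕ) : (paramPrefix n).length = n + 1 := by simp [paramPrefix]

theorem good_simGate {k : ℕ} {x : BoolGate} (hx : x.ReadsBelow (n + k)) (ha : 2 * n + 1 + k < a) :
    ∀ g ∈ simGate n k x, (predLayout a t m).Good g ∧ IsClassical g := by
  have hok : (predLayout a t m).ok (.inp (2 * n + 1 + k)) := ha
  have hoki : ∀ i, i < n + k → (predLayout a t m).ok (.inp (n + 1 + i)) := fun i hi => by
    change n + 1 + i < a; omega
  rcases x with _ | ⟨i, j⟩
  · simp [simGate]
  · obtain ⟨hi, hj⟩ := hx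
    have hdi : n + 1 + i ≠ 2 * n + 1 + k := by omega
    have hdj : n + 1 + j ≠ 2 * n + 1 + k := by omega
    intro g hg
    rcases List.mem_cons.1 hg with rfl | hg
    · split_ifs with hij
      · exact ⟨good_two rfl (hoki i hi) hok (by simpa using hdi), Or.inr (Or.inl rfl)⟩
      · exact ⟨good_three rfl (hoki i hi) (hoki j hj) hok (by simpa using hij)
          (by simpa using hdi) (by simpa using hdj), Or.inr (Or.inr rfl)⟩
    · rw [List.mem_singleton.1 hg]
      exact ⟨good_one rfl hok, Or.inl rfl⟩

theorem good_simGates {gs : List BoolGate} (hgs : LegalFrom n gs)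
    (ha : 2 * n + 1 + gs.length ≤ a) : ∀ g ∈ simGates n gs, (predLayout a t m).Good g := by
  rw [legalFrom_iff] at hgs
  intro g hg
  obtain ⟨k, hk, hg⟩ := List.mem_flatMap.1 hg
  have hk := List.mem_range.1 hk
  rw [List.getD_eq_getElem _ _ hk] at hg
  exact (good_simGate (hgs k hk) (by omega) g hg).1

theorem good_coin {q q' : Wire} (h : (predLayout a t m).ok q) (h' : (predLayout a t m).ok q')
    (hne : q ≠ q') : ∀ g ∈ coin q q', (predLayout a t m).Good g := by
  intro g hg
  simp only [coin, List.mem_cons, List.not_mem_nil, or_false] at hg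
  rcases hg with rfl | rfl | rfl
  exacts [good_one rfl h, good_two rfl h h' hne, good_one rfl h']

theorem good_coinGates : ∀ g ∈ coinGates t, (predLayout a t m).Good g := by
  intro g hg
  obtain ⟨j, hj, hg⟩ := List.mem_flatMap.1 hg
  exact good_coin (q := .rand j) (q' := .anc) (List.mem_range.1 hj) trivial (by simp) g hg

/-- The input `1ⁿ 0 y` shifts wire `i` of the generator to `n + 1 + i`, so its `k`-th gate writes to
`2 * n + 1 + k`, which is still `0`. A `toffoli` followed by `X` computes `nand` there. Quantum
gates need distinct wires, which is why equal arguments are treated by a `cnot`. -/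
theorem run_simGate {k : ℕ} {x : BoolGate} {v : List Bool} (hv : v.length = n + k)
    (hx : x.ReadsBelow (n + k)) (ha : 2 * n + 1 + k < a) (c g : Bool) (r h d : ℕ → Bool) :
    (predLayout a t m).run (simGate n k x) ((predLayout a t m).op
      (wireState (paramPrefix n ++ v) c g r h d) (wireState (paramPrefix n ++ v) c g r h d)) =
      (predLayout a t m).op (wireState (paramPrefix n ++ (v ++ [x.eval v])) c g r h d)
        (wireState (paramPrefix n ++ (v ++ [x.eval v])) c g r h d) := by
  have hlen : (paramPrefix n ++ v).length = 2 * n + 1 + k := by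
    rw [List.length_append, length_paramPrefix, hv]; omega
  have hval : ∀ i, (paramPrefix n ++ v).getD (n + 1 + i) false = v.getD i false := by
    intro i
    rw [List.getD_append_right _ _ _ _ (by rw [length_paramPrefix]; omega), length_paramPrefix]
    congr 1; omega
  rw [← List.append_assoc]
  rcases x with _ | ⟨i, j⟩
  · rw [simGate, run_nil, BoolGate.eval, wireState_append_false]
  · rw [run_classical (good_simGate hx ha)]
    · have hz : wireState (paramPrefix n ++ v) c g r h d (.inp (2 * n + 1 + k)) = false := by
        rw [← hlen]; exact List.getD_eq_default _ _ le_rfl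
      have key : ([if i = j then (.cnot, [.inp (n + 1 + i), .inp (2 * n + 1 + k)])
          else (.toffoli, [.inp (n + 1 + i), .inp (n + 1 + j), .inp (2 * n + 1 + k)]),
          (.X, [.inp (2 * n + 1 + k)])] : List (NamedGate Wire)).foldl (fun z g => act g z)
          (wireState (paramPrefix n ++ v) c g r h d) =
          wireState (paramPrefix n ++ v ++ [(BoolGate.nand i j).eval v]) c g r h d := by
        rw [← update_inp, hlen, BoolGate.eval, ← hval i, ← hval j]
        by_cases hij : i = j
        · subst hij
          rw [if_pos rfl]
          simp only [List.foldl_cons, List.foldl_nil, act, hz, Function.update_self,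
            Function.update_idem, Bool.and_self, Bool.false_xor]
          rfl
        · rw [if_neg hij]
          simp only [List.foldl_cons, List.foldl_nil, act, hz, Function.update_self,
            Function.update_idem, Bool.false_xor]
          rfl
      rw [simGate, key]

theorem run_simGates {gs : List BoolGate} {v : List Bool} (hv : v.length = n)
    (hgs : LegalFrom n gs) (ha : 2 * n + 1 + gs.length ≤ a) (c g : Bool) (r h d : ℕ → Bool) :
    (predLayout a t m).run (simGates n gs) ((predLayout a t m).op
      (wireState (paramPrefix n ++ v) c g r h d) (wireState (paramPrefix n ++ v) c g r h d)) =
      (predLayout a t m).op (wireState (paramPrefix n ++ runGates gs v) c g r h d)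
        (wireState (paramPrefix n ++ runGates gs v) c g r h d) := by
  rw [legalFrom_iff] at hgs
  have key : ∀ k ≤ gs.length, (predLayout a t m).run
      ((List.range k).flatMap fun k => simGate n k (gs.getD k .zero)) ((predLayout a t m).op
      (wireState (paramPrefix n ++ v) c g r h d) (wireState (paramPrefix n ++ v) c g r h d)) =
      (predLayout a t m).op (wireState (paramPrefix n ++ runGates (gs.take k) v) c g r h d)
        (wireState (paramPrefix n ++ runGates (gs.take k) v) c g r h d) := by
    intro k hk
    induction k with
    | zero => rfl
    | succ k ih =>
      rw [List.range_succ, List.flatMap_append, run_append, ih (by omega), List.flatMap_singleton,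
        List.getD_eq_getElem _ _ (by omega : k < gs.length), run_simGate
          (by rw [length_runGates, hv, List.length_take]; omega) (hgs k (by omega)) (by omega)]
      rw [List.take_add_one, List.getElem?_eq_getElem (by omega : k < gs.length), runGates_append]
      rfl
  have := key gs.length le_rfl
  rwa [List.take_length] at this

/-- The infinite sequence that starts with `r` and is `0` afterwards. -/
def padBits {k : ℕ} (r : Fin k → Bool) (j : ℕ) : Bool := if h : j < k then r ⟨j, h⟩ else false

theorem padBits_snoc {k : ℕ} (r : Fin k → Bool) (b : Bool) :
    padBits (Fin.snoc (α := fun _ => Bool) r b) = Function.update (padBits r) k b := by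
  funext j
  rw [Function.update_apply]
  by_cases hj : j < k
  · rw [if_neg hj.ne, padBits, padBits, dif_pos hj, dif_pos (by omega : j < k + 1)]
    simp [Fin.snoc, hj]
  · by_cases hjk : j = k
    · subst hjk
      rw [if_pos rfl, padBits, dif_pos (Nat.lt_succ_self _)]
      simp [Fin.snoc]
    · rw [if_neg hjk, padBits, padBits, dif_neg (by omega), dif_neg hj]

theorem sum_snoc {M : Type} [AddCommMonoid M] {k : ℕ} (F : (Fin (k + 1) → Bool) → M) :
    ∑ r, F r = ∑ r : Fin k → Bool, (F (Fin.snoc (α := fun _ => Bool) r true) +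
      F (Fin.snoc (α := fun _ => Bool) r false)) := by
  rw [← (Fin.snocEquiv fun _ => Bool).sum_comp, Fintype.sum_prod_type, Fintype.sum_bool,
    ← Finset.sum_add_distrib]
  rfl

theorem run_coinGates {k : ℕ} (hk : k ≤ t) (l : List Bool) (g : Bool) (h d : ℕ → Bool) :
    (predLayout a t m).run (coinGates k) ((predLayout a t m).op
      (wireState l false g (fun _ => false) h d) (wireState l false g (fun _ => false) h d)) =
      (1 / 2 : ℂ) ^ k • ∑ r : Fin k → Bool, (predLayout a t m).op
        (wireState l false g (padBits r) h d) (wireState l false g (padBits r) h d) := by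
  induction k with
  | zero =>
    have : ∀ r : Fin 0 → Bool, padBits r = fun _ => false := by
      intro r; funext j; rw [padBits, dif_neg (by omega)]
    rw [Fintype.sum_unique, this, pow_zero, one_smul]
    rfl
  | succ k ih =>
    rw [coinGates, List.range_succ, List.flatMap_append, run_append]
    change (predLayout a t m).run _ ((predLayout a t m).run (coinGates k) _) = _
    rw [ih (by omega), sum_snoc, map_smul, map_sum, pow_succ, mul_smul, Finset.smul_sum (r := (1 / 2 : ℂ))]
    congr 1
    refine Finset.sum_congr rfl fun r _ => ?_
    rw [List.flatMap_singleton, run_coin (by change k < t; omega) trivial (by simp)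
      (by simp [wireState, padBits]) rfl, update_rand, padBits_snoc, padBits_snoc]
    have hf : Function.update (padBits r) k false = padBits r := by
      rw [Function.update_eq_self_iff]; simp [padBits]
    rw [hf]

theorem run_guess (l : List Bool) (r h d : ℕ → Bool) :
    (predLayout a t m).run (coin .guess .anc) ((predLayout a t m).op
      (wireState l false false r h d) (wireState l false false r h d)) =
      (1 / 2 : ℂ) • ∑ g : Bool, (predLayout a t m).op
        (wireState l false g r h d) (wireState l false g r h d) := by
  rw [run_coin trivial trivial (by simp) rfl rfl, update_guess, Fintype.sum_bool]

/-- The sequence with a single `1` at the position `u`. -/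
def oneHot (u j : ℕ) : Bool := j = u

/-- If the `1` is at `k` and the control `tmp` is set, the `toffoli` sets position `k + s` and the
`cnot` then clears `k`. In all other cases nothing happens, provided that position `k + s` is empty.
-/
theorem oneHot_move {s k v : ℕ} (hs : 0 < s) (hv : v ≠ k + s) (c : Bool) (l : List Bool) (g : Bool)
    (r d : ℕ → Bool) : act (.cnot, [.hot (k + s), .hot k]) (act
      (.toffoli, [.hot k, .tmp, .hot (k + s)]) (wireState l c g r (oneHot v) d)) =
      wireState l c g r (oneHot (if c = true ∧ v = k then k + s else v)) d := by
  have h₀ : oneHot v (k + s) = false := by simp [oneHot, hv.symm]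
  have hk : k ≠ k + s := by omega
  simp only [act, update_hot, wireState, h₀, Bool.false_xor, Function.update_self,
    Function.update_of_ne hk]
  congr 1
  split_ifs with h
  · obtain ⟨rfl, rfl⟩ := h
    funext j
    simp only [Function.update_apply, oneHot]
    by_cases h₁ : j = v
    · subst h₁; simp [hs.ne']
    · by_cases h₂ : j = v + s <;> simp [h₁, h₂, hs.ne']
  · have hb : (oneHot v k && c) = false := by
      by_contra h'
      have h' : k = v ∧ c = true := by simpa [oneHot] using h'
      exact h ⟨h'.2, h'.1.symm⟩
    rw [hb, Bool.xor_false, Function.update_eq_self_iff.2, Function.update_eq_self_iff.2]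
    · exact h₀.symm
    · rw [Function.update_of_ne hk]

theorem good_move {s : ℕ} (hs : s ≤ t) : ∀ g ∈ ((List.range s).flatMap fun i =>
      [((.toffoli, [.hot i, .tmp, .hot (i + s)]) : NamedGate Wire),
        (.cnot, [.hot (i + s), .hot i])]), (predLayout a t m).Good g ∧ IsClassical g := by
  intro g hg
  obtain ⟨i, hi, hg⟩ := List.mem_flatMap.1 hg
  have hi := List.mem_range.1 hi
  have h₁ : (predLayout a t m).ok (.hot i) := by change i < 2 * t + 1; omega
  have h₂ : (predLayout a t m).ok (.hot (i + s)) := by change i + s < 2 * t + 1; omega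
  simp only [List.mem_cons, List.not_mem_nil, or_false] at hg
  rcases hg with rfl | rfl
  · exact ⟨good_three rfl h₁ trivial h₂ (by simp) (by simp; omega) (by simp), Or.inr (Or.inr rfl)⟩
  · exact ⟨good_two rfl h₂ h₁ (by simp; omega), Or.inr (Or.inl rfl)⟩

theorem good_doubleGates {s : ℕ} (hs : s ≤ t) : ∀ g ∈ doubleGates s, (predLayout a t m).Good g := by
  intro g hg
  rcases List.mem_append.1 hg with hg | hg
  · rcases List.mem_append.1 hg with hg | hg
    · exact good_coin (q := .tmp) (q' := .anc) trivial trivial (by simp) g hg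
    · exact (good_move hs g hg).1
  · rw [List.mem_singleton.1 hg]
    exact good_one rfl trivial

theorem good_hotGates : ∀ g ∈ hotGates t, (predLayout a t m).Good g := by
  intro g hg
  rcases List.mem_cons.1 hg with rfl | hg
  · exact good_one rfl (by change 0 < 2 * t + 1; omega)
  · obtain ⟨s, hs, hg⟩ := List.mem_flatMap.1 hg
    have hs := List.mem_range.1 hs
    split_ifs at hg
    · exact good_doubleGates hs.le g hg
    · simp at hg

/-- A coin in `tmp` decides whether `s` is added. Only the round `k = u` can move the `1`, and since
`u < s` its target is empty. In each of the two terms `tmp` has the same value in ket and bra, so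
the final reset loses nothing. -/
theorem run_doubleGates {s u : ℕ} (hu : u < s) (hs : s ≤ t) (l : List Bool) (g : Bool)
    (r d : ℕ → Bool) : (predLayout a t m).run (doubleGates s) ((predLayout a t m).op
      (wireState l false g r (oneHot u) d) (wireState l false g r (oneHot u) d)) =
      (1 / 2 : ℂ) • ((predLayout a t m).op (wireState l false g r (oneHot (u + s)) d)
        (wireState l false g r (oneHot (u + s)) d) + (predLayout a t m).op
          (wireState l false g r (oneHot u) d) (wireState l false g r (oneHot u) d)) := by
  have hmove : ∀ (c : Bool), ∀ k ≤ s, ((List.range k).flatMap fun i =>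
      [((.toffoli, [.hot i, .tmp, .hot (i + s)]) : NamedGate Wire),
        (.cnot, [.hot (i + s), .hot i])]).foldl (fun z g => act g z)
        (wireState l c g r (oneHot u) d) = wireState l c g r
          (oneHot (if c = true ∧ u < k then u + s else u)) d := by
    intro c k hk
    induction k with
    | zero => simp
    | succ k ih =>
      rw [List.range_succ, List.flatMap_append, List.foldl_append, ih (by omega),
        List.flatMap_singleton]
      simp only [List.foldl_cons, List.foldl_nil]
      rw [oneHot_move (by omega) (by split_ifs <;> omega)]
      have e : (if c = true ∧ (if c = true ∧ u < k then u + s else u) = k then k + s else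
          if c = true ∧ u < k then u + s else u) = if c = true ∧ u < k + 1 then u + s else u := by
        rcases c with _ | _
        · simp
        · simp only [true_and]
          split_ifs <;> omega
      rw [e]
  rw [doubleGates, run_append, run_append, run_coin trivial trivial (by simp) rfl rfl, update_tmp]
  simp only [map_smul, map_add]
  rw [run_classical (good_move hs), run_classical (good_move hs), hmove true s le_rfl, hmove false s le_rfl,
    run_reset trivial, run_reset trivial, if_pos rfl, if_pos rfl, update_tmp, update_tmp]
  simp [hu, run_nil]

/-- Each `s = 2 ^ i` below `k` turns a uniform number below `2 ^ i` into one below `2 ^ (i + 1)`.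
Scanning all `s` and testing for powers of two keeps the list of gates easy to compute. -/
theorem run_hotGates {k : ℕ} (hk : k ≤ t) (l : List Bool) (g : Bool) (r d : ℕ → Bool) :
    (predLayout a t m).run (hotGates k) ((predLayout a t m).op
      (wireState l false g r (fun _ => false) d) (wireState l false g r (fun _ => false) d)) =
      (1 / 2 ^ Nat.clog 2 k : ℂ) • ∑ u ∈ Finset.range (2 ^ Nat.clog 2 k), (predLayout a t m).op
        (wireState l false g r (oneHot u) d) (wireState l false g r (oneHot u) d) := by
  classical
  induction k with
  | zero =>
    rw [hotGates, List.range_zero, List.flatMap_nil, run_classical]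
    · simp only [List.foldl_cons, List.foldl_nil, act]
      rw [update_hot]
      have : Function.update (fun _ => false) 0 true = oneHot 0 := by
        funext j; rw [Function.update_apply]; simp [oneHot]
      simp [wireState, this]
    · intro g hg
      rw [List.mem_singleton.1 hg]
      exact ⟨good_one rfl (by change 0 < 2 * t + 1; omega), Or.inl rfl⟩
  | succ s ih =>
    have hsplit : hotGates (s + 1) = hotGates s ++
        if ∃ k, s = 2 ^ k then doubleGates s else [] := by
      rw [hotGates, hotGates, List.range_succ, List.flatMap_append, List.flatMap_singleton]
      rfl
    rw [hsplit, run_append, ih (by omega), map_smul, map_sum]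
    split_ifs with hs
    · obtain ⟨i, rfl⟩ := hs
      have h₁ : Nat.clog 2 (2 ^ i) = i := Nat.clog_pow 2 i (by norm_num)
      have h₂ : Nat.clog 2 (2 ^ i + 1) = i + 1 := by
        refine le_antisymm ?_ ?_
        · refine (Nat.clog_le_iff_le_pow (by norm_num)).2 ?_
          have := Nat.one_le_two_pow (n := i)
          rw [pow_succ]; omega
        · exact (Nat.lt_clog_iff_pow_lt (by norm_num)).2 (Nat.lt_succ_self _)
      rw [h₁, h₂, show 2 ^ (i + 1) = 2 ^ i + 2 ^ i by rw [pow_succ, mul_two], Finset.sum_range_add,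
        Finset.sum_congr rfl fun u hu => run_doubleGates (Finset.mem_range.1 hu) (by omega) l g r d,
        ← Finset.smul_sum, smul_smul, Finset.sum_add_distrib, add_comm]
      congr 1
      · rw [pow_succ]; ring
      · congr 1
        exact Finset.sum_congr rfl fun u _ => by rw [add_comm]
    -- If `s` is not a power of two, the least power that is at least `s` is strictly larger than
    -- `s`, so it also serves for `s + 1`.
    · have : Nat.clog 2 (s + 1) = Nat.clog 2 s := by
        refine le_antisymm ?_ (Nat.clog_mono_right 2 (Nat.le_succ s))
        refine (Nat.clog_le_iff_le_pow (by norm_num)).2 ?_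
        have h₁ : s ≤ 2 ^ Nat.clog 2 s := Nat.le_pow_clog (by norm_num) s
        exact Nat.succ_le_of_lt (lt_of_le_of_ne h₁ fun h => hs ⟨_, h⟩)
      rw [this]
      simp only [run_nil]

/-- The input of the distinguisher when the random number is `u`. -/
def loadedBits (n t : ℕ) (o : ℕ → ℕ) (z : Wire → Bool) (u p : ℕ) : Bool :=
  if u < t ∧ p < t then z (sourceWire n t o u p) else false

theorem good_loadGates {o : ℕ → ℕ} (ho : ∀ i < t, n + 1 + o i < a) (hm : t ≤ m) :
    ∀ g ∈ loadGates n t o, (predLayout a t m).Good g ∧ IsClassical g := by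
  have hne : ∀ u p q, sourceWire n t o u p ≠ .dist q ∧ sourceWire n t o u p ≠ .hot q := by
    intro u p q
    rw [sourceWire]
    split_ifs <;> simp
  intro g hg
  obtain ⟨u, hu, hg⟩ := List.mem_flatMap.1 hg
  obtain ⟨p, hp, rfl⟩ := List.mem_map.1 hg
  have hu := List.mem_range.1 hu
  have hp := List.mem_range.1 hp
  refine ⟨good_three rfl (by change u < 2 * t + 1; omega) ?_ (by change p < m; omega)
    (hne u p u).2.symm (by simp) (hne u p p).1, Or.inr (Or.inr rfl)⟩
  rw [sourceWire]
  split_ifs with h₁ h₂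
  · exact ho _ (by omega)
  · trivial
  · exact hp

/-- All rows are present in the circuit, but row `u'` is controlled by `hot u'`, so only the row of
the actual number writes to the empty register. For `u ≥ t` no row does, and the distinguisher
receives zeros. -/
theorem run_loadGates {o : ℕ → ℕ} (ho : ∀ i < t, n + 1 + o i < a) (hm : t ≤ m) (u : ℕ)
    (l : List Bool) (c g : Bool) (r : ℕ → Bool) :
    (predLayout a t m).run (loadGates n t o) ((predLayout a t m).op
      (wireState l c g r (oneHot u) fun _ => false) (wireState l c g r (oneHot u) fun _ => false)) =
      (predLayout a t m).op (wireState l c g r (oneHot u) (loadedBits n t o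
        (wireState l c g r (oneHot u) fun _ => false) u)) (wireState l c g r (oneHot u)
          (loadedBits n t o (wireState l c g r (oneHot u) fun _ => false) u)) := by
  have hsrc : ∀ (u' p : ℕ) (d d' : ℕ → Bool), wireState l c g r (oneHot u) d (sourceWire n t o u' p) =
      wireState l c g r (oneHot u) d' (sourceWire n t o u' p) := by
    intro u' p d d'
    rw [sourceWire]
    split_ifs <;> rfl
  have hrow : ∀ u' (d : ℕ → Bool), ∀ k ≤ t, ((List.range k).map fun p =>
      ((.toffoli, [.hot u', sourceWire n t o u' p, .dist p]) : NamedGate Wire)).foldl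
        (fun z g => act g z) (wireState l c g r (oneHot u) d) = wireState l c g r (oneHot u)
          fun p => if p < k then xor (d p) (oneHot u u' &&
            wireState l c g r (oneHot u) (fun _ => false) (sourceWire n t o u' p)) else d p := by
    intro u' d k hk
    induction k with
    | zero => simp
    | succ k ih =>
      rw [List.range_succ, List.map_append, List.foldl_append, ih (by omega)]
      simp only [List.map_cons, List.map_nil, List.foldl_cons, List.foldl_nil, act]
      rw [update_dist, hsrc u' k _ fun _ => false]
      congr 1
      funext p
      simp only [wireState, Function.update_apply]
      rcases lt_trichotomy p k with h | h | h
      · simp [h.ne, h, show p < k + 1 by omega]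
      · subst h; simp
      · simp [h.ne', show ¬p < k by omega, show ¬p < k + 1 by omega]
  have hall : ∀ k ≤ t, ((List.range k).flatMap fun u' => (List.range t).map fun p =>
      ((.toffoli, [.hot u', sourceWire n t o u' p, .dist p]) : NamedGate Wire)).foldl
        (fun z g => act g z) (wireState l c g r (oneHot u) fun _ => false) =
          wireState l c g r (oneHot u) fun p => if u < k ∧ p < t then
            wireState l c g r (oneHot u) (fun _ => false) (sourceWire n t o u p) else false := by
    intro k hk
    induction k with
    | zero => simp
    | succ k ih =>
      rw [List.range_succ, List.flatMap_append, List.foldl_append, ih (by omega),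
        List.flatMap_singleton, hrow k _ t le_rfl]
      congr 1
      funext p
      by_cases hp : p < t
      · rcases lt_trichotomy u k with h | h | h
        · simp [hp, h, show u < k + 1 by omega, oneHot, h.ne']
        · subst h; simp [hp, oneHot]
        · simp [hp, show ¬u < k by omega, show ¬u < k + 1 by omega, oneHot, h.ne]
      · simp [hp]
  rw [run_classical (good_loadGates ho hm), loadGates, hall t le_rfl]
  rfl

end Evolution

/-! ### Measurement -/

/-- The sum of the diagonal entries of an operator with weights `F`. -/
noncomputable def diagSum {w : ℕ} (F : (Fin w → Bool) → ℂ) : QOp w →ₗ[ℂ] ℂ :=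
  ∑ z, F z • Matrix.entryLinearMap ℂ ℂ z z

theorem diagSum_apply {w : ℕ} (F : (Fin w → Bool) → ℂ) (ρ : QOp w) :
    diagSum F ρ = ∑ z, F z * ρ z z := by
  simp [diagSum, LinearMap.sum_apply]

theorem diagSum_ketBra {w : ℕ} (F : (Fin w → Bool) → ℂ) (z z' : Fin w → Bool) :
    diagSum F (ketBra z z') = if z = z' then F z else 0 := by
  rw [diagSum_apply, Finset.sum_eq_single z]
  · by_cases h : z = z'
    · simp [ketBra, h]
    · simp [ketBra, h, Ne.symm h]
  · intro b _ hb
    simp [ketBra, Ne.symm hb]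
  · simp

theorem QCircuit.finalState_eq (c : QCircuit) (x : List Bool) :
    c.finalState x = applyGates c.gates (ketBra (fun i => x.getD i false) fun i => x.getD i false) := by
  rw [applyGates_eq, QCircuit.finalState]
  congr 1
  ext p q
  simp only [inputState, Matrix.of_apply, ketBra, Matrix.single_apply]
  simp only [eq_comm (a := p), eq_comm (a := q)]

theorem QCircuit.prob_eq (c : QCircuit) (x : List Bool) (E : Set (List Bool)) :
    c.prob x E = (diagSum (fun z => open Classical in if c.outs.map z ∈ E then 1 else 0)
      (c.finalState x)).re := by
  rw [diagSum_apply, Complex.re_sum, QCircuit.prob]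
  refine Finset.sum_congr rfl fun z _ => ?_
  split_ifs <;> simp

/-- The probabilities of the two values of a single output bit sum to `1`. -/
theorem QCircuit.prob_add_prob (c : QCircuit) {o : Fin c.width} (ho : c.outs = [o])
    (x : List Bool) (β : Bool) : c.prob x {[β]} + c.prob x {[!β]} = 1 := by
  classical
  have htr : (c.finalState x).trace = 1 := by
    rw [QCircuit.finalState_eq, trace_applyGates, ketBra, Matrix.trace_single_eq_same]
  have h : ∀ z : Fin c.width → Bool,
      ((if c.outs.map z ∈ ({[β]} : Set (List Bool)) then (c.finalState x z z).re else 0) +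
      if c.outs.map z ∈ ({[!β]} : Set (List Bool)) then (c.finalState x z z).re else 0) =
        (c.finalState x z z).re := by
    intro z
    rw [ho]
    rcases hz : z o <;> rcases β <;> simp [hz]
  rw [QCircuit.prob, QCircuit.prob, ← Finset.sum_add_distrib]
  have h' := congrArg Complex.re htr
  rw [Matrix.trace, Complex.re_sum] at h'
  rw [← Complex.one_re, ← h']
  refine Finset.sum_congr rfl fun z _ => ?_
  rw [Matrix.diag_apply]
  convert h z

/-! ### The circuit of the predictor -/

/-- Compare the output of the distinguisher with the guess. -/
def postGates (fl : Bool) (os : List ℕ) : List (NamedGate Wire) :=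
  os.flatMap fun o => (.cnot, [.guess, .dist o]) :: if fl then [(.X, [.dist o])] else []

/-- The first wire of the distinguisher. -/
def distBase (a t : ℕ) : ℕ := a + 3 + t + (2 * t + 1)

/-- Shift the wires of a gate. -/
def RawGate.shift (s : ℕ) (g : RawGate) : RawGate := (g.1, g.2.map (s + ·))

/-- The number of wires of the input of the predictor and of the simulated generator. -/
def simWidth (n : ℕ) (cG : BoolCircuit) : ℕ := 2 * n + 1 + cG.gates.length

/-- The gates of the predictor before the distinguisher is run. -/
noncomputable def preGates (n t : ℕ) (cG : BoolCircuit) : List (NamedGate Wire) :=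
  simGates n cG.gates ++ (coinGates t ++ (coin .guess .anc ++ (hotGates t ++
    loadGates n t fun i => cG.outs.getD i 0)))

/-- The gates of the predictor. -/
noncomputable def predGates (fl : Bool) (n t : ℕ) (cG : BoolCircuit) (cD : QCircuit) :
    List RawGate :=
  (preGates n t cG).map (predLayout (simWidth n cG) t cD.width).raw ++
    ((cD.gates.map QGate.raw).map (RawGate.shift (distBase (simWidth n cG) t)) ++
      (postGates fl (cD.outs.map Fin.val)).map (predLayout (simWidth n cG) t cD.width).raw)

/-- The register of the distinguisher within that of the predictor. -/
def distWire (a t m : ℕ) : Fin m ↪ Fin (predWidth a t m) where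
  toFun p := ⟨distBase a t + p, by have := p.2; rw [distBase, predWidth]; omega⟩
  inj' p p' h := Fin.ext (by simpa using h)

/-- The circuit of the predictor. -/
noncomputable def predCircuit (fl : Bool) (n t : ℕ) (cG : BoolCircuit) (cD : QCircuit) : QCircuit where
  width := predWidth (simWidth n cG) t cD.width
  gates := (predGates fl n t cG cD).filterMap (QGate.ofRaw _)
  outs := cD.outs.map (distWire (simWidth n cG) t cD.width)
  outs_nodup := cD.outs_nodup.map (distWire _ _ _).injective

theorem distWire_eq {a t m : ℕ} (p : Fin m) :
    distWire a t m p = (predLayout a t m).wire ⟨.dist p, p.2⟩ := rfl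

theorem raw_embed_distWire {a t m : ℕ} (g : QGate m) :
    (g.embed (distWire a t m)).raw = g.raw.shift (distBase a t) := by
  simp only [QGate.embed, QGate.raw, RawGate.shift, List.map_ofFn]
  rfl

theorem map_raw_filterMap {w : ℕ} {gs : List RawGate} (h : ∀ g ∈ gs, (QGate.ofRaw w g).isSome) :
    (gs.filterMap (QGate.ofRaw w)).map QGate.raw = gs := by
  induction gs with
  | nil => rfl
  | cons g gs ih =>
    obtain ⟨q, hq⟩ := Option.isSome_iff_exists.1 (h g (by simp))
    rw [List.filterMap_cons_some hq, List.map_cons, QGate.raw_of_ofRaw hq,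
      ih fun g hg => h g (by simp [hg])]

theorem good_postGates {a t m : ℕ} (fl : Bool) {os : List ℕ} (h : ∀ o ∈ os, o < m) :
    ∀ g ∈ postGates fl os, (predLayout a t m).Good g ∧ IsClassical g := by
  intro g hg
  obtain ⟨o, ho, hg⟩ := List.mem_flatMap.1 hg
  have hok : (predLayout a t m).ok (.dist o) := h o ho
  rcases List.mem_cons.1 hg with rfl | hg
  · exact ⟨good_two rfl trivial hok (by simp), Or.inr (Or.inl rfl)⟩
  · split_ifs at hg
    · rw [List.mem_singleton.1 hg]
      exact ⟨good_one rfl hok, Or.inl rfl⟩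
    · simp at hg

/-! ### The output distribution of the predictor -/

section Predictor

variable {n t : ℕ} {cG : BoolCircuit} {cD : QCircuit} {fl : Bool}

theorem lt_simWidth (hG : cG.WellFormed n) (hGo : cG.outs.length = t) {i : ℕ} (hi : i < t) :
    n + 1 + cG.outs.getD i 0 < simWidth n cG := by
  have := hG.2 (cG.outs.getD i 0)
    (by rw [List.getD_eq_getElem _ _ (by omega)]; exact List.getElem_mem _)
  rw [simWidth]; omega

theorem good_preGates (hG : cG.WellFormed n) (hGo : cG.outs.length = t) (hD : t ≤ cD.width) :
    ∀ g ∈ preGates n t cG, (predLayout (simWidth n cG) t cD.width).Good g := by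
  intro g hg
  simp only [preGates, List.mem_append] at hg
  rcases hg with hg | hg | hg | hg | hg
  · exact good_simGates ((legalFrom_iff _ _).2 hG.1) le_rfl g hg
  · exact good_coinGates g hg
  · exact good_coin (q := .guess) (q' := .anc) trivial trivial (by simp) g hg
  · exact good_hotGates g hg
  · exact (good_loadGates (fun i hi => lt_simWidth hG hGo hi) hD g hg).1

/-- All listed gates are legal, so the filter in the definition of the circuit drops none of them.
Hence the description of the circuit is that of the explicit list. -/
theorem map_raw_predCircuit (hG : cG.WellFormed n) (hGo : cG.outs.length = t) (hD : t ≤ cD.width) :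
    (predCircuit fl n t cG cD).gates.map QGate.raw = predGates fl n t cG cD := by
  refine map_raw_filterMap fun g hg => ?_
  simp only [predGates, List.mem_append] at hg
  rcases hg with hg | hg | hg
  · obtain ⟨g', hg', rfl⟩ := List.mem_map.1 hg
    obtain ⟨v, hv, -⟩ := (good_preGates hG hGo hD g' hg').exists_gate
    exact Option.isSome_iff_exists.2 ⟨_, hv⟩
  · obtain ⟨g', hg', rfl⟩ := List.mem_map.1 hg
    obtain ⟨g, -, rfl⟩ := List.mem_map.1 hg'
    rw [← raw_embed_distWire]
    exact Option.isSome_iff_exists.2 ⟨_, QGate.ofRaw_raw (g.embed (distWire _ _ _))⟩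
  · obtain ⟨g', hg', rfl⟩ := List.mem_map.1 hg
    have ho : ∀ o ∈ cD.outs.map Fin.val, o < cD.width := by
      intro o ho
      obtain ⟨o', -, rfl⟩ := List.mem_map.1 ho
      exact o'.2
    have := (good_postGates (a := simWidth n cG) (t := t) (m := cD.width) fl ho g' hg').1
    obtain ⟨v, hv, -⟩ := this.exists_gate
    exact Option.isSome_iff_exists.2 ⟨_, hv⟩

/-- The input of the distinguisher in the `u`-th hybrid that starts with the last `u` bits of
`w`, when `g` is the guessed bit. -/
def hybridBits (w : List Bool) (t u : ℕ) (g : Bool) (r : ℕ → Bool) : List Bool :=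
  (List.range t).map fun p => if u < t then
    if p < u then w.getD (t - u + p) false else if p = u then g else r p else false

theorem length_hybridBits (w : List Bool) (t u : ℕ) (g : Bool) (r : ℕ → Bool) :
    (hybridBits w t u g r).length = t := by simp [hybridBits]

/-- The state after the first phases is a uniform mixture of basis states. -/
theorem run_preGates (hG : cG.WellFormed n) (hGo : cG.outs.length = t) (hD : t ≤ cD.width)
    {y : List Bool} (hy : y.length = n) :
    (predLayout (simWidth n cG) t cD.width).run (preGates n t cG)
      ((predLayout (simWidth n cG) t cD.width).op
        (wireState (paramPrefix n ++ y) false false (fun _ => false) (fun _ => false) fun _ => false)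
        (wireState (paramPrefix n ++ y) false false (fun _ => false) (fun _ => false) fun _ => false)) =
      (1 / 2 : ℂ) ^ t • ∑ r : Fin t → Bool, (1 / 2 : ℂ) • ∑ g : Bool, (1 / 2 ^ Nat.clog 2 t : ℂ) •
        ∑ u ∈ Finset.range (2 ^ Nat.clog 2 t), (predLayout (simWidth n cG) t cD.width).op
          (wireState (paramPrefix n ++ cG.wires y) false g (padBits r) (oneHot u)
            fun p => (hybridBits (cG.eval y) t u g (padBits r)).getD p false)
          (wireState (paramPrefix n ++ cG.wires y) false g (padBits r) (oneHot u)
            fun p => (hybridBits (cG.eval y) t u g (padBits r)).getD p false) := by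
  rw [preGates, run_append, run_simGates (a := simWidth n cG) hy ((legalFrom_iff _ _).2 hG.1) le_rfl, run_append,
    run_coinGates le_rfl, map_smul, map_sum]
  congr 1
  refine Finset.sum_congr rfl fun r _ => ?_
  rw [run_append, run_guess, map_smul, map_sum]
  congr 1
  refine Finset.sum_congr rfl fun g _ => ?_
  rw [run_append, run_hotGates le_rfl, map_smul, map_sum]
  congr 1
  refine Finset.sum_congr rfl fun u _ => ?_
  rw [run_loadGates (fun i hi => lt_simWidth hG hGo hi) hD]
  have : loadedBits n t (fun i => cG.outs.getD i 0) (wireState (paramPrefix n ++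
      runGates cG.gates y) false g (padBits r) (oneHot u) fun _ => false) u =
      fun p => (hybridBits (cG.eval y) t u g (padBits r)).getD p false := by
    funext p
    rw [loadedBits]
    by_cases hp : p < t
    · rw [List.getD_eq_getElem _ _ (by rw [length_hybridBits]; exact hp)]
      simp only [hybridBits, List.getElem_map, List.getElem_range, hp, and_true]
      by_cases hu : u < t
      -- Output `t - u + p` of the generator is the `p`-th of its last `u` bits.
      · by_cases h₁ : p < u
        · have hlt : t - u + p < cG.outs.length := by omega
          simp only [sourceWire, if_pos hu, if_pos h₁]
          rw [wireState, List.getD_append_right _ _ _ _ (by rw [length_paramPrefix]; omega),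
            length_paramPrefix, BoolCircuit.eval,
            List.getD_eq_getElem (List.map _ _) _ (by rw [List.length_map]; exact hlt),
            List.getElem_map, List.getD_eq_getElem cG.outs _ hlt]
          change (cG.wires y).getD _ false = _
          congr 1
          omega
        · by_cases h₂ : p = u
          · simp only [sourceWire, if_pos hu, if_neg h₁, if_pos h₂, wireState]
          · simp only [sourceWire, if_pos hu, if_neg h₁, if_neg h₂, wireState]
      · simp only [if_neg hu]
    · rw [if_neg (fun h => hp h.2), List.getD_eq_default _ _ (by rw [length_hybridBits]; omega)]
  rw [this]
  rfl

/-- The last gates add the guess and `fl` to the output bit, which is an injective map on the states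
of the register. Diagonal terms thus come from diagonal terms, and the event that the predictor
returns `β` is pulled back to an event for the distinguisher alone. -/
theorem diagSum_postGates {a m : ℕ} (z : Wire → Bool) (o : Fin m) (β : Bool) (σ : QOp m) :
    diagSum (fun y => if y (distWire a t m o) = β then 1 else 0)
      ((predLayout a t m).run (postGates fl [(o : ℕ)])
        (embedOp (distWire a t m) ((predLayout a t m).ket z) σ)) =
      diagSum (fun x => if x o = xor β (xor (z .guess) fl) then 1 else 0) σ := by
  set L := predLayout a t m with hL
  -- The assignment `z` with the register of the distinguisher replaced by `x`.
  set zx : (Fin m → Bool) → Wire → Bool := fun x q => match q with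
    | .dist p => if h : p < m then x ⟨p, h⟩ else z (.dist p)
    | q => z q with hzx
  have hext : ∀ x, Function.extend (distWire a t m) x (L.ket z) = L.ket (zx x) := by
    intro x
    refine ((eq_extend_iff _ _ _ _).2 ⟨fun i hi => ?_, ?_⟩).symm
    · by_cases hi' : i ∈ Set.range L.wire
      · obtain ⟨⟨q, hq⟩, rfl⟩ := hi'
        rw [ket_wire, ket_wire]
        cases q with
        | dist p => exact absurd ⟨⟨p, hq⟩, rfl⟩ hi
        | _ => rfl
      · rw [ket_of_notMem _ _ hi', ket_of_notMem _ _ hi']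
    · funext p
      rw [Function.comp_apply, distWire_eq, ket_wire]
      simp [hzx]
  set zy : (Fin m → Bool) → Wire → Bool := fun x =>
    Function.update (zx x) (.dist o) (xor (x o) (xor (z .guess) fl)) with hzy
  have hpost : ∀ x, (postGates fl [(o : ℕ)]).foldl (fun z g => act g z) (zx x) = zy x := by
    intro x
    rcases fl with _ | _
    · simp [postGates, act, hzy, hzx]
    · simp [postGates, act, hzy, hzx]
  have hlin : (diagSum (fun y => if y (distWire a t m o) = β then 1 else 0)).comp
      ((L.run (postGates fl [(o : ℕ)])).comp (embedOp (distWire a t m) (L.ket z))) =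
      diagSum (fun x => if x o = xor β (xor (z .guess) fl) then 1 else 0) := by
    refine linearMap_ext_ketBra fun x x' => ?_
    rw [LinearMap.comp_apply, LinearMap.comp_apply, embedOp_ketBra, hext, hext]
    change diagSum _ (L.run _ (L.op _ _)) = _
    rw [run_classical (good_postGates fl (by simp)), hpost, hpost, op, diagSum_ketBra,
      diagSum_ketBra]
    have hy : ∀ x (p : Fin m), L.ket (zy x) (distWire a t m p) =
        if p = o then xor (x o) (xor (z .guess) fl) else x p := by
      intro x p
      rw [distWire_eq, ket_wire]
      simp only [hzy, Function.update_apply, Wire.dist.injEq, Fin.val_inj]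
      split_ifs with h
      · rfl
      · simp [hzx]
    have hiff : L.ket (zy x) = L.ket (zy x') ↔ x = x' := by
      refine ⟨fun h => funext fun p => ?_, fun h => by rw [h]⟩
      have hp := congrFun h (distWire a t m p)
      rw [hy, hy] at hp
      split_ifs at hp with h'
      · subst h'; exact (Bool.xor_left_inj).1 hp
      · exact hp
    have : (xor (x o) (xor (z .guess) fl) = β) ↔ x o = xor β (xor (z .guess) fl) := by
      rcases x o <;> rcases z .guess <;> rcases fl <;> rcases β <;> simp
    by_cases hxx : x = x'
    · rw [if_pos (hiff.2 hxx), if_pos hxx, hy, if_pos rfl]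
      simp only [this]
    · rw [if_neg (fun h => hxx (hiff.1 h)), if_neg hxx]
  exact LinearMap.congr_fun hlin σ

/-- When the distinguisher starts, the rest of the register is in a basis state, and its own part is
the input state for `y`. With the other wires as spectators its gates act as in its own circuit. -/
theorem diagSum_distinguish {a : ℕ} {o : Fin cD.width} (ho : cD.outs = [o]) {z : Wire → Bool}
    {y : List Bool} (hz : ∀ p, z (.dist p) = y.getD p false) (β : Bool) :
    (diagSum (fun x => if x (distWire a t cD.width o) = β then 1 else 0)
      (runRaw (predWidth a t cD.width) (((cD.gates.map QGate.raw).map (RawGate.shift (distBase a t)) ++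
        (postGates fl (cD.outs.map Fin.val)).map (predLayout a t cD.width).raw))
        ((predLayout a t cD.width).op z z))).re = cD.prob y {[xor β (xor (z .guess) fl)]} := by
  classical
  have h₁ : (predLayout a t cD.width).op z z = embedOp (distWire a t cD.width)
      ((predLayout a t cD.width).ket z) (ketBra (fun i => y.getD i false) fun i => y.getD i false) := by
    have : Function.extend (distWire a t cD.width) (fun i => y.getD i false)
        ((predLayout a t cD.width).ket z) = (predLayout a t cD.width).ket z := by
      refine ((eq_extend_iff _ _ _ _).2 ⟨fun _ _ => rfl, ?_⟩).symm
      funext p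
      rw [Function.comp_apply, distWire_eq, ket_wire, hz]
    rw [embedOp_ketBra, this, op]
  have h₂ : (cD.gates.map QGate.raw).map (RawGate.shift (distBase a t)) =
      (cD.gates.map (QGate.embed (distWire a t cD.width))).map QGate.raw := by
    rw [List.map_map, List.map_map]
    exact List.map_congr_left fun g _ => (raw_embed_distWire g).symm
  rw [runRaw_append, h₂, runRaw_map_raw, h₁, applyGates_embed, QCircuit.prob_eq,
    QCircuit.finalState_eq, ho]
  have h₃ := diagSum_postGates (fl := fl) (t := t) (a := a) z o β
    (applyGates cD.gates (ketBra (fun i => y.getD i false) fun i => y.getD i false))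
  refine congrArg Complex.re (h₃.trans ?_)
  congr 1
  congr 1
  funext x
  simp

theorem ket_input (hGw : 2 * n + 1 ≤ simWidth n cG) {x : List Bool} (hx : x.length = 2 * n + 1) :
    (predLayout (simWidth n cG) t cD.width).ket
      (wireState x false false (fun _ => false) (fun _ => false) fun _ => false) =
        fun i : Fin (predWidth (simWidth n cG) t cD.width) => x.getD (i : ℕ) false := by
  funext i
  by_cases hi : i ∈ Set.range (predLayout (simWidth n cG) t cD.width).wire
  · obtain ⟨⟨q, hq⟩, rfl⟩ := hi
    rw [ket_wire]
    cases q with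
    | inp j => rfl
    | _ =>
      refine (List.getD_eq_default _ _ ?_).symm
      rw [hx]
      refine hGw.trans ?_
      simp only [Layout.wire, predLayout, wireLoc]
      omega
  · rw [ket_of_notMem _ _ hi, List.getD_eq_default]
    rw [hx]
    by_contra h
    exact hi ⟨⟨.inp i, by change (i : ℕ) < simWidth n cG; omega⟩, rfl⟩

/-- The output distribution of the predictor. -/
theorem predCircuit_prob (hG : cG.WellFormed n) (hGo : cG.outs.length = t) (hD : t ≤ cD.width)
    {o : Fin cD.width} (ho : cD.outs = [o]) {y : List Bool} (hy : y.length = n) (β : Bool) :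
    (predCircuit fl n t cG cD).prob (withParam y n) {[β]} =
      (1 / 2) ^ t * ∑ r : Fin t → Bool, 1 / 2 * ∑ g : Bool, 1 / 2 ^ Nat.clog 2 t *
        ∑ u ∈ Finset.range (2 ^ Nat.clog 2 t),
          cD.prob (hybridBits (cG.eval y) t u g (padBits r)) {[xor β (xor g fl)]} := by
  classical
  have hin : withParam y n = paramPrefix n ++ y := by simp [withParam, paramPrefix]
  have hlen : (withParam y n).length = 2 * n + 1 := by
    rw [hin, List.length_append, length_paramPrefix, hy]; omega
  have hstate : (predCircuit fl n t cG cD).finalState (withParam y n) =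
      runRaw (predWidth (simWidth n cG) t cD.width) (predGates fl n t cG cD)
        ((predLayout (simWidth n cG) t cD.width).op
        (wireState (paramPrefix n ++ y) false false (fun _ => false) (fun _ => false) fun _ => false)
        (wireState (paramPrefix n ++ y) false false (fun _ => false) (fun _ => false)
          fun _ => false)) := by
    rw [QCircuit.finalState_eq, op, ← hin, ket_input (by rw [simWidth]; omega) hlen]
    rfl
  have hF : (fun z : Fin (predWidth (simWidth n cG) t cD.width) → Bool =>
      if (predCircuit fl n t cG cD).outs.map z ∈ ({[β]} : Set (List Bool)) then (1 : ℂ) else 0) =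
      fun z => if z (distWire (simWidth n cG) t cD.width o) = β then 1 else 0 := by
    funext z
    have : ((predCircuit fl n t cG cD).outs.map z ∈ ({[β]} : Set (List Bool))) ↔
        z (distWire (simWidth n cG) t cD.width o) = β := by
      have houts : (predCircuit fl n t cG cD).outs = [distWire (simWidth n cG) t cD.width o] := by
        change cD.outs.map _ = _
        rw [ho]
        rfl
      rw [houts]
      exact ⟨fun h => (List.cons.inj h).1, fun h => congrArg (fun b => [b]) h⟩
    simp only [this]
  rw [QCircuit.prob_eq]
  refine (congrArg₂ (fun F ρ => (diagSum (w := predWidth (simWidth n cG) t cD.width) F ρ).re)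
    (show _ = fun z => if z (distWire (simWidth n cG) t cD.width o) = β then (1 : ℂ) else 0 from
      Eq.trans (by congr! 2) hF) hstate).trans ?_
  have hre : ∀ (k : ℕ) (z : ℂ), ((1 / 2 ^ k : ℂ) * z).re = 1 / 2 ^ k * z.re := by
    intro k z
    have : (1 / 2 ^ k : ℂ) = ((1 / 2 ^ k : ℝ) : ℂ) := by push_cast; rfl
    rw [this, Complex.re_ofReal_mul]
  have hre₁ : ∀ z : ℂ, ((1 / 2 : ℂ) * z).re = 1 / 2 * z.re := by
    intro z
    rw [← pow_one (2 : ℂ), hre, pow_one]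
  have hre₂ : ∀ (z : ℂ), ((1 / 2 : ℂ) ^ t * z).re = (1 / 2) ^ t * z.re := by
    intro z
    rw [one_div_pow, one_div_pow, hre]
  rw [predGates, runRaw_append]
  have hpre := run_preGates (cD := cD) hG hGo hD hy
  rw [run] at hpre
  rw [hpre]
  simp only [map_smul, map_sum, smul_eq_mul, hre₂, Complex.re_sum, hre₁, hre]
  refine congrArg _ (Finset.sum_congr rfl fun r _ => congrArg _ (Finset.sum_congr rfl fun g _ =>
    congrArg _ (Finset.sum_congr rfl fun u _ => ?_)))
  exact diagSum_distinguish ho (fun p => rfl) β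

end Predictor

/-! ## The predictor is a polynomial-time algorithm -/

section Description

variable {B X : Type} [Ctx X]

/-- The description of a quantum gate among the letters. -/
def RawGate.word (g : RawGate) : List Letter := itemWord g.item

/-- The gates on the wires of the predictor are computable. -/
def GComp (B : Type) {X : Type} [Ctx X] (A T : X → ℕ) (L : X → List (NamedGate Wire)) : Prop :=
  LComp B RawGate.word fun x => (L x).map fun g => (g.1, g.2.map (wireLoc (A x) (T x)))

/-- The wire of the predictor is computable. -/
def WComp (B : Type) {X : Type} [Ctx X] (A T : X → ℕ) (q : X → Wire) : Prop :=
  NComp B fun x => wireLoc (A x) (T x) (q x)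

namespace GComp

variable {A T : X → ℕ} {L M : X → List (NamedGate Wire)}

theorem congr (h : GComp B A T L) (e : ∀ x, L x = M x) : GComp B A T M :=
  LComp.congr h fun x => by rw [e x]

theorem nil : GComp B A T fun _ => [] := LComp.nil

theorem append (hL : GComp B A T L) (hM : GComp B A T M) : GComp B A T fun x => L x ++ M x :=
  (LComp.append hL hM).congr fun x => by simp

theorem flatMapRange {N : X → ℕ} {K : X × ℕ → List (NamedGate Wire)} (hN : NComp B N)
    (hK : GComp B (fun p => A p.1) (fun p => T p.1) K) :
    GComp B A T fun x => (List.range (N x)).flatMap fun j => K (x, j) :=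
  (LComp.flatMapRange hN hK).congr fun x => by simp [List.map_flatMap]

theorem ite {P : X → Prop} [DecidablePred P] (hP : DComp B P) (hL : GComp B A T L)
    (hM : GComp B A T M) : GComp B A T fun x => if P x then L x else M x :=
  (LComp.ite hP hL hM).congr fun x => by dsimp only; split_ifs <;> rfl

theorem gate (name : QGateName) {l : List (X → Wire)} (h : ∀ q ∈ l, WComp B A T q) :
    GComp B A T fun x => [(name, l.map fun q => q x)] := by
  refine LComp.singleton ((Comp.item (B := B) (.gate (.inr name))
    (l := l.map fun q x => wireLoc (A x) (T x) (q x)) ?_).congr fun x => ?_)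
  · intro N hN
    obtain ⟨q, hq, rfl⟩ := List.mem_map.1 hN
    exact h q hq
  · simp [RawGate.word, RawGate.item, Function.comp_def]

theorem one (name : QGateName) {q : X → Wire} (h : WComp B A T q) :
    GComp B A T fun x => [(name, [q x])] := gate name (l := [q]) (by simpa using h)

theorem two (name : QGateName) {q q' : X → Wire} (h : WComp B A T q) (h' : WComp B A T q') :
    GComp B A T fun x => [(name, [q x, q' x])] := gate name (l := [q, q']) (by simp [h, h'])

theorem three (name : QGateName) {q q' q'' : X → Wire} (h : WComp B A T q) (h' : WComp B A T q')
    (h'' : WComp B A T q'') : GComp B A T fun x => [(name, [q x, q' x, q'' x])] :=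
  gate name (l := [q, q', q'']) (by simp [h, h', h''])

theorem coin {q q' : X → Wire} (h : WComp B A T q) (h' : WComp B A T q') :
    GComp B A T fun x => Layout.coin (q x) (q' x) :=
  (one .H h).append ((two .cnot h h').append (one .reset h'))

end GComp

namespace WComp

variable {A T N : X → ℕ}

theorem inp (hN : NComp B N) : WComp B A T fun x => .inp (N x) := hN

theorem anc (hA : NComp B A) : WComp B A T fun _ => .anc := hA

theorem tmp (hA : NComp B A) : WComp B A T fun _ => .tmp := hA.add (.const 1)

theorem guess (hA : NComp B A) : WComp B A T fun _ => .guess := hA.add (.const 2)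

theorem rand (hA : NComp B A) (hN : NComp B N) : WComp B A T fun x => .rand (N x) :=
  (hA.add (.const 3)).add hN

theorem hot (hA : NComp B A) (hT : NComp B T) (hN : NComp B N) : WComp B A T fun x => .hot (N x) :=
  ((hA.add (.const 3)).add hT).add hN

theorem dist (hA : NComp B A) (hT : NComp B T) (hN : NComp B N) :
    WComp B A T fun x => .dist (N x) :=
  (((hA.add (.const 3)).add hT).add (((NComp.const 2).mul hT).add (.const 1))).add hN

theorem ite {P : X → Prop} [DecidablePred P] {q q' : X → Wire} (hP : DComp B P)
    (h : WComp B A T q) (h' : WComp B A T q') : WComp B A T fun x => if P x then q x else q' x :=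
  (NComp.ite hP h h').congr fun x => by dsimp only; split_ifs <;> rfl

end WComp

theorem NComp.distBase {A T : X → ℕ} (hA : NComp B A) (hT : NComp B T) :
    NComp B fun x => distBase (A x) (T x) :=
  ((hA.add (.const 3)).add hT).add (((NComp.const 2).mul hT).add (.const 1))

/-! ### Computing the phases of the predictor -/

section Phases

variable {A T N : X → ℕ}

theorem gcomp_coinGates (hA : NComp B A) (hT : NComp B T) : GComp B A T fun x => coinGates (T x) :=
  GComp.flatMapRange hT (GComp.coin (WComp.rand hA.fst .snd) (WComp.anc hA.fst))

theorem gcomp_doubleGates {S : X → ℕ} (hA : NComp B A) (hT : NComp B T) (hS : NComp B S) :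
    GComp B A T fun x => doubleGates (S x) := by
  have h₁ := WComp.hot (B := B) hA.fst hT.fst NComp.snd
  have h₂ := WComp.hot (B := B) hA.fst hT.fst (NComp.snd.add hS.fst)
  have h₃ : GComp B (fun p : X × ℕ => A p.1) (fun p => T p.1) fun p =>
      [(.toffoli, [.hot p.2, .tmp, .hot (p.2 + S p.1)]), (.cnot, [.hot (p.2 + S p.1), .hot p.2])] :=
    ((GComp.three .toffoli h₁ (WComp.tmp hA.fst) h₂).append (GComp.two .cnot h₂ h₁)).congr
      fun p => rfl
  exact ((GComp.coin (WComp.tmp hA) (WComp.anc hA)).append (GComp.flatMapRange hS h₃)).append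
    (GComp.one .reset (WComp.tmp hA))

theorem gcomp_hotGates (hA : NComp B A) (hT : NComp B T) : GComp B A T fun x => hotGates (T x) := by
  classical
  refine ((GComp.one .X (WComp.hot hA hT (.const 0))).append (GComp.flatMapRange (K := fun p =>
    if ∃ k, p.2 = 2 ^ k then doubleGates p.2 else []) hT (GComp.ite (P := fun p : X × ℕ =>
      ∃ k, p.2 = 2 ^ k) (DComp.isPowerOfTwo .snd) (gcomp_doubleGates hA.fst hT.fst .snd)
        GComp.nil))).congr fun x => ?_
  rw [hotGates]
  refine congrArg _ (congrArg (fun F => List.flatMap F _) (funext fun s => ?_))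
  split_ifs <;> rfl

theorem gcomp_loadGates {o : X → ℕ → ℕ} (hA : NComp B A) (hT : NComp B T) (hN : NComp B N)
    (ho : NComp B fun p : X × ℕ => o p.1 p.2) :
    GComp B A T fun x => loadGates (N x) (T x) (o x) := by
  refine (GComp.flatMapRange hT (GComp.flatMapRange (K := fun q : (X × ℕ) × ℕ => [(.toffoli,
    [.hot q.1.2, sourceWire (N q.1.1) (T q.1.1) (o q.1.1) q.1.2 q.2, .dist q.2])]) hT.fst
      (GComp.three .toffoli (WComp.hot hA.fst.fst hT.fst.fst NComp.snd.fst) ?_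
        (WComp.dist hA.fst.fst hT.fst.fst .snd)))).congr fun x => ?_
  · have hs : NComp B fun q : (X × ℕ) × ℕ => T q.1.1 - q.1.2 + q.2 :=
      (hT.fst.fst.sub NComp.snd.fst).add .snd
    have ho' : NComp B fun q : (X × ℕ) × ℕ => o q.1.1 (T q.1.1 - q.1.2 + q.2) := by
      have h : Comp B fun p : ((X × ℕ) × ℕ) × ℕ => List.replicate (o p.1.1.1 p.2) Token.tick :=
        Comp.rename ho (fun p : ((X × ℕ) × ℕ) × ℕ => (p.1.1.1, p.2))
          (fun i => i.elim none fun j => some (some (some j)))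
          (by rintro (_ | i) (_ | j) h <;> first | rfl | cases h; rfl | cases h)
          (by rintro x (_ | _) <;> rfl)
      exact Comp.letNat hs h
    exact WComp.ite (DComp.lt .snd NComp.snd.fst)
      (WComp.inp ((hN.fst.fst.add (.const 1)).add ho'))
      (WComp.ite (DComp.eq .snd NComp.snd.fst) (WComp.guess hA.fst.fst) (WComp.rand hA.fst.fst .snd))
  · rw [loadGates]
    refine congrArg (fun F => List.flatMap F _) (funext fun u => ?_)
    rw [List.map_eq_flatMap]

end Phases

theorem gcomp_simGates {C : ℕ → BoolCircuit} {A T : ℕ → ℕ}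
    (hC : Comp B fun n => (C n).encode.map (Token.map Sum.inl)) :
    GComp B A T fun n => simGates n (C n).gates := by
  classical
  obtain ⟨hg, -, z, a₁, a₂, -, hz, h₁, h₂, -, hgates, -⟩ := boolCircuit_data hC
  have hn : NComp B fun p : ℕ × ℕ => p.1 := NComp.id.fst
  have hw₁ : WComp B (fun p : ℕ × ℕ => A p.1) (fun p => T p.1) fun p => .inp (p.1 + 1 + a₁ p) :=
    WComp.inp ((hn.add (.const 1)).add h₁)
  have hw₂ : WComp B (fun p : ℕ × ℕ => A p.1) (fun p => T p.1) fun p => .inp (p.1 + 1 + a₂ p) :=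
    WComp.inp ((hn.add (.const 1)).add h₂)
  have hw₃ : WComp B (fun p : ℕ × ℕ => A p.1) (fun p => T p.1) fun p => .inp (2 * p.1 + 1 + p.2) :=
    WComp.inp ((((NComp.const 2).mul hn).add (.const 1)).add .snd)
  refine (GComp.flatMapRange (K := fun p => if z p then [] else
    (if a₁ p = a₂ p then [(.cnot, [.inp (p.1 + 1 + a₁ p), .inp (2 * p.1 + 1 + p.2)])] else
      [(.toffoli, [.inp (p.1 + 1 + a₁ p), .inp (p.1 + 1 + a₂ p), .inp (2 * p.1 + 1 + p.2)])]) ++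
        [(.X, [.inp (2 * p.1 + 1 + p.2)])]) hg (GComp.ite hz GComp.nil
      ((GComp.ite (DComp.eq h₁ h₂) (GComp.two _ hw₁ hw₃) (GComp.three _ hw₁ hw₂ hw₃)).append
        (GComp.one _ hw₃)))).congr fun n => ?_
  rw [simGates, List.flatMap_def, List.flatMap_def]
  congr 1
  refine List.map_congr_left fun k hk => ?_
  have hk := List.mem_range.1 hk
  have hgk : (C n).gates.getD k .zero = if z (n, k) then BoolGate.zero else
      .nand (a₁ (n, k)) (a₂ (n, k)) := by
    conv_lhs => rw [hgates n]
    rw [List.getD_eq_getElem _ _ (by simpa using hk), List.getElem_map, List.getElem_range]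
  rw [hgk]
  by_cases hzk : z (n, k)
  · rw [if_pos hzk, if_pos hzk]; rfl
  · rw [if_neg hzk, if_neg hzk, simGate]
    split_ifs <;> rfl

theorem Comp.gateCases {z : X → QGateName} (hz : ∀ g, DComp B fun x => z x = g)
    {F : QGateName → X → List Letter} (hF : ∀ g, Comp B (F g)) : Comp B fun x => F (z x) x := by
  classical
  refine ((hz .X).select (hF .X) ((hz .H).select (hF .H) ((hz .T).select (hF .T)
    ((hz .cnot).select (hF .cnot) ((hz .toffoli).select (hF .toffoli) (hF .reset)))))).congr
      fun x => ?_
  cases h : z x <;> simp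

theorem comp_shiftedGates {C : ℕ → QCircuit}
    (hC : Comp B fun n => (C n).encode.map (Token.map Sum.inr)) {N S : X → ℕ} (hN : NComp B N)
    (hS : NComp B S) : LComp B RawGate.word fun x =>
      ((C (N x)).gates.map QGate.raw).map (RawGate.shift (S x)) := by
  obtain ⟨hg, -, -, z, a, -, hz, ha, -, hgates, -⟩ := qCircuit_data hC
  refine (LComp.mapRange (N := fun x => (C (N x)).gates.length) (a := fun p : X × ℕ =>
    ((z (N p.1, p.2), (List.range (z (N p.1, p.2)).arity).map fun i => S p.1 + a (N p.1, p.2) i) :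
      RawGate)) (hg.at₁ hN) (LComp.singleton ?_)).congr fun x => ?_
  · refine Comp.gateCases (z := fun p : X × ℕ => z (N p.1, p.2)) (F := fun g p => RawGate.word
      (g, (List.range g.arity).map fun i => S p.1 + a (N p.1, p.2) i))
      (fun g => (hz g).at₂ hN.fst .snd) fun g => ?_
    refine (Comp.item (B := B) (.gate (.inr g)) (l := (List.range g.arity).map fun i =>
      fun p : X × ℕ => S p.1 + a (N p.1, p.2) i) ?_).congr fun p => ?_
    · intro M hM
      obtain ⟨i, -, rfl⟩ := List.mem_map.1 hM
      exact hS.fst.add ((ha i).at₂ hN.fst .snd)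
    · simp [RawGate.word, RawGate.item, Function.comp_def]
  · rw [hgates, List.map_map]
    refine List.map_congr_left fun k _ => ?_
    simp [RawGate.shift, Function.comp_def]

/-- The distinguisher is used at input length `t n`, so its circuit is read at the computed number
`t n`. Its gates are copied with all wire numbers shifted to its place in the larger register. -/
theorem comp_predCircuit {cG : ℕ → BoolCircuit} {cD : ℕ → QCircuit} {t : ℕ → ℕ} (fl : Bool)
    (hG : Comp B fun n => (cG n).encode.map (Token.map Sum.inl))
    (hD : Comp B fun n => (cD n).encode.map (Token.map Sum.inr)) (ht : NComp B t)
    (wG : ∀ n, (cG n).WellFormed n) (hGo : ∀ n, (cG n).outs.length = t n)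
    (hDw : ∀ n, n ≤ (cD n).width) :
    Comp B fun n => (predCircuit fl n (t n) (cG n) (cD (t n))).encode.map (Token.map Sum.inr) := by
  obtain ⟨hGg, hGl, -, -, -, oG, -, -, -, hoG, -, houtG⟩ := boolCircuit_data hG
  obtain ⟨-, hDl, hDwd, -, -, oD, -, -, hoD, -, houtD⟩ := qCircuit_data hD
  set A : ℕ → ℕ := fun n => simWidth n (cG n) with hAdef
  have hA : NComp B A := (((NComp.const 2).mul .id).add (.const 1)).add hGg
  have hbase : NComp B fun n => distBase (A n) (t n) := NComp.distBase hA ht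
  have hwidth : NComp B fun n => predWidth (A n) (t n) (cD (t n)).width :=
    hbase.add (hDwd.at₁ ht)
  have hoG' : NComp B fun p : ℕ × ℕ => (cG p.1).outs.getD p.2 0 := by
    refine (NComp.ite (DComp.lt .snd hGl.fst) hoG (.const 0)).congr fun p => ?_
    split_ifs with h
    · conv_rhs => rw [houtG p.1]
      rw [List.getD_eq_getElem _ _ (by simpa using h), List.getElem_map, List.getElem_range]
    · rw [List.getD_eq_default _ _ (by omega)]
  have hpre : GComp B A t fun n => preGates n (t n) (cG n) :=
    (gcomp_simGates hG).append ((gcomp_coinGates hA ht).append ((GComp.coin (WComp.guess hA)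
      (WComp.anc hA)).append ((gcomp_hotGates hA ht).append (gcomp_loadGates hA ht .id hoG'))))
  have hDo : NComp B fun p : ℕ × ℕ => oD (t p.1, p.2) := hoD.at₂ ht.fst .snd
  have hpost : GComp B A t fun n => postGates fl ((cD (t n)).outs.map Fin.val) := by
    have hw : WComp B (fun p : ℕ × ℕ => A p.1) (fun p => t p.1) fun p => .dist (oD (t p.1, p.2)) :=
      WComp.dist hA.fst ht.fst hDo
    have hX : GComp B (fun p : ℕ × ℕ => A p.1) (fun p => t p.1) fun p =>
        if fl then [(.X, [.dist (oD (t p.1, p.2))])] else [] := by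
      cases fl
      · exact GComp.nil
      · exact GComp.one _ hw
    refine (GComp.flatMapRange (N := fun n => (cD (t n)).outs.length) (hDl.at₁ ht)
      ((GComp.two .cnot (WComp.guess hA.fst) hw).append hX)).congr fun n => ?_
    rw [houtD, postGates, List.flatMap_map]
    rfl
  have houts : LComp B (fun i : ℕ => itemWord (outItem i)) fun n =>
      ((cD (t n)).outs.map Fin.val).map fun i => distBase (A n) (t n) + i := by
    refine (LComp.mapRange (N := fun n => (cD (t n)).outs.length) (a := fun p : ℕ × ℕ =>
      distBase (A p.1) (t p.1) + oD (t p.1, p.2)) (hDl.at₁ ht) (LComp.singleton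
        (Comp.item (B := B) (l := [fun p : ℕ × ℕ => distBase (A p.1) (t p.1) + oD (t p.1, p.2)]) _
          ?_))).congr fun n => ?_
    · intro N hN
      rw [List.mem_singleton.1 hN]
      exact hbase.fst.add hDo
    · rw [houtD, List.map_map]
      rfl
  refine (Comp.append (Comp.wireWord hwidth) (Comp.append (LComp.append hpre (LComp.append
    (comp_shiftedGates hD ht hbase) hpost)) houts)).congr fun n => ?_
  rw [QCircuit.map_encode]
  have hg : ((predCircuit fl n (t n) (cG n) (cD (t n))).gates.map fun g => g.raw.item) =
      (predGates fl n (t n) (cG n) (cD (t n))).map RawGate.item := by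
    rw [← map_raw_predCircuit (wG n) (hGo n) (hDw (t n)), List.map_map]
    rfl
  have ho : (predCircuit fl n (t n) (cG n) (cD (t n))).outs.map Fin.val =
      ((cD (t n)).outs.map Fin.val).map fun i => distBase (A n) (t n) + i := by
    have : ∀ l : List (Fin (cD (t n)).width), (l.map (distWire (A n) (t n) _)).map Fin.val =
        (l.map Fin.val).map fun i => distBase (A n) (t n) + i := fun l => by
      rw [List.map_map, List.map_map]
      rfl
    exact this _
  rw [hg, ho]
  refine congrArg₂ _ rfl (congrArg₂ _ ?_ (List.flatMap_map _ _ _).symm)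
  rw [List.flatMap_map]
  rfl

end Description

/-- The predictor's input `1ⁿ 0 y` has length `2 * n + 1`, so half the input length recovers `n`. -/
theorem NComp.half {B : Type} : NComp B fun n : ℕ => n / 2 := by
  refine (NComp.sum NComp.id (DComp.ite (DComp.le (((NComp.const 2).mul .snd).add (.const 2))
    NComp.id.fst))).congr fun n => ?_
  rw [← Finset.sum_filter, Finset.sum_const, smul_eq_mul, mul_one]
  have : (Finset.range n).filter (fun j => 2 * j + 2 ≤ n) = Finset.range (n / 2) := by
    ext j; simp; omega
  rw [this, Finset.card_range]

theorem quantumToken_inv (a : Token QGateName) :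
    ((a.map Sum.inr : Letter).map fun s => s.elim (fun _ => QGateName.X) id) = a :=
  Token.map_map_of_leftInverse (fun _ => rfl) a

/-- A distinguisher against a generator yields a predictor that is a polynomial-time algorithm. -/
theorem exists_predictor {cG : ℕ → BoolCircuit} {t : ℕ → ℕ} (fl : Bool)
    (uG : PolyTimeUniform BoolCircuit.encode cG) (D : QPT) (ht : ∀ B, NComp B t)
    (wG : ∀ n, (cG n).WellFormed n) (hGo : ∀ n, (cG n).outs.length = t n) :
    ∃ A : QPT, ∀ n, A.circuit n =
      predCircuit fl (n / 2) (t (n / 2)) (cG (n / 2)) (D.circuit (t (n / 2))) := by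
  obtain ⟨u⟩ := uG
  obtain ⟨v⟩ := D.uniform
  have hG := comp_of_machine (B := BoxLetter u.tm ⊕ BoxLetter v.tm) u (Token.map Sum.inl)
    ⟨Sum.inl, Sum.inl_injective⟩
  have hD := comp_of_machine (B := BoxLetter u.tm ⊕ BoxLetter v.tm) v (Token.map Sum.inr)
    ⟨Sum.inr, Sum.inr_injective⟩
  refine ⟨⟨fun n => predCircuit fl (n / 2) (t (n / 2)) (cG (n / 2)) (D.circuit (t (n / 2))),
    fun n => ?_, ?_⟩, fun n => rfl⟩
  · change n ≤ predWidth _ _ _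
    -- The input fits because `2 * (n / 2) + 1 ≥ n`, for even `n` too.
    rw [predWidth, simWidth]
    omega
  · exact polyTimeUniform_of_comp (B := BoxLetter u.tm ⊕ BoxLetter v.tm) (Token.map Sum.inr)
      (Token.map fun s => s.elim (fun _ => QGateName.X) id) quantumToken_inv
      (Comp.at₁ (comp_predCircuit fl hG hD (ht _) wG hGo D.le_width) NComp.half)

/-! ## The hybrid argument -/

theorem uniformMean_congr {n : ℕ} {F G : List Bool → ℝ} (h : ∀ x, x.length = n → F x = G x) :
    uniformMean n F = uniformMean n G := by
  rw [uniformMean, uniformMean, Finset.sum_congr rfl fun x _ => h _ (List.length_ofFn)]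

theorem uniformMean_const (n : ℕ) (c : ℝ) : uniformMean n (fun _ => c) = c := by
  rw [uniformMean, Finset.sum_const, Finset.card_univ, Fintype.card_fun, Fintype.card_bool,
    Fintype.card_fin, nsmul_eq_mul]
  push_cast
  field_simp

theorem uniformMean_add (n : ℕ) (F G : List Bool → ℝ) :
    uniformMean n (fun x => F x + G x) = uniformMean n F + uniformMean n G := by
  rw [uniformMean, Finset.sum_add_distrib, add_div]; rfl

theorem uniformMean_sub (n : ℕ) (F G : List Bool → ℝ) :
    uniformMean n (fun x => F x - G x) = uniformMean n F - uniformMean n G := by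
  rw [uniformMean, Finset.sum_sub_distrib, sub_div]; rfl

theorem uniformMean_div (n : ℕ) (F : List Bool → ℝ) (c : ℝ) :
    uniformMean n (fun x => F x / c) = uniformMean n F / c := by
  rw [uniformMean, ← Finset.sum_div, div_right_comm]; rfl

theorem uniformMean_sum (n k : ℕ) (F : ℕ → List Bool → ℝ) :
    uniformMean n (fun x => ∑ u ∈ Finset.range k, F u x) =
      ∑ u ∈ Finset.range k, uniformMean n (F u) := by
  rw [uniformMean, Finset.sum_comm, Finset.sum_div]; rfl

/-- A permutation of the bitstrings of length `n` preserves the uniform distribution. -/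
theorem uniformMean_comp {n : ℕ} {f : List Bool → List Bool}
    (hf : Set.BijOn f {x | x.length = n} {x | x.length = n}) (F : List Bool → ℝ) :
    uniformMean n (fun x => F (f x)) = uniformMean n F := by
  set g : (Fin n → Bool) → Fin n → Bool := fun x i => (f (List.ofFn x)).getD i false with hg
  have hlen : ∀ x : Fin n → Bool, (f (List.ofFn x)).length = n := fun x =>
    hf.mapsTo (show (List.ofFn x).length = n from List.length_ofFn)
  have hgf : ∀ x, List.ofFn (g x) = f (List.ofFn x) := by
    intro x
    refine List.ext_getElem (by rw [List.length_ofFn, hlen]) fun i h₁ h₂ => ?_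
    rw [List.getElem_ofFn]
    exact List.getD_eq_getElem _ _ h₂
  have hinj : Function.Injective g := by
    intro x x' h
    have h' : f (List.ofFn x) = f (List.ofFn x') := by rw [← hgf, ← hgf, h]
    exact List.ofFn_injective (hf.injOn (show (List.ofFn x).length = n from List.length_ofFn)
      (show (List.ofFn x').length = n from List.length_ofFn) h')
  rw [uniformMean, uniformMean]
  congr 1
  rw [← (Finite.injective_iff_bijective.1 hinj).sum_comp fun x => F (List.ofFn x)]
  exact Finset.sum_congr rfl fun x _ => by rw [hgf]

/-- Overwriting one bit of a uniformly random string by a fresh random bit leaves it uniformly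
random. -/
theorem sum_update {k : ℕ} (u : Fin k) (F : (Fin k → Bool) → ℝ) :
    ∑ r, ∑ g : Bool, F (Function.update r u g) = 2 * ∑ r, F r := by
  have hinv : Function.Involutive fun r : Fin k → Bool => Function.update r u (!r u) := by
    intro r
    simp
  have h : ∀ r : Fin k → Bool, ∑ g : Bool, F (Function.update r u g) =
      F r + F (Function.update r u (!r u)) := by
    intro r
    have hr : Function.update r u (r u) = r := Function.update_eq_self u r
    rw [Fintype.sum_bool]
    rcases hb : r u <;> rw [hb] at hr <;> rw [hr]
    · exact add_comm _ _
    · rfl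
  rw [Finset.sum_congr rfl fun r _ => h r, Finset.sum_add_distrib, two_mul]
  congr 1
  exact Equiv.sum_comp (hinv.toPerm _) F

/-! ### The hybrids and the success probability of the predictor -/

section Hybrid

variable {f : List Bool → List Bool} {b : List Bool → Bool}

/-- The string whose first `k` bits are the last bits of the output of the generator on the seed
`s`, continued by `r`. -/
def prefixBits (f : List Bool → List Bool) (b : List Bool → Bool) (t k : ℕ) (s : List Bool)
    (r : ℕ → Bool) : List Bool :=
  (List.range t).map fun p => if p < k then b (f^[k - 1 - p] s) else r p

theorem iteratedGenerator_eq (t : ℕ → ℕ) (s : List Bool) : iteratedGenerator f b t s =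
    (List.range (t s.length)).map fun i => b (f^[t s.length - 1 - i] s) := by
  rw [iteratedGenerator]
  refine List.ext_getElem (by simp) fun i h₁ h₂ => ?_
  simp

theorem length_iteratedGenerator (t : ℕ → ℕ) (s : List Bool) :
    (iteratedGenerator f b t s).length = t s.length := by simp [iteratedGenerator]

theorem prefixBits_self (t : ℕ → ℕ) (s : List Bool) (r : ℕ → Bool) :
    prefixBits f b (t s.length) (t s.length) s r = iteratedGenerator f b t s := by
  rw [iteratedGenerator_eq, prefixBits]
  exact List.map_congr_left fun p hp => if_pos (List.mem_range.1 hp)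

theorem prefixBits_zero {t : ℕ} (s : List Bool) (r : Fin t → Bool) :
    prefixBits f b t 0 s (padBits r) = List.ofFn r := by
  refine List.ext_getElem (by simp [prefixBits]) fun i h₁ h₂ => ?_
  have hi : i < t := by simpa using h₂
  simp [prefixBits, padBits, hi]

/-- In reverse order the last `u` bits for the seed `y` are `b(f^(u-1)(y)) ⋯ b(y)`, whatever `t` is.
With an arbitrary guess in the next place this is hybrid `u` of `y`, the guess playing the role of
its first random bit. -/
theorem hybridBits_eq_prefixBits {t : ℕ → ℕ} {n u : ℕ} (hu : u < t n) {y : List Bool}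
    (hy : y.length = n) (g : Bool) (r : Fin (t n) → Bool) :
    hybridBits (iteratedGenerator f b t y) (t n) u g (padBits r) =
      prefixBits f b (t n) u y (padBits (Function.update r ⟨u, hu⟩ g)) := by
  rw [hybridBits, prefixBits]
  refine List.map_congr_left fun p hp => ?_
  have hp := List.mem_range.1 hp
  rw [if_pos hu]
  split_ifs with h₁ h₂
  · have hlt : t n - u + p < t n := by omega
    rw [iteratedGenerator_eq, hy, List.getD_eq_getElem _ _ (by simpa using hlt), List.getElem_map,
      List.getElem_range]
    congr 2
    omega
  · subst h₂
    simp [padBits, hp]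
  · have : (⟨p, hp⟩ : Fin (t n)) ≠ ⟨u, hu⟩ := fun h => h₂ (congrArg Fin.val h)
    simp [padBits, hp, Function.update_of_ne this]

/-- The last `u` bits for the seed `f(x)` are `b(f^u(x)) ⋯ b(f(x))`, and the correct guess `b(x)`
continues them to hybrid `u + 1` of `x`. -/
theorem hybridBits_correct {t : ℕ → ℕ} {n u : ℕ} (hu : u < t n) {x : List Bool}
    (hy : (f x).length = n) (r : ℕ → Bool) :
    hybridBits (iteratedGenerator f b t (f x)) (t n) u (b x) r =
      prefixBits f b (t n) (u + 1) x r := by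
  rw [hybridBits, prefixBits]
  refine List.map_congr_left fun p hp => ?_
  have hp := List.mem_range.1 hp
  rw [if_pos hu]
  rcases lt_trichotomy p u with h | h | h
  · have hlt : t n - u + p < t n := by omega
    rw [if_pos h, if_pos (by omega), iteratedGenerator_eq, hy,
      List.getD_eq_getElem _ _ (by simpa using hlt), List.getElem_map, List.getElem_range,
      ← Function.iterate_succ_apply]
    congr 2
    omega
  · subst h
    rw [if_neg (by omega), if_pos rfl, if_pos (by omega)]
    simp
  · rw [if_neg (by omega), if_neg (by omega), if_neg (by omega)]

variable (q : List Bool → Bool → ℝ) (fl : Bool)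

/-- The acceptance probability on a prefix of the output of the generator followed by random
bits. -/
noncomputable def prefixMean (f : List Bool → List Bool) (b : List Bool → Bool)
    (q : List Bool → Bool → ℝ) (fl : Bool) (t k : ℕ) (s : List Bool) : ℝ :=
  (1 / 2) ^ t * ∑ r : Fin t → Bool, q (prefixBits f b t k s (padBits r)) fl

variable {q}

/-- Fix `r` and let `P g` be the probability of the verdict `fl` when the guess is `g`. The correct
guess leads to success with probability `P (b x)`, the wrong one with `1 - P (!b x)`; the average is
`1/2 + P (b x) - (P true + P false) / 2`. Here `P (b x)` belongs to hybrid `u + 1` of `x`, and the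
mean over the guess to hybrid `u` of `f x`. For `u ≥ t` the input of the distinguisher does not
depend on the guess, and the average is `1/2`. -/
theorem hybrid_term (hq : ∀ w β, q w β + q w (!β) = 1) {t : ℕ → ℕ} {n : ℕ} {x : List Bool}
    (hy : (f x).length = n) (u : ℕ) :
    (1 / 2) ^ t n * ∑ r : Fin (t n) → Bool, 1 / 2 * ∑ g : Bool,
      q (hybridBits (iteratedGenerator f b t (f x)) (t n) u g (padBits r))
        (xor (b x) (xor g fl)) = 1 / 2 + if u < t n then
          prefixMean f b q fl (t n) (u + 1) x - prefixMean f b q fl (t n) u (f x) else 0 := by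
  have hone : (1 / 2 : ℝ) ^ t n * ∑ _r : Fin (t n) → Bool, (1 / 2 : ℝ) = 1 / 2 := by
    rw [Finset.sum_const, Finset.card_univ, Fintype.card_fun, Fintype.card_bool,
      Fintype.card_fin, nsmul_eq_mul]
    push_cast
    rw [← mul_assoc, ← mul_pow]
    norm_num
  by_cases hu : u < t n
  · rw [if_pos hu]
    have hterm : ∀ r : Fin (t n) → Bool, 1 / 2 * ∑ g : Bool,
        q (hybridBits (iteratedGenerator f b t (f x)) (t n) u g (padBits r))
          (xor (b x) (xor g fl)) = 1 / 2 + q (prefixBits f b (t n) (u + 1) x (padBits r)) fl -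
            1 / 2 * ∑ g : Bool, q (prefixBits f b (t n) u (f x)
              (padBits (Function.update r ⟨u, hu⟩ g))) fl := by
      intro r
      rw [← hybridBits_correct hu hy]
      simp only [← hybridBits_eq_prefixBits hu hy, Fintype.sum_bool]
      set w := iteratedGenerator f b t (f x)
      have h₁ := hq (hybridBits w (t n) u true (padBits r)) fl
      have h₂ := hq (hybridBits w (t n) u false (padBits r)) fl
      rcases b x <;> simp only [Bool.true_xor, Bool.false_xor, Bool.not_not] <;> linarith
    rw [Finset.sum_congr rfl fun r _ => hterm r, Finset.sum_sub_distrib, Finset.sum_add_distrib,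
      ← Finset.mul_sum,
      sum_update ⟨u, hu⟩ fun r => q (prefixBits f b (t n) u (f x) (padBits r)) fl, mul_sub, mul_add, hone, prefixMean, prefixMean]
    ring
  · rw [if_neg hu, add_zero]
    refine Eq.trans ?_ hone
    congr 1
    refine Finset.sum_congr rfl fun r _ => ?_
    have hw : ∀ g, hybridBits (iteratedGenerator f b t (f x)) (t n) u g (padBits r) =
        (List.range (t n)).map fun _ => false := by
      intro g
      simp only [hybridBits, if_neg hu]
    simp only [hw, Fintype.sum_bool]
    have h := hq ((List.range (t n)).map fun _ => false) (xor (b x) (xor true fl))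
    have e : (!(xor (b x) (xor true fl))) = xor (b x) (xor false fl) := by
      rcases b x <;> rcases fl <;> rfl
    rw [e] at h
    rw [h, mul_one]

/-- The success probability of the predictor in terms of the advantage of the distinguisher. -/
theorem uniformMean_hybrid (hq : ∀ w β, q w β + q w (!β) = 1) {t : ℕ → ℕ} {n : ℕ}
    (hf : Set.BijOn f {x | x.length = n} {x | x.length = n}) :
    uniformMean n (fun x => (1 / 2) ^ t n * ∑ r : Fin (t n) → Bool, 1 / 2 * ∑ g : Bool,
      1 / 2 ^ Nat.clog 2 (t n) * ∑ u ∈ Finset.range (2 ^ Nat.clog 2 (t n)),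
        q (hybridBits (iteratedGenerator f b t (f x)) (t n) u g (padBits r))
          (xor (b x) (xor g fl))) =
      1 / 2 + (uniformMean n (fun s => q (iteratedGenerator f b t s) fl) -
        uniformMean (t n) fun y => q y fl) / 2 ^ Nat.clog 2 (t n) := by
  have hT : t n ≤ 2 ^ Nat.clog 2 (t n) := Nat.le_pow_clog (by norm_num) _
  have hT₀ : (2 : ℝ) ^ Nat.clog 2 (t n) ≠ 0 := by positivity
  have hsub : (Finset.range (2 ^ Nat.clog 2 (t n))).filter (· < t n) = Finset.range (t n) := by
    ext u; simp; omega
  have hpoint : ∀ x : List Bool, x.length = n → (1 / 2 : ℝ) ^ t n * ∑ r : Fin (t n) → Bool, 1 / 2 * ∑ g : Bool,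
      1 / 2 ^ Nat.clog 2 (t n) * ∑ u ∈ Finset.range (2 ^ Nat.clog 2 (t n)),
        q (hybridBits (iteratedGenerator f b t (f x)) (t n) u g (padBits r))
          (xor (b x) (xor g fl)) = 1 / 2 + (∑ u ∈ Finset.range (t n),
            (prefixMean f b q fl (t n) (u + 1) x - prefixMean f b q fl (t n) u (f x))) /
              2 ^ Nat.clog 2 (t n) := by
    intro x hx
    have hcomm : (1 / 2 : ℝ) ^ t n * ∑ r : Fin (t n) → Bool, 1 / 2 * ∑ g : Bool,
        1 / 2 ^ Nat.clog 2 (t n) * ∑ u ∈ Finset.range (2 ^ Nat.clog 2 (t n)),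
          q (hybridBits (iteratedGenerator f b t (f x)) (t n) u g (padBits r))
            (xor (b x) (xor g fl)) = (∑ u ∈ Finset.range (2 ^ Nat.clog 2 (t n)),
          ((1 / 2) ^ t n * ∑ r : Fin (t n) → Bool, 1 / 2 * ∑ g : Bool,
            q (hybridBits (iteratedGenerator f b t (f x)) (t n) u g (padBits r))
              (xor (b x) (xor g fl)))) / 2 ^ Nat.clog 2 (t n) := by
      rw [Finset.sum_div]
      simp only [Finset.mul_sum, Finset.sum_div]
      conv_rhs => rw [Finset.sum_comm]
      refine Finset.sum_congr rfl fun r _ => ?_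
      conv_rhs => rw [Finset.sum_comm]
      refine Finset.sum_congr rfl fun g _ => Finset.sum_congr rfl fun u _ => ?_
      ring
    rw [hcomm, Finset.sum_congr rfl fun u _ => hybrid_term fl hq (hf.mapsTo hx) u,
      Finset.sum_add_distrib, ← Finset.sum_filter, hsub, Finset.sum_const, Finset.card_range,
      nsmul_eq_mul, add_div]
    push_cast
    rw [mul_div_cancel_left₀ _ hT₀]
  rw [uniformMean_congr hpoint, uniformMean_add, uniformMean_const, uniformMean_div,
    uniformMean_sum]
  -- The seed `f x` of the subtracted hybrid is as uniform as `x`, so the differences telescope.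
  have htel : ∀ u, uniformMean n (fun x => prefixMean f b q fl (t n) (u + 1) x -
      prefixMean f b q fl (t n) u (f x)) = uniformMean n (prefixMean f b q fl (t n) (u + 1)) -
        uniformMean n (prefixMean f b q fl (t n) u) := by
    intro u
    rw [uniformMean_sub, uniformMean_comp hf]
  rw [Finset.sum_congr rfl fun u _ => htel u,
    Finset.sum_range_sub fun u => uniformMean n (prefixMean f b q fl (t n) u)]
  congr 3
  · refine uniformMean_congr fun s hs => ?_
    have h : ∀ r : Fin (t n) → Bool, prefixBits f b (t n) (t n) s (padBits r) =
        iteratedGenerator f b t s := by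
      subst hs
      exact fun r => prefixBits_self t s _
    simp only [prefixMean, h]
    rw [Finset.sum_const, Finset.card_univ, Fintype.card_fun, Fintype.card_bool,
      Fintype.card_fin, nsmul_eq_mul]
    push_cast
    rw [← mul_assoc, ← mul_pow]
    norm_num
  · rw [← uniformMean_const n (uniformMean (t n) fun y => q y fl)]
    refine uniformMean_congr fun s _ => ?_
    simp only [prefixMean, prefixBits_zero, uniformMean]
    rw [one_div, inv_pow, inv_mul_eq_div]

end Hybrid

/-! ## Security of the generator -/

/-- For `t ≥ 2` the preceding power of two is smaller than `t`; for `t ≤ 1` the power is `1`, and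
the summand `1` is needed for `t = 0`. -/
theorem two_pow_clog_le (t : ℕ) : 2 ^ Nat.clog 2 t ≤ 2 * t + 1 := by
  rcases Nat.lt_or_ge 1 t with ht | ht
  · have h := Nat.pow_pred_clog_lt_self (b := 2) (by norm_num) ht
    obtain ⟨c, hc⟩ : ∃ c, Nat.clog 2 t = c + 1 :=
      ⟨_, (Nat.succ_pred_eq_of_pos (Nat.clog_pos (by norm_num) ht)).symm⟩
    rw [hc, Nat.pred_succ] at h
    rw [hc, pow_succ]
    omega
  · rw [Nat.clog_of_right_le_one ht]
    omega

theorem Negligible.abs {ε : ℕ → ℝ} (h : Negligible ε) : Negligible fun n => |ε n| :=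
  Asymptotics.SuperpolynomialDecay.trans_abs_le h fun n => (abs_abs (ε n)).le

/-- A negligible function multiplied by a polynomially bounded power of two is negligible. -/
theorem Negligible.two_pow_clog_mul {ε : ℕ → ℝ} (h : Negligible ε) {t : ℕ → ℕ}
    (ht : ∃ p : Polynomial ℚ, ∀ n : ℕ, 1 ≤ n → (t n : ℚ) = p.eval (n : ℚ)) :
    Negligible fun n => 2 ^ Nat.clog 2 (t n) * ε n := by
  obtain ⟨p, hp⟩ := ht
  have hp' : ∀ n : ℕ, 1 ≤ n → (t n : ℝ) = (p.map (algebraMap ℚ ℝ)).eval (n : ℝ) := by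
    intro n hn
    have : (n : ℝ) = algebraMap ℚ ℝ (n : ℚ) := by simp
    rw [this, Polynomial.eval_map, Polynomial.eval₂_at_apply, ← hp n hn]
    simp
  have hdec := h.polynomial_mul
    (2 * p.map (algebraMap ℚ ℝ) + 1)
  refine hdec.trans_eventually_abs_le ?_
  -- The polynomial describes `t` only from `1` on, which is enough for a statement about large `n`.
  filter_upwards [Filter.eventually_ge_atTop 1] with n hn
  rw [Function.comp_apply, Function.comp_apply, abs_mul, abs_mul]
  refine mul_le_mul_of_nonneg_right ?_ (abs_nonneg _)
  rw [abs_of_nonneg (by positivity)]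
  refine le_trans ?_ (le_abs_self _)
  have := two_pow_clog_le (t n)
  simp only [Polynomial.eval_add, Polynomial.eval_mul, Polynomial.eval_ofNat, Polynomial.eval_one]
  rw [← hp' n hn]
  exact_mod_cast this

/-- A `QPT` need not output a single bit. Where it does not, it never outputs `[true]`, and both
probabilities in the definition of the advantage vanish. -/
theorem QCircuit.prob_of_length_ne {c : QCircuit} (h : c.outs.length ≠ 1) (x : List Bool)
    (β : Bool) : c.prob x {[β]} = 0 := by
  refine Finset.sum_eq_zero fun z _ => if_neg fun hz => h ?_
  have := congrArg List.length (Set.mem_singleton_iff.1 hz)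
  simpa using this

section Security

variable {f : List Bool → List Bool} {b : List Bool → Bool} {t : ℕ → ℕ}

/-- A predictor for the hard-core predicate whose advantage is that of a given distinguisher,
divided by a power of two that is at most `2 t + 1`. -/
theorem exists_predictor_advantage (hf : ∀ n, Set.BijOn f {x | x.length = n} {x | x.length = n})
    (hG : PTComputable (iteratedGenerator f b t))
    (ht : ∃ p : Polynomial ℚ, ∀ n : ℕ, 1 ≤ n → (t n : ℚ) = p.eval (n : ℚ)) (D : QPT) (fl : Bool) :
    ∃ A : QPT, ∀ n, (D.circuit (t n)).outs.length = 1 →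
      uniformMean n (fun x => A.prob (withParam (f x) n) {[b x]}) =
        1 / 2 + (uniformMean n (fun s => D.prob (iteratedGenerator f b t s) {[fl]}) -
          uniformMean (t n) fun y => D.prob y {[fl]}) / 2 ^ Nat.clog 2 (t n) := by
  obtain ⟨cG, uG, wG, eG⟩ := hG
  have hGo : ∀ n, (cG n).outs.length = t n := by
    intro n
    have h := congrArg List.length (eG (List.replicate n false))
    rw [length_iteratedGenerator, BoolCircuit.eval, List.length_map, List.length_replicate] at h
    exact h
  obtain ⟨A, hA⟩ := exists_predictor fl uG D (fun B => NComp.of_rational_polynomial ht) wG hGo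
  refine ⟨A, fun n hn => ?_⟩
  obtain ⟨o, ho⟩ := List.length_eq_one_iff.1 hn
  have hG' : uniformMean n (fun s => D.prob (iteratedGenerator f b t s) {[fl]}) =
      uniformMean n fun s => (D.circuit (t n)).prob (iteratedGenerator f b t s) {[fl]} := by
    refine uniformMean_congr fun s hs => ?_
    rw [QPT.prob, length_iteratedGenerator, hs]
  have hU : uniformMean (t n) (fun y => D.prob y {[fl]}) =
      uniformMean (t n) fun y => (D.circuit (t n)).prob y {[fl]} := by
    refine uniformMean_congr fun y hy => ?_
    rw [QPT.prob, hy]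
  rw [hG', hU, ← uniformMean_hybrid fl (q := fun w β => (D.circuit (t n)).prob w {[β]})
    (QCircuit.prob_add_prob _ ho) (hf n)]
  refine uniformMean_congr fun x hx => ?_
  have hy : (f x).length = n := (hf n).mapsTo hx
  have hlen : (withParam (f x) n).length / 2 = n := by
    simp only [withParam, List.length_append, List.length_replicate, List.length_cons, hy]
    omega
  have he : iteratedGenerator f b t (f x) = (cG n).eval (f x) := by
    rw [← eG, hy]
  rw [QPT.prob, hA, hlen, he]
  exact predCircuit_prob (wG n) (hGo n) (D.le_width _) ho hy (b x)

/-- The predictor with `fl = true` bounds the signed advantage from above. With `fl = false` the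
verdict is complemented, which bounds it from below; together they bound the absolute value. -/
theorem security_iteratedGenerator (hf : ∀ n, Set.BijOn f {x | x.length = n} {x | x.length = n})
    (hG : PTComputable (iteratedGenerator f b t)) (hb : IsHardCore b f)
    (ht : ∃ p : Polynomial ℚ, ∀ n : ℕ, 1 ≤ n → (t n : ℚ) = p.eval (n : ℚ)) (D : QPT) :
    ∃ ε : ℕ → ℝ, Negligible ε ∧ ∀ n : ℕ,
      |uniformMean n (fun s => D.prob (iteratedGenerator f b t s) {[true]}) -
        uniformMean (t n) (fun y => D.prob y {[true]})| ≤ ε n := by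
  choose A hA using exists_predictor_advantage hf hG ht D
  choose ε hε hle using fun fl => hb.2 (A fl)
  have hsum : Negligible fun n => |ε true n| + |ε false n| :=
    Asymptotics.SuperpolynomialDecay.add (hε true).abs (hε false).abs
  refine ⟨_, hsum.two_pow_clog_mul ht, fun n => ?_⟩
  have hT : (0 : ℝ) < 2 ^ Nat.clog 2 (t n) := by positivity
  by_cases hn : (D.circuit (t n)).outs.length = 1
  · have hadv : ∀ fl, uniformMean n (fun s => D.prob (iteratedGenerator f b t s) {[fl]}) -
        uniformMean (t n) (fun y => D.prob y {[fl]}) ≤ 2 ^ Nat.clog 2 (t n) * ε fl n := by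
      intro fl
      have h := hle fl n
      rw [hA fl n hn] at h
      rw [← div_le_iff₀' hT]
      linarith
    obtain ⟨o, ho⟩ := List.length_eq_one_iff.1 hn
    have hneg : ∀ w, w.length = t n → D.prob w {[false]} = 1 - D.prob w {[true]} := by
      intro w hw
      rw [QPT.prob, QPT.prob, hw]
      exact eq_sub_of_add_eq ((add_comm _ _).trans (QCircuit.prob_add_prob _ ho w true))
    have h₁ := hadv true
    have h₀ := hadv false
    rw [uniformMean_congr fun s hs => hneg (iteratedGenerator f b t s)
        (by rw [length_iteratedGenerator, hs]),
      uniformMean_congr hneg, uniformMean_sub, uniformMean_sub, uniformMean_const,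
      uniformMean_const] at h₀
    have hle' : ∀ fl, 2 ^ Nat.clog 2 (t n) * ε fl n ≤
        2 ^ Nat.clog 2 (t n) * (|ε true n| + |ε false n|) := by
      intro fl
      refine mul_le_mul_of_nonneg_left ?_ hT.le
      have h₁ := le_abs_self (ε true n)
      have h₀ := le_abs_self (ε false n)
      have := abs_nonneg (ε true n)
      have := abs_nonneg (ε false n)
      cases fl <;> linarith
    refine abs_le.2 ⟨?_, h₁.trans (hle' true)⟩
    have := h₀.trans (hle' false)
    linarith
  · have hG' : uniformMean n (fun s => D.prob (iteratedGenerator f b t s) {[true]}) = 0 := by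
      rw [← uniformMean_const n 0]
      refine uniformMean_congr fun s hs => ?_
      rw [QPT.prob, length_iteratedGenerator, hs, QCircuit.prob_of_length_ne hn]
    have hU : uniformMean (t n) (fun y => D.prob y {[true]}) = 0 := by
      rw [← uniformMean_const (t n) 0]
      refine uniformMean_congr fun y hy => ?_
      rw [QPT.prob, hy, QCircuit.prob_of_length_ne hn]
    rw [hG', hU, sub_zero, abs_zero]
    positivity

end Security

end QuantumPRG

/-! ### Pseudorandomness of the iterated generator -/

theorem mainTheorem5 (f : List Bool → List Bool) (b : List Bool → Bool) (t : ℕ → ℕ)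
    (hf : QuantumPRG.IsQOWP f) (hb : QuantumPRG.IsHardCore b f)
    (ht : ∃ p : Polynomial ℚ, ∀ n : ℕ, 1 ≤ n → (t n : ℚ) = p.eval (n : ℚ)) :
    QuantumPRG.IsQPRG t (QuantumPRG.iteratedGenerator f b t) := by
  have hG : QuantumPRG.PTComputable (QuantumPRG.iteratedGenerator f b t) :=
    QuantumPRG.ptComputable_iteratedGenerator hf.1.1 (fun x => (hf.2 x.length).mapsTo rfl) hb.1 ht
  exact ⟨hG, QuantumPRG.length_iteratedGenerator t,
    QuantumPRG.security_iteratedGenerator hf.2 hG hb ht⟩
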